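/- Let $d,l,m\ge 0$, $k\ge 1$, $n=d+l$, let $E$ be a smooth $(n+m)$-dimensional manifold, $e\in E$, and let $\theta_k$ be a $k$-th order jet at $e$ of $n$-dimensional submanifolds of $E$. Let $\underline R\subset T_eE$ be its tangent plane, $N=T_eE/\underline R$, and let $J^{k+1}_{\theta_k}$ be the set of $(k+1)$-jets extending $\theta_k$, an affine space over the space $S^{k+1}\underline R^*\otimes N$ of homogeneous polynomial maps $\underline R\to N$ of degree $k+1$. For $\underline L\in\mathrm{Gr}(\underline R,l)$ let $\mu^p_{\underline L}\subset S^{k+1}\underline R^*\otimes N$ consist of the polynomials whose symmetric multilinear form vanishes whenever $p$ of its arguments lie in $\underline L$. Let $I=\mathrm{Gr}(\underline R,l)\times J^{k+1}_{\theta_k}$ (the space of integral flags). On $I$ there are the vertical distributions $\mathcal V^p_{(\underline L,\theta)}=0\oplus\mu^p_{\underline L}$ and the flag distributions $\mathcal F^p=\mathcal V^{p+1}+V\mathrm{pr}_n$, where $V\mathrm{pr}_n$ is tangent to the fibers of $I\to J^{k+1}_{\theta_k}$. Let $M^q$ be the space of leaves of $\mathcal V^{k+1-q}$, and $\underline{\mathcal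 F}^q$ the distribution on $M^q$ induced by $\mathcal F^{k+1-q}$. Thus $M^0=J^{k+1}_{\theta_k,l}$ is the bundle over $\mathrm{Gr}(\underline R,l)$ whose fiber over $\underline L$ is the quotient of $J^{k+1}_{\theta_k}$ by the relation that the difference of two jets vanishes on $\underline L$. For $\phi_1\in M^1$ with image $\phi_0\in M^0$ let $Q_{\phi_1}\subset T_{\phi_0}M^0$ be the image of $\underline{\mathcal F}^1_{\phi_1}$ under the tangent map of $M^1\to M^0$. Choose a basis $y_1,\dots,y_d,x_1,\dots,x_l$ of $\underline R^*$, a basis $e_1,\dots,e_m$ of $N$ and an origin $\theta_{\mathrm{orig}}\in J^{k+1}_{\theta_k}$. Over the set $U$ of those $\underline L$ that are transversal to $\bigcap_j\ker x_j$, a point of $J^{k+1}_{\theta_k,l}$ has coordinates $A_{i,j},v^h_\lambda$ ($\lambda\in\mathbb N^l$, $|\lambda|=k+1$), where $\underline L=\bigcap_i\ker(y_i-\sum_jA_{i,j}x_j)$ and the point is the class of $\theta_{\mathrm{orig}}+\sum_{\lambda,h}v^h_\lambda x^\lambda\otimes e_h$. On the space $J^1$ of 1-jets of local sections of $J^{k+1}_{\theta_k,l}\to\mathrm{Gr}(\underline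 R,l)$ this gives coordinates $A_{i,j},v^h_\lambda,\partial_{A_{i,j}}v^h_\lambda$. Then every $Q_{\phi_1}$ is the tangent plane of the graph of a section with a unique 1-jet at the base point of $\phi_1$, so that $\phi_1\mapsto Q_{\phi_1}$ may be viewed as a map $M^1\to J^1$. For every choice of the coordinates above, the part of the image of this map lying over $U$ is exactly the set of those 1-jets over $U$ that satisfy the infinitesimal pasting conditions: for all $i,j,j',h$ and all $\lambda,\lambda'$, $$\partial_{A_{i,j}}v^h_\lambda=\partial_{A_{i,j'}}v^h_{\lambda'}\quad\text{whenever }\lambda_j>0,\ \lambda'_{j'}>0\text{ and }\lambda-1_j=\lambda'-1_{j'},$$ $$\partial_{A_{i,j}}v^h_\lambda=0\quad\text{whenever }\lambda_j=0.$$ -/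

import Mathlib

open scoped Manifold ContDiff Topology

noncomputable section

namespace PolarJets

/-! ## Homogeneous polynomial maps -/

section Polynomials

variable {V W : Type*} [AddCommGroup V] [Module ℝ V] [AddCommGroup W] [Module ℝ W]

/-- Restriction to the diagonal of an `r`-multilinear map. -/
def diag (r : ℕ) : MultilinearMap ℝ (fun _ : Fin r => V) W →ₗ[ℝ] (V → W) where
  toFun T := fun x => T fun _ => x
  map_add' _ _ := rfl
  map_smul' _ _ := rfl

/-- `S^r V^* ⊗ W`, as the space of homogeneous polynomial maps `V → W` of degree `r`. -/
def HomPoly (V W : Type*) [AddCommGroup V] [Module ℝ V] [AddCommGroup W] [Module ℝ W]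
    (r : ℕ) : Submodule ℝ (V → W) :=
  LinearMap.range (diag (V := V) (W := W) r)

/-- `μ_L^p` inside `S^r V^* ⊗ W`: the homogeneous polynomials of degree `r` whose symmetric
multilinear form vanishes as soon as `p` of its arguments lie in `L`. -/
def mu (W : Type*) [AddCommGroup W] [Module ℝ W] (r : ℕ) (L : Submodule ℝ V) (p : ℕ) :
    Submodule ℝ (V → W) where
  carrier := {P | ∃ T : MultilinearMap ℝ (fun _ : Fin r => V) W,
    (∀ (σ : Equiv.Perm (Fin r)) (v : Fin r → V), T (v ∘ σ) = T v) ∧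
    (∀ (s : Finset (Fin r)) (v : Fin r → V), p ≤ s.card → (∀ i ∈ s, v i ∈ L) → T v = 0) ∧
    diag r T = P}
  zero_mem' := ⟨0, by simp, by simp, map_zero _⟩
  add_mem' := by
    rintro _ _ ⟨T, hT, hT', rfl⟩ ⟨S, hS, hS', rfl⟩
    refine ⟨T + S, fun σ v => ?_, fun s v hs hv => ?_, map_add _ _ _⟩
    · simp [hT σ v, hS σ v]
    · simp [hT' s v hs hv, hS' s v hs hv]
  smul_mem' := by
    rintro a _ ⟨T, hT, hT', rfl⟩
    refine ⟨a • T, fun σ v => ?_, fun s v hs hv => ?_, map_smul _ _ _⟩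
    · simp [hT σ v]
    · simp [hT' s v hs hv]

theorem mu_mono (r : ℕ) (L : Submodule ℝ V) {p p' : ℕ} (h : p ≤ p') :
    mu W r L p ≤ mu W r L p' := by
  rintro _ ⟨T, hT, hT', rfl⟩
  exact ⟨T, hT, fun s v hs hv => hT' s v (h.trans hs) hv, rfl⟩

theorem eq_zero_of_mem_mu {r : ℕ} {L : Submodule ℝ V} {p : ℕ} (hp : p ≤ r) {P : V → W}
    (hP : P ∈ mu W r L p) {x : V} (hx : x ∈ L) : P x = 0 := by
  obtain ⟨T, -, hT', rfl⟩ := hP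
  exact hT' Finset.univ (fun _ => x) (by simpa using hp) (fun _ _ => hx)

/-- The Grassmannian of `l`-dimensional subspaces. -/
def Gr (V : Type*) [AddCommGroup V] [Module ℝ V] (l : ℕ) : Type _ :=
  {L : Submodule ℝ V // Module.finrank ℝ L = l}

end Polynomials

/-! ## Jets of submanifolds -/

section Jets

variable {H : Type*} [NormedAddCommGroup H] [NormedSpace ℝ H]
  {E : Type*} [TopologicalSpace E] [ChartedSpace H E]

/-- A (parametrized) germ of an `n`-dimensional submanifold of `E` through `e`. -/
structure Germ (H : Type*) [NormedAddCommGroup H] [NormedSpace ℝ H]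
    {E : Type*} [TopologicalSpace E] [ChartedSpace H E] (n : ℕ) (e : E) where
  toFun : EuclideanSpace ℝ (Fin n) → E
  map_zero : toFun 0 = e
  smooth : ∀ᶠ x in 𝓝 (0 : EuclideanSpace ℝ (Fin n)), ContMDiffAt (𝓡 n) 𝓘(ℝ, H) ∞ toFun x
  immersive : Function.Injective (mfderiv (𝓡 n) 𝓘(ℝ, H) toFun 0)

variable {n : ℕ} {e : E}

/-- The germ written in the preferred chart of `E` at `e`. -/
def Germ.loc (g : Germ H n e) : EuclideanSpace ℝ (Fin n) → H :=
  extChartAt 𝓘(ℝ, H) e ∘ g.toFun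

/-- The derivative of the germ at the origin, as a map into `T_e E`. -/
def Germ.tangentMap (g : Germ H n e) :
    EuclideanSpace ℝ (Fin n) →L[ℝ] TangentSpace 𝓘(ℝ, H) e :=
  mfderiv (𝓡 n) 𝓘(ℝ, H) g.toFun 0

/-- Two germs of submanifolds have contact of order `k` if, after a reparametrization of the
first one, they agree up to `o(‖x‖^k)`, i.e. have the same Taylor polynomial of order `k`. -/
def Contact (k : ℕ) (g g' : Germ H n e) : Prop :=
  ∃ (φ : EuclideanSpace ℝ (Fin n) → EuclideanSpace ℝ (Fin n))
    (φ' : EuclideanSpace ℝ (Fin n) ≃L[ℝ] EuclideanSpace ℝ (Fin n)),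
    φ 0 = 0 ∧ ContDiffAt ℝ ∞ φ 0 ∧
    HasFDerivAt φ (φ' : EuclideanSpace ℝ (Fin n) →L[ℝ] EuclideanSpace ℝ (Fin n)) 0 ∧
    (fun x => g.loc (φ x) - g'.loc x) =o[𝓝 0] fun x => ‖x‖ ^ k

theorem isLittleO_comp_pow {H : Type*} [NormedAddCommGroup H] {n k : ℕ} {u : EuclideanSpace ℝ (Fin n) → H}
    {ψ : EuclideanSpace ℝ (Fin n) → EuclideanSpace ℝ (Fin n)}
    {ψ' : EuclideanSpace ℝ (Fin n) →L[ℝ] EuclideanSpace ℝ (Fin n)}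
    (hu : u =o[𝓝 0] fun x => ‖x‖ ^ k) (h0 : ψ 0 = 0) (hψ : HasFDerivAt ψ ψ' 0) :
    (fun x => u (ψ x)) =o[𝓝 0] fun x => ‖x‖ ^ k := by
  have ht : Filter.Tendsto ψ (𝓝 0) (𝓝 0) := by
    have := hψ.continuousAt.tendsto
    rwa [h0] at this
  have hO : ψ =O[𝓝 0] fun x => x := by
    have := hψ.isBigO_sub
    simp only [h0, sub_zero] at this
    exact this
  exact (hu.comp_tendsto ht).trans_isBigO (hO.norm_norm.pow k)

theorem Contact.refl (k : ℕ) (g : Germ H n e) : Contact k g g :=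
  ⟨id, ContinuousLinearEquiv.refl ℝ _, rfl, contDiffAt_id, hasFDerivAt_id 0, by
    simpa using Asymptotics.isLittleO_zero _ _⟩

theorem Contact.symm {k : ℕ} {g g' : Germ H n e} (h : Contact k g g') : Contact k g' g := by
  obtain ⟨φ, φ', h0, hs, hd, ho⟩ := h
  have hne : (∞ : WithTop ℕ∞) ≠ 0 := by simp
  have hinv0 : hs.localInverse hd hne 0 = 0 := by
    have := hs.localInverse_apply_image hd hne
    rwa [h0] at this
  have hsd : HasStrictFDerivAt φ
      (φ' : EuclideanSpace ℝ (Fin n) →L[ℝ] EuclideanSpace ℝ (Fin n)) 0 :=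
    hs.hasStrictFDerivAt' hd hne
  have hd' : HasFDerivAt (hs.localInverse hd hne)
      (φ'.symm : EuclideanSpace ℝ (Fin n) →L[ℝ] EuclideanSpace ℝ (Fin n)) 0 := by
    have := hsd.to_localInverse.hasFDerivAt
    rwa [h0] at this
  refine ⟨hs.localInverse hd hne, φ'.symm, hinv0, ?_, hd', ?_⟩
  · have := hs.to_localInverse hd hne
    rwa [h0] at this
  · have h1 := isLittleO_comp_pow ho hinv0 hd'
    have hr : ∀ᶠ y in 𝓝 (0 : EuclideanSpace ℝ (Fin n)), φ (hs.localInverse hd hne y) = y := by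
      have := hsd.eventually_right_inverse
      rwa [h0] at this
    refine h1.neg_left.congr' ?_ Filter.EventuallyEq.rfl
    filter_upwards [hr] with y hy
    rw [hy]
    abel

theorem Contact.trans {k : ℕ} {g₁ g₂ g₃ : Germ H n e} (h : Contact k g₁ g₂)
    (h' : Contact k g₂ g₃) : Contact k g₁ g₃ := by
  obtain ⟨φ, φ', h0, hs, hd, ho⟩ := h
  obtain ⟨ψ, ψ', h0', hs', hd', ho'⟩ := h'
  refine ⟨φ ∘ ψ, ψ'.trans φ', by simp [h0, h0'], ?_, ?_, ?_⟩
  · refine ContDiffAt.comp 0 ?_ hs'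
    rwa [h0']
  · rw [← h0'] at hd
    exact hd.comp 0 hd'
  · refine ((isLittleO_comp_pow ho h0' hd').add ho').congr_left fun x => ?_
    simp

theorem Contact.mono {k k' : ℕ} (hk : k ≤ k') {g g' : Germ H n e} (h : Contact k' g g') :
    Contact k g g' := by
  obtain ⟨φ, φ', h0, hs, hd, ho⟩ := h
  refine ⟨φ, φ', h0, hs, hd, ho.trans_isBigO ?_⟩
  refine Asymptotics.IsBigO.of_bound 1 ?_
  filter_upwards [Metric.ball_mem_nhds (0 : EuclideanSpace ℝ (Fin n)) one_pos] with x hx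
  have hx' : ‖x‖ ≤ 1 := by simpa using (Metric.mem_ball.1 hx).le
  simpa using pow_le_pow_of_le_one (norm_nonneg x) hx' hk

/-- Contact of order `k` is an equivalence relation. -/
def contactSetoid (H : Type*) [NormedAddCommGroup H] [NormedSpace ℝ H]
    {E : Type*} [TopologicalSpace E] [ChartedSpace H E] (n k : ℕ) (e : E) :
    Setoid (Germ H n e) where
  r := Contact k
  iseqv := ⟨Contact.refl k, Contact.symm, Contact.trans⟩

/-- The `k`-jets at `e` of `n`-dimensional submanifolds of `E`. -/
def Jet (H : Type*) [NormedAddCommGroup H] [NormedSpace ℝ H]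
    {E : Type*} [TopologicalSpace E] [ChartedSpace H E] (n k : ℕ) (e : E) : Type _ :=
  Quotient (contactSetoid H n k e)

/-- The jet of a germ. -/
def Germ.jet (g : Germ H n e) (k : ℕ) : Jet H n k e := Quotient.mk (contactSetoid H n k e) g

/-- The projection `π_{k+1,k}` forgetting the information of highest order. -/
def Jet.restrict {k : ℕ} : Jet H n (k + 1) e → Jet H n k e :=
  Quotient.map' id fun _ _ h => Contact.mono k.le_succ h

/-- The tangent plane `R ⊆ T_e E` of a jet of order `k ≥ 1`. All representatives of such a jet
have the same tangent plane, which is the supremum written here. -/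
def Jet.plane {k : ℕ} (θ : Jet H n k e) : Submodule ℝ (TangentSpace 𝓘(ℝ, H) e) :=
  ⨆ (g : Germ H n e) (_ : g.jet k = θ),
    LinearMap.range (g.tangentMap : EuclideanSpace ℝ (Fin n) →ₗ[ℝ] TangentSpace 𝓘(ℝ, H) e)

/-- The normal tangent space `N = T_e E / R` of a jet. -/
abbrev Jet.normal {k : ℕ} (θ : Jet H n k e) : Type _ := TangentSpace 𝓘(ℝ, H) e ⧸ θ.plane

/-- `J^{k+1}_θ`: the jets of order `k + 1` extending `θ`. -/
def Ext {k : ℕ} (θ : Jet H n k e) : Type _ := {θ' : Jet H n (k + 1) e // θ'.restrict = θ}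

/-- `IsDiff η' η P` says that `P = η' - η` for the affine structure of `J^{k+1}_θ` over
`S^{k+1} R^* ⊗ N`: there are representatives `g'` of `η'` and `g` of `η` with the same Taylor
polynomial of order `k`, and the difference of their Taylor terms of order `k + 1`, taken modulo
`R`, becomes `P` when the parameter space is identified with `R` by the derivative of `g`. -/
def IsDiff {k : ℕ} {θ : Jet H n k e} (η' η : Ext θ) (P : θ.plane → θ.normal) : Prop :=
  ∃ (g' g : Germ H n e) (τ : EuclideanSpace ℝ (Fin n) → H),
    g'.jet (k + 1) = η'.1 ∧ g.jet (k + 1) = η.1 ∧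
    τ ∈ HomPoly (EuclideanSpace ℝ (Fin n)) H (k + 1) ∧
    ((fun x => g'.loc x - g.loc x - τ x) =o[𝓝 0] fun x => ‖x‖ ^ (k + 1)) ∧
    ∀ (x : EuclideanSpace ℝ (Fin n)) (r : θ.plane),
      (r : TangentSpace 𝓘(ℝ, H) e) = g.tangentMap x →
        P r = θ.plane.mkQ (show TangentSpace 𝓘(ℝ, H) e from τ x)

/-- The translate `η + P`. -/
def Ext.add {k : ℕ} {θ : Jet H n k e} (η : Ext θ) (P : θ.plane → θ.normal) : Ext θ :=
  @Classical.epsilon _ ⟨η⟩ fun η' => IsDiff η' η P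

/-! ## Integral flags, the leaf spaces `M^q`, and partial jet extensions -/

/-- The space of integral flags, identified with `Gr(R, l) × J^{k+1}_θ`. -/
abbrev Flag {k : ℕ} (θ : Jet H n k e) (l : ℕ) : Type _ := Gr θ.plane l × Ext θ

/-- Two flags lie on the same leaf of the vertical distribution `V^p`. -/
def SameLeaf {k : ℕ} (θ : Jet H n k e) (l p : ℕ) (X Y : Flag θ l) : Prop :=
  X.1 = Y.1 ∧ ∃ P ∈ mu θ.normal (k + 1) X.1.1 p, IsDiff Y.2 X.2 P

/-- `M^q`, for `0 ≤ q ≤ k + 1`: the space of leaves of `V^p`, where `p = k + 1 - q`. -/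
def M {k : ℕ} (θ : Jet H n k e) (l q : ℕ) : Type _ := Quot (SameLeaf θ l (k + 1 - q))

/-- The projection of the space of flags onto `M^q`. -/
def toM {k : ℕ} {θ : Jet H n k e} {l : ℕ} (q : ℕ) (X : Flag θ l) : M θ l q := Quot.mk _ X

/-- Two flags `(L, η)`, `(L', η')` define the same partial extension of `θ` if `L = L'` and `η`,
`η'` are tangent of order `k + 1` in direction `L`, i.e. `η' - η` vanishes on `L`. -/
def SamePartial {k : ℕ} (θ : Jet H n k e) (l : ℕ) (X Y : Flag θ l) : Prop :=
  X.1 = Y.1 ∧ ∃ P, IsDiff Y.2 X.2 P ∧ ∀ r ∈ X.1.1, P r = 0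

/-- `J^{k+1}_{θ,l}`: the space of partial jet extensions of `θ` along `l`-dimensional
directions. -/
def PartialExt {k : ℕ} (θ : Jet H n k e) (l : ℕ) : Type _ := Quot (SamePartial θ l)

/-- The bundle projection `dir : J^{k+1}_{θ,l} → Gr(R, l)`. -/
def PartialExt.dir {k : ℕ} {θ : Jet H n k e} {l : ℕ} : PartialExt θ l → Gr θ.plane l :=
  Quot.lift (fun X => X.1) fun _ _ h => h.1

/-- The projection `M^q → M^0 = J^{k+1}_{θ,l}`. -/
def M.toPartial {k : ℕ} {θ : Jet H n k e} {l q : ℕ} : M θ l q → PartialExt θ l :=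
  Quot.map id fun _ _ ⟨h, P, hP, hd⟩ =>
    ⟨h, P, hd, fun _ hr => eq_zero_of_mem_mu (Nat.sub_le _ _) hP hr⟩

end Jets

/-! ## Local coordinates -/

section Coordinates

variable {H : Type*} [NormedAddCommGroup H] [NormedSpace ℝ H] [FiniteDimensional ℝ H]
  {E : Type*} [TopologicalSpace E] [ChartedSpace H E] {n k : ℕ} {e : E}

/-- The choices on which the local coordinates depend: a basis
`y_1, …, y_d, x_1, …, x_l` of `R^*` (so that `L_0` is the common kernel of the `y_i`), a basis
`e_1, …, e_m` of `N`, and an origin of `J^{k+1}_θ`. -/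
structure Coords (θ : Jet H n k e) (d l m : ℕ) where
  basis : Module.Basis (Fin d ⊕ Fin l) ℝ (Module.Dual ℝ θ.plane)
  normalBasis : Module.Basis (Fin m) ℝ θ.normal
  orig : Ext θ

/-- The multi-indices `(δ, λ) ∈ ℕ^d × ℕ^l` with `|δ| + |λ| = k + 1`. -/
abbrev Idx (k d l : ℕ) : Type :=
  {σ : Fin d ⊕ Fin l → ℕ // σ ∈ Finset.piAntidiag Finset.univ (k + 1)}

/-- The multi-indices `(δ, λ) ∈ ℕ^d × ℕ^l` with `|δ| + |λ| = k + 1` and `|δ| ≤ q`. -/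
abbrev IdxLe (k d l q : ℕ) : Type :=
  {σ : Fin d ⊕ Fin l → ℕ // σ ∈ (Finset.piAntidiag Finset.univ (k + 1)).filter
    fun σ => ∑ i, σ (Sum.inl i) ≤ q}

/-- The multi-indices `λ ∈ ℕ^l` with `|λ| = k + 1`. -/
abbrev IdxL (k l : ℕ) : Type := {ν : Fin l → ℕ // ν ∈ Finset.piAntidiag Finset.univ (k + 1)}

/-- Coordinates `A_{i,j}` on the Grassmannian. -/
abbrev GrCoord (d l : ℕ) : Type := Fin d → Fin l → ℝ

/-- Trivial coordinates `A_{i,j}, u^h_{δ,λ}` on the space of flags. -/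
abbrev FlagCoord (k d l m : ℕ) : Type := GrCoord d l × (Idx k d l → Fin m → ℝ)

/-- Adapted coordinates `A_{i,j}, v^h_{δ,λ}`, `|δ| ≤ q`, on `M^q`. -/
abbrev MCoord (k d l m q : ℕ) : Type := GrCoord d l × (IdxLe k d l q → Fin m → ℝ)

/-- The fibre coordinates `v^h_λ` on the bundle `J^{k+1}_{θ,l} → Gr(R, l)`. -/
abbrev FibreCoord (k l m : ℕ) : Type := IdxL k l → Fin m → ℝ

/-- The coordinates `A_{i,j}, v^h_λ` on `J^{k+1}_{θ,l}`. -/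
abbrev PartialCoord (k d l m : ℕ) : Type := GrCoord d l × FibreCoord k l m

variable {θ : Jet H n k e} {d l m : ℕ}

instance : FiniteDimensional ℝ (TangentSpace 𝓘(ℝ, H) e) :=
  inferInstanceAs (FiniteDimensional ℝ H)

namespace Coords

variable (c : Coords θ d l m)

/-- The covector `y_i`. -/
def y (i : Fin d) : Module.Dual ℝ θ.plane := c.basis (Sum.inl i)

/-- The covector `x_j`. -/
def x (j : Fin l) : Module.Dual ℝ θ.plane := c.basis (Sum.inr j)

/-- The covector `y_i - ∑ A_{i,j} x_j`. -/
def yA (A : GrCoord d l) (i : Fin d) : Module.Dual ℝ θ.plane := c.y i - ∑ j, A i j • c.x j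

/-- The subspace of `R` with coordinates `A`: the common kernel of the `y_i - ∑ A_{i,j} x_j`. -/
def subspaceAt (A : GrCoord d l) : Submodule ℝ θ.plane := ⨅ i, LinearMap.ker (c.yA A i)

theorem finrank_subspaceAt (A : GrCoord d l) : Module.finrank ℝ (c.subspaceAt A) = l := by
  classical
  let β := c.basis.dualBasis
  let ev := Module.evalEquiv ℝ θ.plane
  have hx : ∀ (w : Fin d ⊕ Fin l → ℝ) (s), c.basis s (ev.symm (∑ t, w t • β t)) = w s := by
    intro w s
    have : ev (ev.symm (∑ t, w t • β t)) (c.basis s) = w s := by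
      rw [LinearEquiv.apply_symm_apply]
      rcases s with i | j <;> simp [β, Finsupp.single_apply]
    simpa [ev] using this
  let f : c.subspaceAt A →ₗ[ℝ] (Fin l → ℝ) :=
    (LinearMap.pi fun j => c.x j) ∘ₗ (c.subspaceAt A).subtype
  have hmem : ∀ r : θ.plane, r ∈ c.subspaceAt A ↔ ∀ i, c.y i r = ∑ j, A i j * c.x j r := by
    intro r
    simp [subspaceAt, yA, sub_eq_zero]
  have hinj : Function.Injective f := by
    rw [← LinearMap.ker_eq_bot, LinearMap.ker_eq_bot']
    rintro ⟨r, hr⟩ h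
    have hxr : ∀ j, c.x j r = 0 := fun j => congrFun h j
    have hyr : ∀ i, c.y i r = 0 := fun i => by rw [(hmem r).1 hr i]; simp [hxr]
    have : ev r = 0 := by
      refine c.basis.ext fun s => ?_
      rcases s with i | j
      · exact hyr i
      · exact hxr j
    have : r = 0 := by simpa using this
    exact Subtype.ext this
  have hsurj : Function.Surjective f := by
    intro w
    refine ⟨⟨ev.symm (∑ t, (Sum.elim (fun i => ∑ j, A i j * w j) w) t • β t), ?_⟩, ?_⟩
    · rw [hmem]
      intro i
      simp only [y, x, hx, Sum.elim_inl, Sum.elim_inr]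
    · funext j
      exact hx _ (Sum.inr j)
  rw [(LinearEquiv.ofBijective f ⟨hinj, hsurj⟩).finrank_eq]
  simp

/-- The affine parametrization of the Grassmannian. -/
def gr (A : GrCoord d l) : Gr θ.plane l := ⟨c.subspaceAt A, c.finrank_subspaceAt A⟩

/-- The domain of the chart on the Grassmannian: the planes transversal to the complement
`⋂ ker x_j` of `L_0`. -/
def domain : Set (Gr θ.plane l) := {L | IsCompl L.1 (⨅ j, LinearMap.ker (c.x j))}

/-- The chart on the Grassmannian, inverse to `Coords.gr`. -/
def grChart : Gr θ.plane l → GrCoord d l := Function.invFun c.gr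

/-- The polynomial `∑ u^h_{δ,λ} (1 / (δ! λ!)) y^δ x^λ ⊗ e_h`. -/
def trivialPoly (u : Idx k d l → Fin m → ℝ) : θ.plane → θ.normal := fun r =>
  ∑ σ, ∑ h, (u σ h * ((∏ i, c.y i r ^ σ.1 (Sum.inl i) / (σ.1 (Sum.inl i)).factorial) *
    ∏ j, c.x j r ^ σ.1 (Sum.inr j) / (σ.1 (Sum.inr j)).factorial)) • c.normalBasis h

/-- The polynomial `∑ v^h_{δ,λ} (1 / δ!) (y - ∑ A x)^δ x^λ ⊗ e_h`. -/
def adaptedPoly (q : ℕ) (a : MCoord k d l m q) : θ.plane → θ.normal := fun r =>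
  ∑ σ, ∑ h, (a.2 σ h * ((∏ i, c.yA a.1 i r ^ σ.1 (Sum.inl i) / (σ.1 (Sum.inl i)).factorial) *
    ∏ j, c.x j r ^ σ.1 (Sum.inr j))) • c.normalBasis h

/-- The polynomial `∑ v^h_λ x^λ ⊗ e_h`. -/
def fibrePoly (v : FibreCoord k l m) : θ.plane → θ.normal := fun r =>
  ∑ ν, ∑ h, (v ν h * ∏ j, c.x j r ^ ν.1 j) • c.normalBasis h

/-- The point of the space of flags with given trivial coordinates. -/
def flagParam (a : FlagCoord k d l m) : Flag θ l := (c.gr a.1, c.orig.add (c.trivialPoly a.2))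

/-- The trivial coordinates of a flag. -/
def flagChart : Flag θ l → FlagCoord k d l m := Function.invFun c.flagParam

/-- The point of `M^q` with given adapted coordinates. -/
def mParam (q : ℕ) (a : MCoord k d l m q) : M θ l q :=
  toM q (c.gr a.1, c.orig.add (c.adaptedPoly q a))

/-- The adapted coordinates of a point of `M^q`. -/
def mChart (q : ℕ) : M θ l q → MCoord k d l m q := Function.invFun (c.mParam q)

/-- The partial extension with given coordinates `A_{i,j}, v^h_λ`. -/
def partialParam (a : PartialCoord k d l m) : PartialExt θ l :=
  Quot.mk _ (c.gr a.1, c.orig.add (c.fibrePoly a.2))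

/-- The coordinates `A_{i,j}, v^h_λ` of a partial extension. -/
def partialChart : PartialExt θ l → PartialCoord k d l m := Function.invFun c.partialParam

/-! ## Distributions, in coordinates

Tangent vectors at points over the chart domain are given by their components. -/

/-- The vertical distribution `V^p` at a flag: the vectors `0 ⊕ f` with `f ∈ μ_L^p`. -/
def vertical (p : ℕ) (X : Flag θ l) : Submodule ℝ (FlagCoord k d l m) where
  carrier := {w | w.1 = 0 ∧ c.trivialPoly w.2 ∈ mu θ.normal (k + 1) X.1.1 p}
  zero_mem' := by
    refine ⟨rfl, ?_⟩
    convert (mu θ.normal (k + 1) X.1.1 p).zero_mem using 1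
    funext r
    simp [trivialPoly]
  add_mem' := by
    rintro w w' ⟨h, hw⟩ ⟨h', hw'⟩
    refine ⟨by simp [h, h'], ?_⟩
    convert (mu θ.normal (k + 1) X.1.1 p).add_mem hw hw' using 1
    funext r
    simp [trivialPoly, add_mul, add_smul, Finset.sum_add_distrib]
  smul_mem' := by
    rintro a w ⟨h, hw⟩
    refine ⟨by simp [h], ?_⟩
    convert (mu θ.normal (k + 1) X.1.1 p).smul_mem a hw using 1
    funext r
    simp [trivialPoly, mul_assoc, mul_smul, Finset.smul_sum]

/-- The vertical distribution of the projection `pr_n` of the space of flags onto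
`J^{k+1}_θ`. -/
def verticalPrN (k d l m : ℕ) : Submodule ℝ (FlagCoord k d l m) :=
  LinearMap.ker (LinearMap.snd ℝ (GrCoord d l) (Idx k d l → Fin m → ℝ))

/-- The flag distribution `F^p = V^{p+1} + V pr_n`. -/
def flagDist (p : ℕ) (X : Flag θ l) : Submodule ℝ (FlagCoord k d l m) :=
  c.vertical (p + 1) X ⊔ verticalPrN k d l m

/-- The tangent map at `X` of the projection of the space of flags onto `M^q`. -/
def tangentToM (q : ℕ) (X : Flag θ l) : FlagCoord k d l m →L[ℝ] MCoord k d l m q :=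
  fderiv ℝ (c.mChart q ∘ toM q ∘ c.flagParam) (c.flagChart X)

/-- The reduction to `M^q` of the flag distribution `F^p`, where `p = k + 1 - q`: at `φ` it is the
image of the plane of `F^p` at any flag over `φ` (these images coincide, so that their
supremum is each of them). -/
def reducedDist (q : ℕ) (φ : M θ l q) : Submodule ℝ (MCoord k d l m q) :=
  ⨆ (X : Flag θ l) (_ : toM q X = φ),
    (c.flagDist (k + 1 - q) X).map
      (c.tangentToM q X : FlagCoord k d l m →ₗ[ℝ] MCoord k d l m q)

/-- The plane `Q_φ ⊆ T M^0`, for `φ ∈ M^1`: the image under the tangent map of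
`M^1 → M^0 = J^{k+1}_{θ,l}` of the plane at `φ` of the reduced flag distribution. -/
def qPlane (φ : M θ l 1) : Submodule ℝ (PartialCoord k d l m) :=
  (c.reducedDist 1 φ).map
    (fderiv ℝ (c.partialChart ∘ M.toPartial ∘ c.mParam 1) (c.mChart 1 φ) :
      MCoord k d l m 1 →ₗ[ℝ] PartialCoord k d l m)

/-- The functions `v^h_λ(A)` describing a section of partial extensions. -/
def sectionCoord (s : Gr θ.plane l → PartialExt θ l) (A : GrCoord d l) : FibreCoord k l m :=
  (c.partialChart (s (c.gr A))).2

end Coords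

/-! ## The first jet space of `J^{k+1}_{θ,l} → Gr(R, l)` -/

/-- A section of `J^{k+1}_{θ,l} → Gr(R, l)` that is smooth near `L`. (Away from `L` no regularity
is required, so that these are the local sections at `L`, extended arbitrarily.) -/
structure LocalSection (θ : Jet H n k e) (d l m : ℕ) where
  base : Gr θ.plane l
  toFun : Gr θ.plane l → PartialExt θ l
  isSection : ∀ L, (toFun L).dir = L
  smooth : ∀ c : Coords θ d l m, base ∈ c.domain →
    ∀ᶠ A in 𝓝 (c.grChart base), ContDiffAt ℝ ∞ (c.sectionCoord toFun) A

/-- Two local sections have the same 1-jet: they have the same base point, the same value and the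
same first derivatives there, in all the charts. -/
def jetSetoid (θ : Jet H n k e) (d l m : ℕ) : Setoid (LocalSection θ d l m) where
  r s t := s.base = t.base ∧ s.toFun s.base = t.toFun t.base ∧
    ∀ c : Coords θ d l m, s.base ∈ c.domain →
      fderiv ℝ (c.sectionCoord s.toFun) (c.grChart s.base) =
        fderiv ℝ (c.sectionCoord t.toFun) (c.grChart t.base)
  iseqv :=
    ⟨fun _ => ⟨rfl, rfl, fun _ _ => rfl⟩,
      fun ⟨h, h', h''⟩ => ⟨h.symm, h'.symm, fun c hc => (h'' c (h ▸ hc)).symm⟩,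
      fun ⟨h, h', h''⟩ ⟨g, g', g''⟩ =>
        ⟨h.trans g, h'.trans g', fun c hc => (h'' c hc).trans (g'' c (h ▸ hc))⟩⟩

/-- The first jet space of the bundle `J^{k+1}_{θ,l} → Gr(R, l)`. -/
def FirstJet (θ : Jet H n k e) (d l m : ℕ) : Type _ := Quotient (jetSetoid θ d l m)

/-- The base point in `Gr(R, l)` of a 1-jet of sections. -/
def FirstJet.base (j : FirstJet θ d l m) : Gr θ.plane l :=
  Quotient.lift (fun s : LocalSection θ d l m => s.base) (fun _ _ h => (show _ ∧ _ from h).1) j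

/-- The value in `J^{k+1}_{θ,l}` of a 1-jet of sections. -/
def FirstJet.value (j : FirstJet θ d l m) : PartialExt θ l :=
  Quotient.lift (fun s : LocalSection θ d l m => s.toFun s.base) (fun _ _ h => (show _ ∧ _ ∧ _ from h).2.1) j

open Classical in
/-- The first derivatives of a 1-jet of sections in the coordinates `c`; only used when the base
point lies in the domain of `c`. -/
def FirstJet.deriv (c : Coords θ d l m) (j : FirstJet θ d l m) :
    GrCoord d l →L[ℝ] FibreCoord k l m :=
  Quotient.lift (fun s : LocalSection θ d l m =>
      if s.base ∈ c.domain then fderiv ℝ (c.sectionCoord s.toFun) (c.grChart s.base) else 0)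
    (fun s t h => by
      by_cases hs : s.base ∈ c.domain
      · have ht : t.base ∈ c.domain := h.1 ▸ hs
        simpa only [hs, ht, if_true] using h.2.2 c hs
      · have ht : t.base ∉ c.domain := h.1 ▸ hs
        simp only [hs, ht, if_false]) j

/-- The coordinate `∂_{A_{i,j}} v^h_λ` on the first jet space. -/
def FirstJet.partialDeriv (c : Coords θ d l m) (J : FirstJet θ d l m) (i : Fin d) (j : Fin l)
    (ν : IdxL k l) (h : Fin m) : ℝ :=
  J.deriv c (Pi.single i (Pi.single j 1)) ν h

/-- The horizontal plane in `T J^{k+1}_{θ,l}` defined by a 1-jet of sections, i.e. the tangent plane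
of the graph of a section, in the coordinates `c`. -/
def FirstJet.plane (c : Coords θ d l m) (J : FirstJet θ d l m) :
    Submodule ℝ (PartialCoord k d l m) :=
  LinearMap.graph (J.deriv c : GrCoord d l →ₗ[ℝ] FibreCoord k l m)

/-- The 1-jet `J` of sections corresponds to the plane `Q_φ`: it sits at the image of `φ` in
`J^{k+1}_{θ,l}`, and its horizontal plane is `Q_φ`, in all local coordinates at that point. -/
def Represents (J : FirstJet θ d l m) (φ : M θ l 1) : Prop :=
  J.value = φ.toPartial ∧ ∀ c : Coords θ d l m, J.base ∈ c.domain → J.plane c = c.qPlane φ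

/-- The infinitesimal pasting conditions in the coordinates `c`. -/
def PastingConditions (c : Coords θ d l m) (J : FirstJet θ d l m) : Prop :=
  (∀ (i : Fin d) (j j' : Fin l) (ν ν' : IdxL k l) (h : Fin m),
    0 < ν.1 j → 0 < ν'.1 j' → ν.1 - Pi.single j 1 = ν'.1 - Pi.single j' 1 →
      J.partialDeriv c i j ν h = J.partialDeriv c i j' ν' h) ∧
  ∀ (i : Fin d) (j : Fin l) (ν : IdxL k l) (h : Fin m),
    ν.1 j = 0 → J.partialDeriv c i j ν h = 0

end Coordinates

end PolarJets

end

/-! Subtracting a fixed origin identifies `J^{k+1}_θ` with the homogeneous polynomials P : R → N of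
degree k + 1. A single extension η of θ defines a section L ↦ [(L, η)] of J^{k+1}_{θ,l} → Gr(R, l).
In a chart this section is A ↦ the coefficients, in the x_j, of P restricted to the plane L_A
(`fibreCoef`). The theorem rests on two computations of its derivative.

The plane Q is tangent to the graph of this section. In coordinates the projection from flags to M^0
is (A, u) ↦ (A, `fibreCoef` of P_u at A). For M^1 the flag distribution is F^k = V^{k+1} + V pr_n:
the first summand is killed, since its polynomials vanish on L, and the second, where only A moves,
gives the graph of the derivative (`map_flagDist`). Flags over the same point of M^1 differ by an
element of μ_L^k, which vanishes to second order along L and so does not change the derivative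
(`fderiv_fibreCoef_congr`). Hence `qPlane_toM`.

Now expand P in the coordinates (y - A x, x), with coefficients w_{δ,λ}. Tilting the plane in the
direction A_{i,j} turns the i-th of the y - A x into t x_j, so only terms linear in it contribute:
∂_{A_{i,j}} v_λ = w_{1_i, λ - 1_j}, and 0 if λ_j = 0 (`fderiv_fibreCoef_single`). This gives the
pasting conditions. Conversely, they say that the derivatives depend only on i and λ - 1_j, so that
values and derivatives assemble into the coefficients with |δ| ≤ 1 of a polynomial
(`exists_coefficients`), that is, into a point of M^1.

Two supports are needed: the affine structure of `J^{k+1}_θ`, defined through representatives, must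
be well behaved (`isDiff_iff`), and 1-jets agreeing in one chart must agree in all
(`FirstJet.ext_of_chart`). -/

noncomputable section

set_option linter.unusedSectionVars false

namespace PolarJets

/-! ### Homogeneous polynomial maps: smoothness, growth and vanishing. -/

section HomogeneousAnalysis

open Asymptotics

theorem multilinear_expand {V W ι : Type*} [AddCommGroup V] [Module ℝ V] [AddCommGroup W]
    [Module ℝ W] [Fintype ι] {r : ℕ} (b : Module.Basis ι ℝ V)
    (T : MultilinearMap ℝ (fun _ : Fin r => V) W) (v : Fin r → V) :
    T v = ∑ f : Fin r → ι, (∏ i, b.repr (v i) (f i)) • T fun i => b (f i) := by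
  classical
  have h : v = fun i => ∑ j, b.repr (v i) j • b j := funext fun i => (b.sum_repr (v i)).symm
  conv_lhs => rw [h]
  rw [MultilinearMap.map_sum]
  exact Finset.sum_congr rfl fun f _ => T.map_smul_univ _ _

variable {E F : Type*} [NormedAddCommGroup E] [NormedSpace ℝ E] [NormedAddCommGroup F]
  [NormedSpace ℝ F]

theorem multilinear_continuous [FiniteDimensional ℝ E] {r : ℕ}
    (T : MultilinearMap ℝ (fun _ : Fin r => E) F) : Continuous T := by
  have h : (T : (Fin r → E) → F) = fun v => ∑ f : Fin r → Fin (Module.finrank ℝ E),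
      (∏ i, (Module.finBasis ℝ E).repr (v i) (f i)) •
        T fun i => (Module.finBasis ℝ E) (f i) :=
    funext fun v => multilinear_expand _ T v
  rw [h]
  refine continuous_finsetSum _ fun f _ => Continuous.smul ?_ continuous_const
  refine continuous_finsetProd _ fun i _ => ?_
  exact ((Module.finBasis ℝ E).coord (f i)).continuous_of_finiteDimensional.comp
    (continuous_apply i)

theorem HomPoly.map_smul {V W : Type*} [AddCommGroup V] [Module ℝ V] [AddCommGroup W]
    [Module ℝ W] {r : ℕ} {P : V → W} (hP : P ∈ HomPoly V W r) (t : ℝ) (x : V) :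
    P (t • x) = t ^ r • P x := by
  obtain ⟨T, rfl⟩ := hP
  simpa [diag] using T.map_smul_univ (fun _ => t) fun _ => x

theorem HomPoly.map_zero {V W : Type*} [AddCommGroup V] [Module ℝ V] [AddCommGroup W]
    [Module ℝ W] {r : ℕ} (hr : r ≠ 0) {P : V → W} (hP : P ∈ HomPoly V W r) : P 0 = 0 := by
  simpa [hr] using HomPoly.map_smul hP 0 0

theorem HomPoly.comp_linear {V V' W W' : Type*} [AddCommGroup V] [Module ℝ V] [AddCommGroup W]
    [Module ℝ W] [AddCommGroup V'] [Module ℝ V'] [AddCommGroup W'] [Module ℝ W'] {r : ℕ}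
    {P : V → W} (hP : P ∈ HomPoly V W r) (f : V' →ₗ[ℝ] V) (g : W →ₗ[ℝ] W') :
    (fun x => g (P (f x))) ∈ HomPoly V' W' r := by
  obtain ⟨T, rfl⟩ := hP
  exact ⟨(g.compMultilinearMap T).compLinearMap fun _ => f, rfl⟩

theorem HomPoly.exists_continuous [FiniteDimensional ℝ E] {r : ℕ} {P : E → F}
    (hP : P ∈ HomPoly E F r) :
    ∃ T : ContinuousMultilinearMap ℝ (fun _ : Fin r => E) F, ∀ x, P x = T fun _ => x := by
  obtain ⟨T, rfl⟩ := hP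
  exact ⟨⟨T, multilinear_continuous T⟩, fun _ => rfl⟩

theorem HomPoly.contDiff [FiniteDimensional ℝ E] {r : ℕ} {P : E → F}
    (hP : P ∈ HomPoly E F r) {N : WithTop ℕ∞} : ContDiff ℝ N P := by
  obtain ⟨T, hT⟩ := HomPoly.exists_continuous hP
  rw [funext hT]
  exact T.contDiff.comp (contDiff_pi.2 fun _ => contDiff_id)

theorem HomPoly.isBigO [FiniteDimensional ℝ E] {r : ℕ} {P : E → F}
    (hP : P ∈ HomPoly E F r) (l : Filter E) : P =O[l] fun x => ‖x‖ ^ r := by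
  obtain ⟨T, hT⟩ := HomPoly.exists_continuous hP
  refine IsBigO.of_bound ‖T‖ (Filter.Eventually.of_forall fun x => ?_)
  rw [hT]
  simpa using T.le_opNorm fun _ => x

/-- A homogeneous polynomial map composed with a differentiable map agrees, up to terms of higher
order, with its composition with the derivative. -/
theorem HomPoly.comp_sub_isLittleO {E' : Type*} [NormedAddCommGroup E'] [NormedSpace ℝ E']
    [FiniteDimensional ℝ E] {r : ℕ} (hr : r ≠ 0) {P : E → F} (hP : P ∈ HomPoly E F r)
    {φ : E' → E} {φ' : E' →L[ℝ] E} (h0 : φ 0 = 0) (hφ : HasFDerivAt φ φ' 0) :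
    (fun x => P (φ x) - P (φ' x)) =o[𝓝 0] fun x => ‖x‖ ^ r := by
  obtain ⟨T, hT⟩ := HomPoly.exists_continuous hP
  have hd : (fun x => φ x - φ' x) =o[𝓝 0] fun x => x := by
    simpa [h0] using hφ.isLittleO
  have hO : φ =O[𝓝 0] fun x => x := by simpa [h0] using hφ.isBigO_sub
  have hO' : (fun x => φ' x) =O[𝓝 0] fun x => x := φ'.isBigO_id _
  have hm : (fun x => max ‖φ x‖ ‖φ' x‖) =O[𝓝 0] fun x => ‖x‖ := by
    obtain ⟨c, hc⟩ := hO.bound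
    obtain ⟨c', hc'⟩ := hO'.bound
    refine IsBigO.of_bound (max c c') ?_
    filter_upwards [hc, hc'] with x hx hx'
    have h1 : c * ‖x‖ ≤ max c c' * ‖x‖ := by gcongr; exact le_max_left _ _
    have h2 : c' * ‖x‖ ≤ max c c' * ‖x‖ := by gcongr; exact le_max_right _ _
    rw [norm_norm, Real.norm_of_nonneg (le_max_of_le_left (norm_nonneg _))]
    exact max_le (hx.trans h1) (hx'.trans h2)
  have key : (fun x => max ‖φ x‖ ‖φ' x‖ ^ (r - 1) * ‖φ x - φ' x‖) =o[𝓝 0] fun x => ‖x‖ ^ r := by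
    have := (hm.pow (r - 1)).mul_isLittleO hd.norm_norm
    refine this.congr_right fun x => ?_
    rw [← pow_succ, Nat.sub_add_cancel (Nat.one_le_iff_ne_zero.2 hr)]
  refine (IsBigO.of_bound (‖T‖ * r) (Filter.Eventually.of_forall fun x => ?_)).trans_isLittleO key
  rw [hT, hT]
  refine (T.norm_image_sub_le _ _).trans_eq ?_
  have : Nonempty (Fin r) := ⟨⟨0, Nat.pos_of_ne_zero hr⟩⟩
  have h1 : (fun _ : Fin r => φ x) - (fun _ => φ' x) = fun _ => φ x - φ' x := rfl
  rw [h1, pi_norm_const, pi_norm_const, pi_norm_const, Fintype.card_fin, mul_assoc,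
    Real.norm_of_nonneg (by positivity)]

/-- Along a ray P(t x) = t^r P(x); dividing by t^r leaves a constant that must tend to zero. -/
theorem HomPoly.eq_zero_of_isLittleO {r : ℕ} {P : E → F} (hP : P ∈ HomPoly E F r)
    (h : P =o[𝓝 0] fun x => ‖x‖ ^ r) : P = 0 := by
  funext x
  have ht : Filter.Tendsto (fun t : ℝ => t • x) (𝓝[≠] 0) (𝓝 0) := by
    have : Filter.Tendsto (fun t : ℝ => t • x) (𝓝 0) (𝓝 ((0 : ℝ) • x)) :=
      (continuous_id.smul continuous_const).tendsto 0
    rw [zero_smul] at this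
    exact this.mono_left nhdsWithin_le_nhds
  have h1 : (fun t : ℝ => t ^ r • P x) =o[𝓝[≠] 0] fun t : ℝ => t ^ r := by
    have := (h.comp_tendsto ht).congr_left (f₂ := fun t : ℝ => t ^ r • P x) fun t =>
      HomPoly.map_smul hP t x
    refine this.trans_isBigO (IsBigO.of_bound (‖x‖ ^ r) (Filter.Eventually.of_forall fun t => ?_))
    simp [norm_smul, mul_pow, mul_comm]
  have h2 : (fun _ : ℝ => P x) =o[𝓝[≠] (0 : ℝ)] fun _ : ℝ => (1 : ℝ) := by
    have h3 := (isBigO_refl (fun t : ℝ => (t ^ r)⁻¹) (𝓝[≠] 0)).smul_isLittleO h1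
    refine h3.congr' ?_ ?_
    · filter_upwards [self_mem_nhdsWithin] with t ht
      rw [smul_smul, inv_mul_cancel₀ (pow_ne_zero _ ht), one_smul]
    · filter_upwards [self_mem_nhdsWithin] with t ht
      rw [smul_eq_mul, inv_mul_cancel₀ (pow_ne_zero _ ht)]
  simpa using (isLittleO_const_const_iff.1 h2)

theorem isLittleO_norm_pow_of_le {E : Type*} [NormedAddCommGroup E] {r s : ℕ} (h : r < s) :
    (fun x : E => ‖x‖ ^ s) =o[𝓝 0] fun x => ‖x‖ ^ r := by
  have := (isLittleO_pow_pow (𝕜 := ℝ) h).comp_tendsto (tendsto_norm_zero (E := E))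
  exact this

theorem isBigO_norm_pow_of_le {E : Type*} [NormedAddCommGroup E] {r s : ℕ} (h : r ≤ s) :
    (fun x : E => ‖x‖ ^ s) =O[𝓝 0] fun x => ‖x‖ ^ r := by
  rcases h.lt_or_eq with h | rfl
  · exact (isLittleO_norm_pow_of_le h).isBigO
  · exact isBigO_refl _ _

end HomogeneousAnalysis

/-! ### Taylor's formula and the leading term of a small function. -/

section Taylor

open Asymptotics

universe u v

/-- Taylor's formula with Peano's remainder, in several variables. -/
theorem exists_taylor (r : ℕ) : ∀ {E : Type u} {F : Type max u v} [NormedAddCommGroup E]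
    [NormedSpace ℝ E] [NormedAddCommGroup F] [NormedSpace ℝ F] {f : E → F},
    ContDiffAt ℝ r f 0 → ∃ p : ℕ → E → F, (∀ j, p j ∈ HomPoly E F j) ∧
      (fun x => f x - ∑ j ∈ Finset.range (r + 1), p j x) =o[𝓝 0] fun x => ‖x‖ ^ r := by
  induction r with
  | zero =>
    intro E F _ _ _ _ f hf
    refine ⟨fun j => if j = 0 then fun _ => f 0 else 0, fun j => ?_, ?_⟩
    · rcases eq_or_ne j 0 with rfl | hj
      · exact ⟨MultilinearMap.constOfIsEmpty ℝ _ (f 0), by ext; simp [diag]⟩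
      · simp [hj]
    · simp only [zero_add, Finset.range_one, Finset.sum_singleton, if_true, pow_zero]
      rw [isLittleO_one_iff]
      have := hf.continuousAt.tendsto.sub_const (f 0)
      simpa using this
  | succ r ih =>
    -- The target ranges over `Type max u v` so that the induction hypothesis applies to `E →L[ℝ]
    -- F`. Integrating the term `q j` of the derivative along the ray from 0 to x gives `q j x x /
    -- (j + 1)`, of degree j + 1.
    intro E F _ _ _ _ f hf
    obtain ⟨q, hq, ho⟩ := ih (hf.fderiv_right (m := r) (by norm_cast))
    choose T hT using hq
    have hTq : ∀ j x, q j x = T j fun _ => x := fun j x => (congrFun (hT j) x).symm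
    let L : (E →L[ℝ] F) →ₗ[ℝ] (E →ₗ[ℝ] F) := ContinuousLinearMap.coeLM ℝ
    have hp : ∀ j, (fun x => ((j : ℝ) + 1)⁻¹ • q j x x) ∈ HomPoly E F (j + 1) := fun j =>
      (HomPoly E F (j + 1)).smul_mem _
        ⟨MultilinearMap.uncurryRight (M := fun _ => E) (L.compMultilinearMap (T j)), by
          funext x
          simp only [diag, LinearMap.coe_mk, AddHom.coe_mk, MultilinearMap.uncurryRight_apply, hTq]
          rfl⟩
    refine ⟨fun j => Nat.casesOn j (fun _ => f 0) fun j x => ((j : ℝ) + 1)⁻¹ • q j x x,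
      fun j => ?_, ?_⟩
    · cases j with
      | zero => exact ⟨MultilinearMap.constOfIsEmpty ℝ _ (f 0), by ext; simp [diag]⟩
      | succ j => exact hp j
    · have hdiff : ∀ᶠ y in 𝓝 (0 : E), DifferentiableAt ℝ f y := by
        have h1 : ContDiffAt ℝ 1 f 0 := hf.of_le (by norm_cast; omega)
        filter_upwards [h1.eventually (by simp)] with y hy
        exact hy.differentiableAt (by simp)
      rw [isLittleO_iff] at ho ⊢
      intro ε hε
      obtain ⟨δ, hδ, hb⟩ := Metric.eventually_nhds_iff_ball.1 (hdiff.and (ho hε))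
      filter_upwards [Metric.ball_mem_nhds (0 : E) hδ] with x hx
      rw [mem_ball_zero_iff] at hx
      -- The remainder along the segment from 0 to x, without its constant term. Its derivative is
      -- the Taylor remainder of `fderiv ℝ f` at `t • x` applied to x, so the mean value inequality
      -- bounds the increment.
      let w : ℝ → F := fun t => f (t • x) -
        ∑ j ∈ Finset.range (r + 1), t ^ (j + 1) • ((j : ℝ) + 1)⁻¹ • q j x x
      let w' : ℝ → F := fun t => fderiv ℝ f (t • x) x -
        ∑ j ∈ Finset.range (r + 1), t ^ j • q j x x
      have hmem : ∀ t ∈ Set.Icc (0 : ℝ) 1, t • x ∈ Metric.ball (0 : E) δ := by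
        intro t ht
        rw [mem_ball_zero_iff, norm_smul, Real.norm_of_nonneg ht.1]
        exact (mul_le_of_le_one_left (norm_nonneg _) ht.2).trans_lt hx
      have hw : ∀ t ∈ Set.Icc (0 : ℝ) 1, HasDerivWithinAt w (w' t) (Set.Icc 0 1) t := by
        intro t ht
        refine HasDerivAt.hasDerivWithinAt (HasDerivAt.sub ?_ ?_)
        · have h1 : HasDerivAt (fun t : ℝ => t • x) x t := by
            simpa using (hasDerivAt_id t).smul_const x
          exact ((hb _ (hmem t ht)).1.hasFDerivAt).comp_hasDerivAt t h1
        · refine HasDerivAt.fun_sum fun j _ => ?_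
          have h2 := (hasDerivAt_pow (j + 1) t).smul_const (((j : ℝ) + 1)⁻¹ • q j x x)
          convert h2 using 1
          rw [smul_smul]
          congr 1
          push_cast
          have : (j : ℝ) + 1 ≠ 0 := by positivity
          field_simp
      have hbd : ∀ t ∈ Set.Ico (0 : ℝ) 1, ‖w' t‖ ≤ ε * ‖x‖ ^ r * ‖x‖ := by
        intro t ht
        have ht' : t ∈ Set.Icc (0 : ℝ) 1 := ⟨ht.1, ht.2.le⟩
        have h3 := (hb _ (hmem t ht')).2
        have h4 : w' t = (fderiv ℝ f (t • x) -
            ∑ j ∈ Finset.range (r + 1), q j (t • x)) x := by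
          simp only [w', sub_apply, sum_apply]
          congr 1
          refine Finset.sum_congr rfl fun j _ => ?_
          rw [HomPoly.map_smul ⟨T j, hT j⟩]
          rfl
        rw [h4]
        refine (ContinuousLinearMap.le_opNorm _ _).trans ?_
        gcongr
        refine h3.trans ?_
        rw [Real.norm_of_nonneg (by positivity), norm_smul, Real.norm_of_nonneg ht.1]
        have := mul_le_of_le_one_left (norm_nonneg x) ht.2.le
        have := mul_nonneg ht.1 (norm_nonneg x)
        gcongr
      have := norm_image_sub_le_of_norm_deriv_le_segment_01' hw hbd
      rw [Real.norm_of_nonneg (by positivity : (0 : ℝ) ≤ ‖x‖ ^ (r + 1)), pow_succ, ← mul_assoc]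
      refine le_trans (le_of_eq ?_) this
      congr 1
      rw [Finset.sum_range_succ' _ (r + 1)]
      simp only [w, one_smul, zero_smul, one_pow, sub_sub]
      simp

/-- A smooth function of order `o(‖x‖ ^ r)` agrees up to `o(‖x‖ ^ (r + 1))` with a homogeneous
polynomial. -/
theorem exists_homPoly_of_isLittleO {E : Type u} {F : Type max u v} [NormedAddCommGroup E]
    [NormedSpace ℝ E] [FiniteDimensional ℝ E] [NormedAddCommGroup F] [NormedSpace ℝ F] {f : E → F}
    {r : ℕ} (hf : ContDiffAt ℝ (r + 1 : ℕ) f 0) (h : f =o[𝓝 0] fun x => ‖x‖ ^ r) :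
    ∃ τ ∈ HomPoly E F (r + 1), (fun x => f x - τ x) =o[𝓝 0] fun x => ‖x‖ ^ (r + 1) := by
  obtain ⟨p, hp, ho⟩ := exists_taylor.{u, v} (r + 1) hf
  -- Once the terms of degree below j vanish, `p j` is itself o(‖x‖^j), hence zero.
  have hz : ∀ j, j < r + 1 → p j = 0 := by
    intro j
    induction j using Nat.strong_induction_on with
    | _ j ih =>
      intro hj
      refine HomPoly.eq_zero_of_isLittleO (hp j) ?_
      have h1 : (fun x => ∑ i ∈ Finset.range (r + 1 + 1), p i x) =o[𝓝 0] fun x => ‖x‖ ^ j := by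
        have := (h.trans_isBigO (isBigO_norm_pow_of_le (by omega : j ≤ r))).sub
          (ho.trans_isBigO (isBigO_norm_pow_of_le (by omega : j ≤ r + 1)))
        refine this.congr_left fun x => ?_
        abel
      have h2 : (fun x => ∑ i ∈ (Finset.range (r + 1 + 1)).erase j, p i x) =o[𝓝 0]
          fun x => ‖x‖ ^ j := by
        refine IsLittleO.fun_sum fun i hi => ?_
        rcases lt_or_gt_of_ne (Finset.ne_of_mem_erase hi) with hij | hij
        · rw [ih i hij (by omega)]
          exact isLittleO_zero _ _
        · exact (HomPoly.isBigO (hp i) _).trans_isLittleO (isLittleO_norm_pow_of_le hij)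
      refine (h1.sub h2).congr_left fun x => ?_
      rw [← Finset.add_sum_erase _ _ (Finset.mem_range.2 (by omega : j < r + 1 + 1))]
      abel
  refine ⟨p (r + 1), hp _, ho.congr_left fun x => ?_⟩
  rw [Finset.sum_range_succ, Finset.sum_eq_zero fun j hj => by
    rw [hz j (Finset.mem_range.1 hj)]; rfl, zero_add]

end Taylor

/-! ### First-order estimates near the origin. -/

section Asymptotic

open Asymptotics

variable {E F G : Type*} [NormedAddCommGroup E] [NormedSpace ℝ E] [NormedAddCommGroup F]
  [NormedSpace ℝ F] [NormedAddCommGroup G] [NormedSpace ℝ G]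

theorem comp_sub_isLittleO {E : Type*} [NormedAddCommGroup E] {f : F → G} {f' : F →L[ℝ] G} (hf : HasStrictFDerivAt f f' 0)
    {φ ψ : E → F} (hφ : Filter.Tendsto φ (𝓝 0) (𝓝 0)) (hψ : Filter.Tendsto ψ (𝓝 0) (𝓝 0)) :
    (fun x => f (φ x) - f (ψ x) - f' (φ x - ψ x)) =o[𝓝 0] fun x => φ x - ψ x :=
  hf.isLittleO.comp_tendsto (hφ.prodMk_nhds hψ)

/-- An injective linear map from a finite-dimensional space is bounded below, and the error of the
linear approximation is of smaller order than φ - ψ, hence absorbed. For immersions this turns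
closeness of images into closeness of parameters. -/
theorem sub_isBigO_comp_sub {E : Type*} [NormedAddCommGroup E] [FiniteDimensional ℝ F] {f : F → G} {f' : F →L[ℝ] G}
    (hf : HasStrictFDerivAt f f' 0) (hinj : Function.Injective f')
    {φ ψ : E → F} (hφ : Filter.Tendsto φ (𝓝 0) (𝓝 0)) (hψ : Filter.Tendsto ψ (𝓝 0) (𝓝 0)) :
    (fun x => φ x - ψ x) =O[𝓝 0] fun x => f (φ x) - f (ψ x) := by
  obtain ⟨K, -, hK⟩ := f'.toLinearMap.injective_iff_antilipschitz.1 hinj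
  have h1 : (fun x => φ x - ψ x) =O[𝓝 0] fun x => f' (φ x - ψ x) :=
    IsBigO.of_bound K (Filter.Eventually.of_forall fun x => by
      simpa using hK.le_mul_dist (φ x - ψ x) 0)
  have h2 := (comp_sub_isLittleO hf hφ hψ).trans_isBigO h1
  refine h1.trans ?_
  refine (h2.right_isBigO_add).congr_right fun x => ?_
  abel

theorem fderiv_eq_zero_of_isBigO {f : E → F} {f' : E →L[ℝ] F} (h0 : f 0 = 0)
    (hf : HasFDerivAt f f' 0) {r : ℕ} (hr : 1 < r) (h : f =O[𝓝 0] fun x => ‖x‖ ^ r) :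
    f' = 0 := by
  refine hf.unique ?_
  rw [hasFDerivAt_iff_isLittleO_nhds_zero]
  simp only [zero_add, h0, sub_zero, zero_apply]
  have := h.trans_isLittleO (isLittleO_norm_pow_of_le hr)
  simp only [pow_one] at this
  exact isLittleO_norm_right.1 this

theorem HomPoly.hasFDerivAt_zero [FiniteDimensional ℝ E] {r : ℕ} (hr : 1 < r) {P : E → F}
    (hP : P ∈ HomPoly E F r) : HasFDerivAt P (0 : E →L[ℝ] F) 0 := by
  have h0 := HomPoly.map_zero (by omega) hP
  have hd : HasFDerivAt P (fderiv ℝ P 0) 0 :=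
    ((HomPoly.contDiff hP (N := 1)).differentiable (by simp) 0).hasFDerivAt
  rwa [fderiv_eq_zero_of_isBigO h0 hd hr (HomPoly.isBigO hP _)] at hd

end Asymptotic

/-! ### Germs in the chart, translated germs, comparison of leading terms. -/

section AffineStructure

open Asymptotics

variable {H : Type*} [NormedAddCommGroup H] [NormedSpace ℝ H]
  {E : Type*} [TopologicalSpace E] [ChartedSpace H E] {n k : ℕ} {e : E}

/-- The derivative at the origin of a germ written in the chart. -/
def Germ.dloc (g : Germ H n e) : EuclideanSpace ℝ (Fin n) →L[ℝ] H := g.tangentMap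

theorem Germ.dloc_injective (g : Germ H n e) : Function.Injective g.dloc := g.immersive

theorem Germ.loc_zero (g : Germ H n e) : g.loc 0 = extChartAt 𝓘(ℝ, H) e e := by
  simp [Germ.loc, g.map_zero]

theorem Germ.contMDiffAt (g : Germ H n e) : ContMDiffAt (𝓡 n) 𝓘(ℝ, H) ∞ g.toFun 0 :=
  g.smooth.self_of_nhds

/-- The preferred chart at `e` is the one that identifies the tangent space at `e` with `H`, so no
transition map appears. -/
theorem mfderiv_eq_fderiv_chart {f : EuclideanSpace ℝ (Fin n) → E} (h0 : f 0 = e)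
    (hf : MDifferentiableAt (𝓡 n) 𝓘(ℝ, H) f 0) :
    (show EuclideanSpace ℝ (Fin n) →L[ℝ] H from mfderiv (𝓡 n) 𝓘(ℝ, H) f 0) =
      fderiv ℝ (extChartAt 𝓘(ℝ, H) e ∘ f) 0 := by
  subst h0
  rw [hf.mfderiv]
  simp only [writtenInExtChartAt, mfld_simps]
  rw [fderivWithin_univ]
  rfl

theorem Ext.jet_eq {θ : Jet H n k e} {η : Ext θ} {g : Germ H n e} (h : g.jet (k + 1) = η.1) :
    g.jet k = θ := by
  rw [← η.2, ← h]
  rfl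

theorem Ext.exists_germ {θ : Jet H n k e} (η : Ext θ) : ∃ g : Germ H n e, g.jet (k + 1) = η.1 :=
  Quotient.exists_rep η.1

variable [IsManifold 𝓘(ℝ, H) ∞ E]

theorem Germ.eventually_contDiffAt (g : Germ H n e) :
    ∀ᶠ x in 𝓝 (0 : EuclideanSpace ℝ (Fin n)), ContDiffAt ℝ ∞ g.loc x := by
  have hs : ∀ᶠ x in 𝓝 (0 : EuclideanSpace ℝ (Fin n)), g.toFun x ∈ (chartAt H e).source := by
    have h1 : (chartAt H e).source ∈ 𝓝 (g.toFun 0) := by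
      rw [g.map_zero]
      exact chart_source_mem_nhds H e
    exact g.contMDiffAt.continuousAt h1
  filter_upwards [g.smooth, hs] with x hx hx'
  exact ((contMDiffAt_extChartAt' hx').comp x hx).contDiffAt

theorem Germ.hasStrictFDerivAt (g : Germ H n e) : HasStrictFDerivAt g.loc g.dloc 0 := by
  have h1 : ContDiffAt ℝ ∞ g.loc 0 := g.eventually_contDiffAt.self_of_nhds
  have h2 : g.dloc = fderiv ℝ g.loc 0 :=
    mfderiv_eq_fderiv_chart g.map_zero (g.contMDiffAt.mdifferentiableAt (by simp))
  rw [h2]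
  exact h1.hasStrictFDerivAt (by simp)

/-- The difference is o(‖x‖^k) with k ≥ 1, hence has zero derivative at the origin; the chain rule
does the rest. This matches the two identifications of the parameter space with R. -/
theorem Contact.dloc_comp (hk : 1 ≤ k) {g g' : Germ H n e}
    {φ : EuclideanSpace ℝ (Fin n) → EuclideanSpace ℝ (Fin n)}
    {φ' : EuclideanSpace ℝ (Fin n) →L[ℝ] EuclideanSpace ℝ (Fin n)} (h0 : φ 0 = 0)
    (hd : HasFDerivAt φ φ' 0)
    (ho : (fun x => g.loc (φ x) - g'.loc x) =o[𝓝 0] fun x => ‖x‖ ^ k) :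
    g.dloc.comp φ' = g'.dloc := by
  have h1 : HasFDerivAt (fun x => g.loc (φ x)) (g.dloc.comp φ') 0 := by
    refine HasFDerivAt.comp (g := g.loc) 0 ?_ hd
    rw [h0]
    exact g.hasStrictFDerivAt.hasFDerivAt
  have h2 := h1.sub g'.hasStrictFDerivAt.hasFDerivAt
  refine sub_eq_zero.1 (h2.unique ?_)
  rw [hasFDerivAt_iff_isLittleO_nhds_zero]
  have h3 := ho.trans_isBigO (isBigO_norm_pow_of_le hk)
  simp only [pow_one] at h3
  simpa [h0, g.loc_zero, g'.loc_zero] using isLittleO_norm_right.1 h3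

/-- By `Contact.dloc_comp` the tangent map of any other representative factors through that of `g`,
so the supremum defining the plane is already attained at `g`. -/
theorem Germ.plane_jet (hk : 1 ≤ k) (g : Germ H n e) :
    (g.jet k).plane = LinearMap.range (g.tangentMap.toLinearMap) := by
  refine le_antisymm (iSup₂_le fun h hh => ?_) (le_iSup₂_of_le g rfl le_rfl)
  obtain ⟨φ, φ', h0, -, hd, ho⟩ : Contact k g h := Quotient.exact hh.symm
  have := Contact.dloc_comp hk h0 hd ho
  rintro _ ⟨x, rfl⟩
  exact ⟨φ' x, congrArg (fun A : EuclideanSpace ℝ (Fin n) →L[ℝ] H => A x) this⟩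

theorem Germ.mem_plane_iff (hk : 1 ≤ k) {θ : Jet H n k e} (g : Germ H n e) (hg : g.jet k = θ)
    (r : H) : (show TangentSpace 𝓘(ℝ, H) e from r) ∈ θ.plane ↔ ∃ x, g.dloc x = r := by
  rw [← hg, g.plane_jet hk]
  exact Iff.rfl


theorem Germ.eventually_add_mem_target (g : Germ H n e) {τ : EuclideanSpace ℝ (Fin n) → H}
    (hτ : ContinuousAt τ 0) (h0 : τ 0 = 0) :
    ∀ᶠ x in 𝓝 (0 : EuclideanSpace ℝ (Fin n)),
      g.loc x + τ x ∈ (extChartAt 𝓘(ℝ, H) e).target := by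
  have : ContinuousAt (fun x => g.loc x + τ x) 0 := g.hasStrictFDerivAt.continuousAt.add hτ
  refine this ?_
  change _ ∈ 𝓝 (g.loc 0 + τ 0)
  rw [h0, add_zero, g.loc_zero]
  exact extChartAt_target_mem_nhds e

theorem Germ.chart_comp_symm_add (g : Germ H n e) {τ : EuclideanSpace ℝ (Fin n) → H}
    (hτ : ContinuousAt τ 0) (h0 : τ 0 = 0) :
    (extChartAt 𝓘(ℝ, H) e ∘ fun x => (extChartAt 𝓘(ℝ, H) e).symm (g.loc x + τ x)) =ᶠ[𝓝 0]
      fun x => g.loc x + τ x := by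
  filter_upwards [g.eventually_add_mem_target hτ h0] with x hx
  exact (extChartAt 𝓘(ℝ, H) e).right_inv hx

theorem Germ.eventually_contMDiffAt_symm_add (g : Germ H n e)
    {τ : EuclideanSpace ℝ (Fin n) → H} (hτ : ContDiff ℝ ∞ τ) (h0 : τ 0 = 0) :
    ∀ᶠ x in 𝓝 (0 : EuclideanSpace ℝ (Fin n)), ContMDiffAt (𝓡 n) 𝓘(ℝ, H) ∞
      (fun x => (extChartAt 𝓘(ℝ, H) e).symm (g.loc x + τ x)) x := by
  filter_upwards [g.eventually_add_mem_target hτ.continuous.continuousAt h0,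
    g.eventually_contDiffAt] with x hx hx'
  have h2 : ContMDiffAt 𝓘(ℝ, H) 𝓘(ℝ, H) ∞ (extChartAt 𝓘(ℝ, H) e).symm (g.loc x + τ x) :=
    (contMDiffOn_extChartAt_symm e).contMDiffAt ((isOpen_extChartAt_target e).mem_nhds hx)
  exact ContMDiffAt.comp x h2 (hx'.add hτ.contDiffAt).contMDiffAt

/-- The germ obtained by adding a homogeneous polynomial `τ` of degree at least two to a germ, in
the preferred chart. -/
def Germ.translate (g : Germ H n e) {r : ℕ} (hr : 1 < r) (τ : EuclideanSpace ℝ (Fin n) → H)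
    (hτ : τ ∈ HomPoly (EuclideanSpace ℝ (Fin n)) H r) : Germ H n e where
  toFun x := (extChartAt 𝓘(ℝ, H) e).symm (g.loc x + τ x)
  map_zero := by simp [HomPoly.map_zero (by omega) hτ, g.loc_zero]
  smooth := g.eventually_contMDiffAt_symm_add (HomPoly.contDiff hτ)
    (HomPoly.map_zero (by omega) hτ)
  immersive := by
    have h0 := HomPoly.map_zero (by omega) hτ
    have hs := (g.eventually_contMDiffAt_symm_add (HomPoly.contDiff hτ) h0).self_of_nhds
    have h1 := mfderiv_eq_fderiv_chart (e := e) (by simp [h0, g.loc_zero])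
      (hs.mdifferentiableAt (by simp))
    have h2 := (g.chart_comp_symm_add (HomPoly.contDiff hτ (N := 0)).continuous.continuousAt
      h0).fderiv_eq.trans (g.hasStrictFDerivAt.hasFDerivAt.add
        (HomPoly.hasFDerivAt_zero hr hτ)).fderiv
    rw [add_zero] at h2
    have h3 := h1.trans h2
    intro x y hxy
    refine g.dloc_injective ?_
    rw [← h3]
    exact hxy

theorem Germ.translate_loc (g : Germ H n e) {r : ℕ} (hr : 1 < r)
    {τ : EuclideanSpace ℝ (Fin n) → H} (hτ : τ ∈ HomPoly (EuclideanSpace ℝ (Fin n)) H r) :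
    (g.translate hr τ hτ).loc =ᶠ[𝓝 0] fun x => g.loc x + τ x :=
  g.chart_comp_symm_add (HomPoly.contDiff hτ (N := 0)).continuous.continuousAt
    (HomPoly.map_zero (by omega) hτ)

theorem Germ.translate_sub_isLittleO (g : Germ H n e) {r : ℕ} (hr : 1 < r)
    {τ : EuclideanSpace ℝ (Fin n) → H} (hτ : τ ∈ HomPoly (EuclideanSpace ℝ (Fin n)) H r) (s : ℕ) :
    (fun x => (g.translate hr τ hτ).loc x - g.loc x - τ x) =o[𝓝 0] fun x => ‖x‖ ^ s := by
  refine (isLittleO_zero _ _).congr' ?_ Filter.EventuallyEq.rfl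
  filter_upwards [g.translate_loc hr hτ] with x hx
  rw [hx]
  abel

theorem Germ.translate_jet (g : Germ H n e) (hk : 1 ≤ k)
    {τ : EuclideanSpace ℝ (Fin n) → H} (hτ : τ ∈ HomPoly (EuclideanSpace ℝ (Fin n)) H (k + 1)) :
    (g.translate (by omega) τ hτ).jet k = g.jet k := by
  refine Quotient.sound (s := contactSetoid H n k e)
    ⟨id, ContinuousLinearEquiv.refl ℝ _, rfl, contDiffAt_id, hasFDerivAt_id 0, ?_⟩
  have h1 := (g.translate_sub_isLittleO (by omega) hτ k).add
    ((HomPoly.isBigO hτ (𝓝 0)).trans_isLittleO (isLittleO_norm_pow_of_le k.lt_succ_self))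
  refine h1.congr_left fun x => ?_
  simp

theorem exists_leftInverse [FiniteDimensional ℝ H] {F : Type*} [NormedAddCommGroup F]
    [NormedSpace ℝ F] {f : F →L[ℝ] H} (hf : Function.Injective f) :
    ∃ S : H →L[ℝ] F, ∀ x, S (f x) = x := by
  obtain ⟨S, hS⟩ := f.toLinearMap.exists_leftInverse_of_injective (LinearMap.ker_eq_bot.2 hf)
  exact ⟨LinearMap.toContinuousLinearMap S, fun x => LinearMap.congr_fun hS x⟩

/-- Comparison of the leading terms of the difference of two jets for two choices of
representatives. -/
theorem leading_term_sub_mem_range [FiniteDimensional ℝ H] (hk : 1 ≤ k)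
    {g g' h h' : Germ H n e} {τ ρ : EuclideanSpace ℝ (Fin n) → H}
    (hτ : τ ∈ HomPoly (EuclideanSpace ℝ (Fin n)) H (k + 1))
    (hρ : ρ ∈ HomPoly (EuclideanSpace ℝ (Fin n)) H (k + 1))
    (hg : (fun x => g'.loc x - g.loc x - τ x) =o[𝓝 0] fun x => ‖x‖ ^ (k + 1))
    (hh : (fun x => h'.loc x - h.loc x - ρ x) =o[𝓝 0] fun x => ‖x‖ ^ (k + 1))
    {φ φ₁ : EuclideanSpace ℝ (Fin n) → EuclideanSpace ℝ (Fin n)}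
    {φ' φ₁' : EuclideanSpace ℝ (Fin n) →L[ℝ] EuclideanSpace ℝ (Fin n)}
    (h0 : φ 0 = 0) (hd : HasFDerivAt φ φ' 0)
    (ho : (fun x => g.loc (φ x) - h.loc x) =o[𝓝 0] fun x => ‖x‖ ^ (k + 1))
    (h0₁ : φ₁ 0 = 0) (hd₁ : HasFDerivAt φ₁ φ₁' 0)
    (ho₁ : (fun x => g'.loc (φ₁ x) - h'.loc x) =o[𝓝 0] fun x => ‖x‖ ^ (k + 1)) :
    ∀ x, ∃ z, g.dloc z = ρ x - τ (φ' x) := by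
  have ht : Filter.Tendsto φ (𝓝 0) (𝓝 0) := by simpa [h0] using hd.continuousAt.tendsto
  have ht₁ : Filter.Tendsto φ₁ (𝓝 0) (𝓝 0) := by simpa [h0₁] using hd₁.continuousAt.tendsto
  -- Modulo o(‖x‖^(k+1)): g'∘φ₁ ≈ h' ≈ h + ρ ≈ g∘φ + ρ, while also g'∘φ₁ ≈ g∘φ₁ + τ∘φ₁'.
  have e1 : (fun x => g.loc (φ₁ x) - g.loc (φ x) - (ρ x - τ (φ₁' x))) =o[𝓝 0]
      fun x => ‖x‖ ^ (k + 1) := by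
    have a1 := isLittleO_comp_pow hg h0₁ hd₁
    have a2 := HomPoly.comp_sub_isLittleO k.succ_ne_zero hτ h0₁ hd₁
    refine ((((hh.sub a1).add ho₁).sub ho).sub a2).congr_left fun x => ?_
    abel
  have e2 : (fun x => g.loc (φ₁ x) - g.loc (φ x)) =O[𝓝 0] fun x => ‖x‖ ^ (k + 1) := by
    have b1 := HomPoly.isBigO hρ (𝓝 0)
    have b2 := HomPoly.isBigO (HomPoly.comp_linear hτ φ₁'.toLinearMap LinearMap.id) (𝓝 0)
    refine (e1.isBigO.add (b1.sub b2)).congr_left fun x => ?_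
    simp
  -- Since g is immersive, φ₁ - φ = O(‖x‖^(k+1)). As k + 1 > 1 the two derivatives agree, and g∘φ₁ -
  -- g∘φ is, to leading order, the tangent vector `g.dloc (φ₁ x - φ x)`.
  have e3 := (sub_isBigO_comp_sub g.hasStrictFDerivAt g.dloc_injective ht₁ ht).trans e2
  have e4 := (comp_sub_isLittleO g.hasStrictFDerivAt ht₁ ht).trans_isBigO e3
  have hφ : φ₁' = φ' := sub_eq_zero.1
    (fderiv_eq_zero_of_isBigO (by simp [h0, h0₁]) (hd₁.sub hd) (by omega) e3)
  subst hφ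
  obtain ⟨S, hS⟩ := exists_leftInverse g.dloc_injective
  have hP : (fun x => ρ x - τ (φ₁' x)) ∈ HomPoly (EuclideanSpace ℝ (Fin n)) H (k + 1) :=
    (HomPoly (EuclideanSpace ℝ (Fin n)) H (k + 1)).sub_mem hρ (HomPoly.comp_linear hτ φ₁'.toLinearMap LinearMap.id)
  -- A projection killing exactly the tangent vectors of g; applied to the leading term it leaves a
  -- homogeneous polynomial of higher order than its degree, hence zero.
  let q : H →L[ℝ] H := ContinuousLinearMap.id ℝ H - g.dloc.comp S
  have hq : ∀ v, q v = v - g.dloc (S v) := fun v => rfl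
  have hz : (fun x => q (ρ x - τ (φ₁' x))) = 0 := by
    refine HomPoly.eq_zero_of_isLittleO (HomPoly.comp_linear hP LinearMap.id q.toLinearMap) ?_
    refine ((q.isBigO_comp _ _).trans_isLittleO (e4.sub e1)).congr_left fun x => ?_
    rw [_root_.map_sub, _root_.map_sub, hq (g.loc (φ₁ x) - g.loc (φ x) - _)]
    simp [hq, hS]
    abel
  intro x
  refine ⟨S (ρ x - τ (φ₁' x)), ?_⟩
  have := congrFun hz x
  simp only [hq, Pi.zero_apply] at this
  exact (sub_eq_zero.1 this).symm

end AffineStructure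

/-! ### The affine structure of `J^{k+1}_θ`. -/

section AffineStructure

open Asymptotics

variable {H : Type*} [NormedAddCommGroup H] [NormedSpace ℝ H] [FiniteDimensional ℝ H]
  {E : Type*} [TopologicalSpace E] [ChartedSpace H E] [IsManifold 𝓘(ℝ, H) ∞ E]
  {n k : ℕ} {e : E} {θ : Jet H n k e}

/-- The class in `N` of a tangent vector at `e`. -/
def Jet.toNormal (θ : Jet H n k e) : H →ₗ[ℝ] θ.normal := θ.plane.mkQ

omit [FiniteDimensional ℝ H] in
theorem toNormal_eq_iff (hk : 1 ≤ k) {g : Germ H n e} (hg : g.jet k = θ) (v w : H) :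
    θ.toNormal v = θ.toNormal w ↔ ∃ z, g.dloc z = v - w := by
  rw [← g.mem_plane_iff hk hg]
  exact Submodule.Quotient.eq _

omit [FiniteDimensional ℝ H] [IsManifold 𝓘(ℝ, H) ∞ E] in
theorem exists_lift_toNormal (r : ℕ) (g : Germ H n e) {P : θ.plane → θ.normal}
    (hP : P ∈ HomPoly θ.plane θ.normal r) (hg : ∀ x, g.tangentMap x ∈ θ.plane) :
    ∃ τ ∈ HomPoly (EuclideanSpace ℝ (Fin n)) H r,
      ∀ x, θ.toNormal (τ x) = P ⟨g.tangentMap x, hg x⟩ := by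
  obtain ⟨S, hS⟩ := θ.plane.mkQ.exists_rightInverse_of_surjective (Submodule.range_mkQ _)
  exact ⟨_, HomPoly.comp_linear hP (g.tangentMap.toLinearMap.codRestrict θ.plane hg)
    (show θ.normal →ₗ[ℝ] H from S), fun x => LinearMap.congr_fun hS _⟩

/-- The linear parametrization by `R` of the parameter space of a germ with tangent plane `R`. -/
theorem exists_plane_inverse (hk : 1 ≤ k) {g : Germ H n e} (hg : g.jet k = θ) :
    ∃ S : θ.plane →ₗ[ℝ] EuclideanSpace ℝ (Fin n),
      (∀ r : θ.plane, g.dloc (S r) = (r : TangentSpace 𝓘(ℝ, H) e)) ∧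
      ∀ (x) (r : θ.plane), (r : TangentSpace 𝓘(ℝ, H) e) = g.tangentMap x → S r = x := by
  obtain ⟨S, hS⟩ := exists_leftInverse g.dloc_injective
  have h2 : ∀ (x) (r : θ.plane), (r : TangentSpace 𝓘(ℝ, H) e) = g.tangentMap x →
      S (r : TangentSpace 𝓘(ℝ, H) e) = x := fun x r hr => by
    rw [hr]
    exact hS x
  refine ⟨(show TangentSpace 𝓘(ℝ, H) e →ₗ[ℝ] EuclideanSpace ℝ (Fin n) from S.toLinearMap) ∘ₗ
    θ.plane.subtype, fun r => ?_, h2⟩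
  obtain ⟨x, hx⟩ := (g.mem_plane_iff hk hg _).1 r.2
  exact (congrArg g.dloc (h2 x r hx.symm)).trans hx

omit [FiniteDimensional ℝ H] in
theorem tangentMap_mem_plane (hk : 1 ≤ k) {g : Germ H n e} (hg : g.jet k = θ) (x) :
    g.tangentMap x ∈ θ.plane :=
  (g.mem_plane_iff hk hg _).2 ⟨x, rfl⟩

theorem IsDiff.mem_homPoly (hk : 1 ≤ k) {η' η : Ext θ} {P : θ.plane → θ.normal}
    (h : IsDiff η' η P) : P ∈ HomPoly θ.plane θ.normal (k + 1) := by
  obtain ⟨g', g, τ, -, hg, hτ, -, hP⟩ := h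
  obtain ⟨S, hS, -⟩ := exists_plane_inverse hk (Ext.jet_eq hg)
  have : P = fun r => θ.toNormal (τ (S r)) := funext fun r => hP _ _ (hS r).symm
  rw [this]
  exact HomPoly.comp_linear hτ S θ.toNormal

/-- Changing representatives alters the leading term, once the parameters are matched, only by
tangent vectors (`leading_term_sub_mem_range`), which vanish in N. -/
theorem IsDiff.unique (hk : 1 ≤ k) {η' η : Ext θ} {P Q : θ.plane → θ.normal}
    (hP : IsDiff η' η P) (hQ : IsDiff η' η Q) : P = Q := by
  obtain ⟨g', g, τ, hg', hg, hτ, hgo, hgP⟩ := hP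
  obtain ⟨h', h, ρ, hh', hh, hρ, hho, hhQ⟩ := hQ
  obtain ⟨φ, φ', h0, -, hd, ho⟩ : Contact (k + 1) g h := Quotient.exact (hg.trans hh.symm)
  obtain ⟨φ₁, φ₁', h0₁, -, hd₁, ho₁⟩ : Contact (k + 1) g' h' :=
    Quotient.exact (hg'.trans hh'.symm)
  have hl := leading_term_sub_mem_range hk hτ hρ hgo hho h0 hd ho h0₁ hd₁ ho₁
  have hdl := Contact.dloc_comp (by omega) h0 hd ho
  funext r
  obtain ⟨x, hx⟩ := (h.mem_plane_iff hk (Ext.jet_eq hh) _).1 r.2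
  rw [hhQ x r hx.symm, hgP (φ' x) r (by rw [← hdl] at hx; exact hx.symm)]
  exact ((toNormal_eq_iff hk (Ext.jet_eq hg) _ _).2 (hl x)).symm

/-- If the leading terms τ and ρ have the same class in N, their discrepancy D = ρ - τ∘φ' is
tangent. A tangential discrepancy can be absorbed by reparametrization: φ is corrected by the
polynomial S∘D, which g maps to D to leading order. -/
theorem IsDiff.left_unique (hk : 1 ≤ k) {η₁ η₂ η : Ext θ} {P : θ.plane → θ.normal}
    (h₁ : IsDiff η₁ η P) (h₂ : IsDiff η₂ η P) : η₁ = η₂ := by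
  obtain ⟨g', g, τ, hg', hg, hτ, hgo, hgP⟩ := h₁
  obtain ⟨h', h, ρ, hh', hh, hρ, hho, hhP⟩ := h₂
  obtain ⟨φ, φ', h0, hs, hd, ho⟩ : Contact (k + 1) g h := Quotient.exact (hg.trans hh.symm)
  have hdl := Contact.dloc_comp (by omega) h0 hd ho
  obtain ⟨S, hS⟩ := exists_leftInverse g.dloc_injective
  let D : EuclideanSpace ℝ (Fin n) → H := fun x => ρ x - τ (φ' x)
  have hD : D ∈ HomPoly (EuclideanSpace ℝ (Fin n)) H (k + 1) :=
    (HomPoly (EuclideanSpace ℝ (Fin n)) H (k + 1)).sub_mem hρ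
      (HomPoly.comp_linear hτ φ'.toLinearEquiv.toLinearMap LinearMap.id)
  have hB := HomPoly.comp_linear hD LinearMap.id S.toLinearMap
  have hDB : ∀ x, g.dloc (S (D x)) = D x := by
    intro x
    have hr : g.dloc (φ' x) = h.dloc x := by rw [← hdl]; rfl
    have hm := tangentMap_mem_plane hk (Ext.jet_eq hh) x
    have e1 := hhP x ⟨_, hm⟩ rfl
    have e2 := hgP (φ' x) ⟨_, hm⟩ hr.symm
    obtain ⟨z, hz⟩ := (toNormal_eq_iff hk (Ext.jet_eq hg) _ _).1 (e1.symm.trans e2)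
    change g.dloc (S (ρ x - τ (φ' x))) = ρ x - τ (φ' x)
    rw [← hz, hS]
  have hB0 : S (D 0) = 0 := HomPoly.map_zero k.succ_ne_zero hB
  have hBd : HasFDerivAt (fun x => S (D x)) (0 : _ →L[ℝ] EuclideanSpace ℝ (Fin n)) 0 :=
    HomPoly.hasFDerivAt_zero (by omega) hB
  -- The correction has degree k + 1 ≥ 2, so the derivative of the reparametrization remains the
  -- invertible φ'.
  have hd₁ : HasFDerivAt (fun x => φ x + S (D x))
      (φ' : EuclideanSpace ℝ (Fin n) →L[ℝ] EuclideanSpace ℝ (Fin n)) 0 := by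
    have := hd.add hBd
    rwa [add_zero] at this
  have h0₁ : φ 0 + S (D 0) = 0 := by rw [h0, hB0, add_zero]
  refine Subtype.ext (hg'.symm.trans (Eq.trans (Quotient.sound (s := contactSetoid H n (k + 1) e)
    ⟨fun x => φ x + S (D x), φ', h0₁, ?_, hd₁, ?_⟩) hh'))
  · exact hs.add (HomPoly.contDiff hB).contDiffAt
  · have ht : Filter.Tendsto φ (𝓝 0) (𝓝 0) := by simpa [h0] using hd.continuousAt.tendsto
    have ht₁ : Filter.Tendsto (fun x => φ x + S (D x)) (𝓝 0) (𝓝 0) := by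
      have := hd₁.continuousAt.tendsto
      rwa [h0₁] at this
    have hO : (fun x => (φ x + S (D x)) - φ x) =O[𝓝 0] fun x => ‖x‖ ^ (k + 1) :=
      (HomPoly.isBigO hB (𝓝 0)).congr_left fun x => by simp
    have a1 := (comp_sub_isLittleO g.hasStrictFDerivAt ht₁ ht).trans_isBigO hO
    have a2 := isLittleO_comp_pow hgo h0₁ hd₁
    have a3 := HomPoly.comp_sub_isLittleO k.succ_ne_zero hτ h0₁ hd₁
    refine ((((a1.add a2).add a3).add ho).sub hho).congr_left fun x => ?_
    have hx : g.dloc (φ x + S (D x) - φ x) = ρ x - τ (φ' x) := by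
      rw [add_sub_cancel_left, hDB]
    simp only [hx]
    change _ - (ρ x - τ (φ' x)) + _ + (_ - τ (φ' x)) + _ - _ = _
    abel

omit [FiniteDimensional ℝ H] in
/-- The extension of `θ` represented by a translate of a germ. -/
theorem exists_isDiff_translate (hk : 1 ≤ k) {η : Ext θ} {g : Germ H n e}
    (hg : g.jet (k + 1) = η.1) {P : θ.plane → θ.normal}
    {τ : EuclideanSpace ℝ (Fin n) → H} (hτ : τ ∈ HomPoly (EuclideanSpace ℝ (Fin n)) H (k + 1))
    (hP : ∀ x, θ.toNormal (τ x) =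
      P ⟨g.tangentMap x, tangentMap_mem_plane hk (Ext.jet_eq hg) x⟩) :
    ∃ η' : Ext θ, (g.translate (by omega) τ hτ).jet (k + 1) = η'.1 ∧ IsDiff η' η P := by
  refine ⟨⟨(g.translate (by omega) τ hτ).jet (k + 1), ?_⟩, rfl, _, g, τ, rfl, hg, hτ,
    g.translate_sub_isLittleO _ hτ _, fun x r hr => ?_⟩
  · rw [← Ext.jet_eq hg, ← g.translate_jet hk hτ]
    rfl
  · refine Eq.trans ?_ (hP x).symm
    congr 1
    exact Subtype.ext hr

omit [FiniteDimensional ℝ H] in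
theorem exists_isDiff_of_mem (hk : 1 ≤ k) (η : Ext θ) {P : θ.plane → θ.normal}
    (hP : P ∈ HomPoly θ.plane θ.normal (k + 1)) : ∃ η', IsDiff η' η P := by
  obtain ⟨g, hg⟩ := η.exists_germ
  obtain ⟨τ, hτ, h⟩ := exists_lift_toNormal (k + 1) g hP
    (tangentMap_mem_plane hk (Ext.jet_eq hg))
  obtain ⟨η', -, h'⟩ := exists_isDiff_translate hk hg hτ h
  exact ⟨η', h'⟩

omit [FiniteDimensional ℝ H] in
theorem isDiff_add (hk : 1 ≤ k) (η : Ext θ) {P : θ.plane → θ.normal}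
    (hP : P ∈ HomPoly θ.plane θ.normal (k + 1)) : IsDiff (η.add P) η P :=
  Classical.epsilon_spec (exists_isDiff_of_mem hk η hP)

/-- Both jets extend θ, so after reparametrization their germs differ by o(‖x‖^k), with a
homogeneous leading term τ of degree k + 1. Translating `g` by τ gives a new representative of η',
in the normal form required by `IsDiff`. -/
theorem exists_isDiff (hk : 1 ≤ k) (η' η : Ext θ) : ∃ P, IsDiff η' η P := by
  obtain ⟨g, hg⟩ := η.exists_germ
  obtain ⟨g', hg'⟩ := η'.exists_germ
  obtain ⟨φ, φ', h0, hs, hd, ho⟩ : Contact k g' g :=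
    Quotient.exact ((Ext.jet_eq hg').trans (Ext.jet_eq hg).symm)
  have hsm : ContDiffAt ℝ (k + 1 : ℕ) (fun x => g'.loc (φ x) - g.loc x) 0 := by
    have h1 : ContDiffAt ℝ ∞ g'.loc (φ 0) := by
      rw [h0]
      exact g'.eventually_contDiffAt.self_of_nhds
    exact ((h1.comp 0 hs).sub g.eventually_contDiffAt.self_of_nhds).of_le (by exact_mod_cast le_top)
  obtain ⟨τ, hτ, hτo⟩ := exists_homPoly_of_isLittleO hsm ho
  obtain ⟨S, -, hS⟩ := exists_plane_inverse hk (Ext.jet_eq hg)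
  refine ⟨fun r => θ.toNormal (τ (S r)), g.translate (by omega) τ hτ, g, τ, ?_, hg, hτ,
    g.translate_sub_isLittleO _ hτ _, fun x r hr => ?_⟩
  · rw [← hg']
    refine (Quotient.sound (s := contactSetoid H n (k + 1) e) ⟨φ, φ', h0, hs, hd, ?_⟩).symm
    refine (hτo.sub (g.translate_sub_isLittleO (by omega) hτ _)).congr_left fun x => ?_
    abel
  · exact congrArg (fun z => θ.toNormal (τ z)) (hS x r hr)

/-- The two differences may use unrelated representatives of η₁. The second is therefore realized
anew by translating the germ `g₁` of the first, `left_unique` shows that the result still represents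
η₂, and the Taylor terms add because `g₁` and `g₀` have the same derivative. -/
theorem IsDiff.add (hk : 1 ≤ k) {η₀ η₁ η₂ : Ext θ} {P P' : θ.plane → θ.normal}
    (h' : IsDiff η₂ η₁ P') (h : IsDiff η₁ η₀ P) : IsDiff η₂ η₀ (P + P') := by
  have hP' := h'.mem_homPoly hk
  obtain ⟨g₁, g₀, τ, hg₁, hg₀, hτ, ho, hP⟩ := h
  obtain ⟨τ', hτ', hl⟩ := exists_lift_toNormal (k + 1) g₁ hP'
    (tangentMap_mem_plane hk (Ext.jet_eq hg₁))
  obtain ⟨η₂', hη, hd⟩ := exists_isDiff_translate hk hg₁ hτ' hl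
  obtain rfl := hd.left_unique hk h'
  have ht : g₁.dloc = g₀.dloc := by
    have h1 : (fun x => g₁.loc x - g₀.loc x) =o[𝓝 0] fun x => ‖x‖ ^ k := by
      refine ((ho.trans_isBigO (isBigO_norm_pow_of_le k.le_succ)).add
        ((HomPoly.isBigO hτ (𝓝 0)).trans_isLittleO
          (isLittleO_norm_pow_of_le k.lt_succ_self))).congr_left fun x => ?_
      abel
    simpa using Contact.dloc_comp hk (φ := id) rfl (hasFDerivAt_id 0) h1
  refine ⟨_, g₀, τ + τ', hη, hg₀, Submodule.add_mem _ hτ hτ', ?_, fun x r hr => ?_⟩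
  · refine (ho.add (g₁.translate_sub_isLittleO (by omega) hτ' (k + 1))).congr_left fun x => ?_
    simp only [Pi.add_apply]
    abel
  · have e1 := hP x r hr
    have hr' : (r : TangentSpace 𝓘(ℝ, H) e) = g₁.tangentMap x :=
      hr.trans (congrArg (fun A : EuclideanSpace ℝ (Fin n) →L[ℝ] H => A x) ht.symm)
    have e2 : P' r = θ.toNormal (τ' x) := by
      rw [hl]
      congr 1
      exact Subtype.ext hr'
    rw [Pi.add_apply, e1, e2]
    exact (θ.toNormal.map_add (τ x) (τ' x)).symm

/-- The polynomial `η - η₀`. -/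
def Ext.diff (η η₀ : Ext θ) : θ.plane → θ.normal := Classical.epsilon fun P => IsDiff η η₀ P

theorem isDiff_diff (hk : 1 ≤ k) (η η₀ : Ext θ) : IsDiff η η₀ (η.diff η₀) :=
  Classical.epsilon_spec (exists_isDiff hk η η₀)

theorem Ext.diff_mem (hk : 1 ≤ k) (η η₀ : Ext θ) :
    η.diff η₀ ∈ HomPoly θ.plane θ.normal (k + 1) :=
  (isDiff_diff hk η η₀).mem_homPoly hk

theorem Ext.add_diff (hk : 1 ≤ k) (η η₀ : Ext θ) : η₀.add (η.diff η₀) = η :=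
  (isDiff_add hk η₀ (Ext.diff_mem hk η η₀)).left_unique hk (isDiff_diff hk η η₀)

theorem Ext.diff_add (hk : 1 ≤ k) (η₀ : Ext θ) {P : θ.plane → θ.normal}
    (hP : P ∈ HomPoly θ.plane θ.normal (k + 1)) : (η₀.add P).diff η₀ = P :=
  (isDiff_diff hk _ η₀).unique hk (isDiff_add hk η₀ hP)

/-- From here on germs are no longer needed: every question about extensions becomes one about
polynomials relative to the origin `η₀`. -/
theorem isDiff_iff (hk : 1 ≤ k) {η' η : Ext θ} (η₀ : Ext θ) {P : θ.plane → θ.normal} :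
    IsDiff η' η P ↔ P = η'.diff η₀ - η.diff η₀ := by
  have key : ∀ Q, IsDiff η' η Q → Q = η'.diff η₀ - η.diff η₀ := fun Q h =>
    eq_sub_of_add_eq' ((h.add hk (isDiff_diff hk η η₀)).unique hk (isDiff_diff hk η' η₀))
  refine ⟨key P, fun h => ?_⟩
  obtain ⟨Q, hQ⟩ := exists_isDiff hk η' η
  rwa [h, ← key Q hQ]

end AffineStructure

/-! ### Coefficients as finite combinations of values. -/

section Monomials

variable {ι : Type*} [Fintype ι] [DecidableEq ι] {r : ℕ}

/-- The multi-indices of degree `r`. -/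
abbrev MIdx (ι : Type*) [Fintype ι] [DecidableEq ι] (r : ℕ) : Type _ :=
  {σ : ι → ℕ // σ ∈ Finset.piAntidiag Finset.univ r}

theorem MIdx.sum_eq (σ : MIdx ι r) : ∑ s, σ.1 s = r := (Finset.mem_piAntidiag.1 σ.2).1

/-- The homogeneous polynomial function with coefficients `w`. -/
def monoSum (w : MIdx ι r → ℝ) (a : ι → ℝ) : ℝ := ∑ σ, w σ * ∏ s, a s ^ σ.1 s

theorem monoSum_eq_zero {w : MIdx ι r → ℝ} (h : ∀ a, monoSum w a = 0) : w = 0 := by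
  let p : MvPolynomial ι ℝ :=
    ∑ σ : MIdx ι r, MvPolynomial.monomial (Finsupp.equivFunOnFinite.symm σ.1) (w σ)
  have hp : p = 0 := by
    refine MvPolynomial.funext fun a => ?_
    rw [map_zero, ← h a]
    simp [p, monoSum, MvPolynomial.eval_monomial, Finsupp.prod_fintype]
  funext τ
  have := congrArg (MvPolynomial.coeff (Finsupp.equivFunOnFinite.symm τ.1)) hp
  simpa [p, MvPolynomial.coeff_sum, MvPolynomial.coeff_monomial, ← Subtype.ext_iff] using this

/-- The coefficients of a homogeneous polynomial function are linear combinations of finitely many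
of its values. -/
theorem exists_extraction (ι : Type*) [Fintype ι] [DecidableEq ι] (r : ℕ) (σ : MIdx ι r) :
    ∃ c : (ι → ℝ) →₀ ℝ, ∀ w : MIdx ι r → ℝ, (c.sum fun a t => t * monoSum w a) = w σ := by
  let ev : (ι → ℝ) → Module.Dual ℝ (MIdx ι r → ℝ) := fun a =>
    { toFun := fun w => monoSum w a
      map_add' := fun w w' => by simp [monoSum, add_mul, Finset.sum_add_distrib]
      map_smul' := fun t w => by simp [monoSum, Finset.mul_sum, mul_assoc] }
  -- A coefficient family annihilated by all evaluations is zero, so the evaluations span the dual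
  -- space.
  have hspan : Submodule.span ℝ (Set.range ev) = ⊤ := by
    refine Submodule.span_eq_top_of_ne_zero fun w hw => ?_
    by_contra! hz
    exact hw (monoSum_eq_zero fun a => hz (ev a) ⟨a, rfl⟩)
  have hmem : LinearMap.proj σ ∈ Submodule.span ℝ (Set.range ev) := hspan ▸ Submodule.mem_top
  obtain ⟨c, hc⟩ := (Finsupp.mem_span_range_iff_exists_finsupp).1 hmem
  refine ⟨c, fun w => ?_⟩
  have := LinearMap.congr_fun hc w
  simp only [Finsupp.sum, LinearMap.sum_apply] at this
  exact this

/-- Weights and nodes recovering the coefficient of index `σ`. -/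
def extraction (ι : Type*) [Fintype ι] [DecidableEq ι] (r : ℕ) (σ : MIdx ι r) : (ι → ℝ) →₀ ℝ :=
  (exists_extraction ι r σ).choose

/-- The coefficient of index `σ` of a function that is a homogeneous polynomial. -/
def coeffOf (f : (ι → ℝ) → ℝ) (σ : MIdx ι r) : ℝ :=
  (extraction ι r σ).sum fun a t => t * f a

theorem coeffOf_monoSum (w : MIdx ι r → ℝ) : coeffOf (monoSum w) = w :=
  funext fun σ => (exists_extraction ι r σ).choose_spec w

theorem coeffOf_zero (σ : MIdx ι r) : coeffOf (fun _ => 0) σ = 0 := by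
  simp [coeffOf]

theorem coeffOf_sub (f g : (ι → ℝ) → ℝ) (σ : MIdx ι r) :
    coeffOf (fun a => f a - g a) σ = coeffOf f σ - coeffOf g σ := by
  simp [coeffOf, Finsupp.sum, mul_sub]

/-- Because `coeffOf` is one fixed finite combination of values, regularity and derivatives of
coefficients in a parameter reduce to those of the values at each fixed `a`. -/
theorem contDiff_coeffOf {X : Type*} [NormedAddCommGroup X] [NormedSpace ℝ X]
    {f : X → (ι → ℝ) → ℝ} {N : WithTop ℕ∞} (hf : ∀ a, ContDiff ℝ N fun x => f x a)
    (σ : MIdx ι r) : ContDiff ℝ N fun x => coeffOf (f x) σ :=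
  ContDiff.sum fun a _ => contDiff_const.mul (hf a)

theorem hasDerivAt_coeffOf {f : ℝ → (ι → ℝ) → ℝ} {f' : (ι → ℝ) → ℝ} {t : ℝ}
    (hf : ∀ a, HasDerivAt (fun x => f x a) (f' a) t) (σ : MIdx ι r) :
    HasDerivAt (fun x => coeffOf (f x) σ) (coeffOf f' σ) t :=
  HasDerivAt.fun_sum fun a _ => (hf a).const_mul _

theorem HomPoly.exists_monoSum {W κ : Type*} [AddCommGroup W] [Module ℝ W]
    (e : Module.Basis κ ℝ W) {P : (ι → ℝ) → W} (hP : P ∈ HomPoly (ι → ℝ) W r) :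
    ∃ w : MIdx ι r → κ → ℝ, ∀ h a, e.coord h (P a) = monoSum (fun σ => w σ h) a := by
  obtain ⟨T, rfl⟩ := hP
  -- The multi-index counting how often each basis direction occurs; expansion terms with the same
  -- count contribute to the same monomial.
  let cnt : (Fin r → ι) → MIdx ι r := fun f =>
    ⟨fun s => (Finset.univ.filter fun i => f i = s).card, by
      rw [Finset.mem_piAntidiag]
      refine ⟨?_, by simp⟩
      have := Finset.card_eq_sum_card_fiberwise (f := f) (s := Finset.univ) (t := Finset.univ)
        (by simp)
      simpa using this.symm⟩
  have hcnt : ∀ (f : Fin r → ι) (a : ι → ℝ), ∏ i, a (f i) = ∏ s, a s ^ (cnt f).1 s := by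
    intro f a
    rw [← Finset.prod_fiberwise Finset.univ f]
    refine Finset.prod_congr rfl fun s _ => ?_
    rw [Finset.prod_congr rfl (g := fun _ => a s) fun i hi => by
      rw [(Finset.mem_filter.1 hi).2], Finset.prod_const]
  refine ⟨fun σ h => ∑ f : Fin r → ι, if cnt f = σ then
    e.coord h (T fun i => Pi.single (f i) 1) else 0, fun h a => ?_⟩
  have h1 : diag r T a = ∑ f : Fin r → ι, (∏ i, a (f i)) • T fun i => Pi.single (f i) 1 := by
    have := multilinear_expand (Pi.basisFun ℝ ι) T fun _ => a
    simpa [diag] using this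
  rw [h1, map_sum]
  simp only [monoSum, Finset.sum_mul]
  rw [Finset.sum_comm]
  refine Finset.sum_congr rfl fun f _ => ?_
  rw [Finset.sum_eq_single (cnt f)]
  · rw [if_pos rfl, _root_.map_smul, smul_eq_mul, hcnt, mul_comm]
  · intro σ _ hσ
    rw [if_neg hσ.symm, zero_mul]
  · simp

end Monomials

/-! ### Membership in `μ_L^p` and vanishing along `L`. -/

section Mu

variable {V W : Type*} [AddCommGroup V] [Module ℝ V] [AddCommGroup W] [Module ℝ W]
  {ι : Type*} [Fintype ι] [DecidableEq ι] {r : ℕ}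

/-- The list `f` repeats each index s exactly σ_s times, writing the monomial as a product of r
linear factors; the count of factors in `Z` feeds the pigeonhole argument of `monomial_mem_mu`. -/
theorem exists_factor_indices (σ : MIdx ι r) : ∃ f : Fin r → ι,
    (∀ g : ι → ℝ, ∏ i, g (f i) = ∏ s, g s ^ σ.1 s) ∧
    ∀ Z : Finset ι, (Finset.univ.filter fun i => f i ∈ Z).card = ∑ s ∈ Z, σ.1 s := by
  have hc : Fintype.card (Σ s, Fin (σ.1 s)) = r := by simpa using σ.sum_eq
  let q := (Fintype.equivFinOfCardEq hc).symm
  refine ⟨fun i => (q i).1, fun g => ?_, fun Z => ?_⟩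
  · rw [Equiv.prod_comp q fun x => g x.1, Fintype.prod_sigma]
    simp
  · rw [Finset.card_filter, Equiv.sum_comp q fun x => if x.1 ∈ Z then 1 else 0,
      Fintype.sum_sigma]
    rw [← Finset.univ_inter Z, ← Finset.sum_ite_mem]
    refine Finset.sum_congr rfl fun s _ => ?_
    by_cases hs : s ∈ Z <;> simp [hs]

/-- A monomial with enough factors vanishing on `L` belongs to `μ_L^p`. -/
theorem monomial_mem_mu (b : ι → Module.Dual ℝ V) (σ : MIdx ι r) (w : W) (L : Submodule ℝ V)
    (p : ℕ) (Z : Finset ι) (hZ : ∀ s ∈ Z, ∀ x ∈ L, b s x = 0)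
    (hp : r < p + ∑ s ∈ Z, σ.1 s) : (fun x => (∏ s, b s x ^ σ.1 s) • w) ∈ mu W r L p := by
  obtain ⟨f, hf, hfc⟩ := exists_factor_indices σ
  let T₀ : MultilinearMap ℝ (fun _ : Fin r => V) W :=
    ((MultilinearMap.mkPiAlgebra ℝ (Fin r) ℝ).compLinearMap fun i => b (f i)).smulRight w
  have hT₀ : ∀ v, T₀ v = (∏ i, b (f i) (v i)) • w := fun v => by simp [T₀]
  -- Averaging over permutations symmetrizes the form without changing its diagonal.
  let T : MultilinearMap ℝ (fun _ : Fin r => V) W :=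
    (r.factorial : ℝ)⁻¹ • ∑ π : Equiv.Perm (Fin r), T₀.domDomCongr π
  have hT : ∀ v, T v = (r.factorial : ℝ)⁻¹ • ∑ π : Equiv.Perm (Fin r), T₀ fun i => v (π i) :=
    fun v => by simp [T]
  refine ⟨T, fun τ v => ?_, fun s v hs hv => ?_, ?_⟩
  · rw [hT, hT]
    congr 1
    exact Equiv.sum_comp (Equiv.mulLeft τ) fun π : Equiv.Perm (Fin r) => T₀ fun i => v (π i)
  · rw [hT, Finset.sum_eq_zero, smul_zero]
    intro π _
    -- Pigeonhole: more than r - p factors vanish on `L` and at least p arguments lie in `L`, so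
    -- some vanishing factor receives an argument from `L`.
    obtain ⟨i, hi⟩ : ∃ i, f i ∈ Z ∧ π i ∈ s := by
      by_contra! hne
      have hd : Disjoint (Finset.univ.filter fun i => f i ∈ Z) (s.map π.symm.toEmbedding) := by
        rw [Finset.disjoint_left]
        intro i hi hi'
        obtain ⟨j, hj, rfl⟩ := Finset.mem_map.1 hi'
        exact hne _ (Finset.mem_filter.1 hi).2 (by simpa using hj)
      have := Finset.card_le_univ (Finset.disjUnion _ _ hd)
      rw [Finset.card_disjUnion, hfc, Finset.card_map, Fintype.card_fin] at this
      omega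
    rw [hT₀, Finset.prod_eq_zero (Finset.mem_univ i) (hZ _ hi.1 _ (hv _ hi.2)), zero_smul]
  · funext x
    simp only [diag, LinearMap.coe_mk, AddHom.coe_mk, hT, hT₀, Finset.sum_const,
      Finset.card_univ, Fintype.card_perm, Fintype.card_fin, hf fun s => b s x]
    rw [← Nat.cast_smul_eq_nsmul ℝ, smul_smul, inv_mul_cancel₀ (by positivity), one_smul]

theorem mu_le_homPoly (L : Submodule ℝ V) (p : ℕ) : mu W r L p ≤ HomPoly V W r := by
  rintro _ ⟨T, -, -, rfl⟩
  exact ⟨T, rfl⟩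

/-- A polynomial whose multilinear form vanishes when all but one arguments lie in `L` vanishes of
second order along `L`. -/
theorem hasDerivAt_of_mem_mu {k : ℕ} {L : Submodule ℝ V} {Q : V → W}
    (hQ : Q ∈ mu W (k + 1) L k) (f : W →ₗ[ℝ] ℝ) {x : V} (hx : x ∈ L) (z : V) :
    HasDerivAt (fun t : ℝ => f (Q (x + t • z))) 0 0 := by
  obtain ⟨T, -, hT, rfl⟩ := hQ
  have h1 : ∀ t : ℝ, f (diag (k + 1) T (x + t • z)) = ∑ s : Finset (Fin (k + 1)),
      t ^ s.card * f (T (s.piecewise (fun _ => z) fun _ => x)) := by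
    intro t
    have h2 := T.map_add_univ (fun _ => t • z) fun _ => x
    have h3 : diag (k + 1) T (x + t • z) = T ((fun _ => t • z) + fun _ => x) := by
      simp only [diag, LinearMap.coe_mk, AddHom.coe_mk]
      congr 1
      funext i
      exact add_comm _ _
    rw [h3, h2, map_sum]
    refine Finset.sum_congr rfl fun s _ => ?_
    have h4 := T.map_piecewise_smul (fun _ => t) (s.piecewise (fun _ => z) fun _ => x) s
    rw [Finset.prod_const] at h4
    rw [← smul_eq_mul, ← map_smul, ← h4]
    congr 2
    funext i
    by_cases hi : i ∈ s <;> simp [hi]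
  simp only [h1]
  have h5 : ∀ s : Finset (Fin (k + 1)), s ∈ Finset.univ → HasDerivAt
      (fun t : ℝ => t ^ s.card * f (T (s.piecewise (fun _ => z) fun _ => x))) 0 0 := by
    intro s _
    -- Terms with at least two factors t have zero derivative at t = 0; the others have at least k
    -- arguments equal to x ∈ L and vanish identically.
    rcases lt_or_ge 1 s.card with hs | hs
    · have := (hasDerivAt_pow s.card (0 : ℝ)).mul_const
        (f (T (s.piecewise (fun _ => z) fun _ => x)))
      simpa [Nat.sub_ne_zero_of_lt hs] using this
    · rw [hT sᶜ _ (by rw [Finset.card_compl, Fintype.card_fin]; omega) fun i hi => by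
        simpa [Finset.mem_compl.1 hi] using hx]
      simpa using hasDerivAt_const (0 : ℝ) (0 : ℝ)
  simpa using HasDerivAt.fun_sum h5

end Mu

/-! ### Reading off membership from coefficients. -/

section BasisCoordinates

variable {V W : Type*} [AddCommGroup V] [Module ℝ V] [AddCommGroup W] [Module ℝ W]
  {ι κ : Type*} [Fintype ι] [DecidableEq ι] [Fintype κ] {r : ℕ}

theorem mem_mu_of_coord (e : Module.Basis κ ℝ W) (b : ι → Module.Dual ℝ V) {P : V → W}
    {w : MIdx ι r → κ → ℝ}
    (hP : ∀ h x, e.coord h (P x) = monoSum (fun σ => w σ h) fun s => b s x)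
    (L : Submodule ℝ V) (p : ℕ) (Z : Finset ι) (hZ : ∀ s ∈ Z, ∀ x ∈ L, b s x = 0)
    (hw : ∀ σ h, w σ h ≠ 0 → r < p + ∑ s ∈ Z, σ.1 s) : P ∈ mu W r L p := by
  classical
  have h1 : P = ∑ h, ∑ σ, w σ h • fun x => (∏ s, b s x ^ σ.1 s) • e h := by
    funext x
    refine e.ext_elem fun h => ?_
    rw [← e.coord_apply, ← e.coord_apply, hP]
    simp only [Finset.sum_apply, Pi.smul_apply, map_sum, map_smul, Module.Basis.coord_apply,
      Module.Basis.repr_self, Finsupp.single_apply, smul_eq_mul, mul_ite, mul_one, mul_zero]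
    rw [Finset.sum_comm]
    simp only [Finset.sum_ite_eq', Finset.mem_univ, if_true]
    rfl
  rw [h1]
  refine Submodule.sum_mem _ fun h _ => Submodule.sum_mem _ fun σ _ => ?_
  by_cases h0 : w σ h = 0
  · rw [h0, zero_smul]
    exact Submodule.zero_mem _
  · exact Submodule.smul_mem _ _ (monomial_mem_mu b σ (e h) L p Z hZ (hw σ h h0))

theorem mem_homPoly_of_coord (e : Module.Basis κ ℝ W) (b : ι → Module.Dual ℝ V) {P : V → W}
    {w : MIdx ι r → κ → ℝ}
    (hP : ∀ h x, e.coord h (P x) = monoSum (fun σ => w σ h) fun s => b s x) :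
    P ∈ HomPoly V W r :=
  -- With p = r + 1 no vanishing factors are required, so every monomial qualifies.
  mu_le_homPoly ⊥ (r + 1) (mem_mu_of_coord e b hP ⊥ (r + 1) ∅ (by simp) (by simp))

end BasisCoordinates

/-! ### The Grassmannian chart and coefficients relative to a plane. -/

section Coordinates

variable {H : Type*} [NormedAddCommGroup H] [NormedSpace ℝ H] [FiniteDimensional ℝ H]
  {E : Type*} [TopologicalSpace E] [ChartedSpace H E] {n k : ℕ} {e : E}
  {θ : Jet H n k e} {d l m : ℕ}

namespace Coords

variable (c : Coords θ d l m)

theorem pi_basis_bijective : Function.Bijective (LinearMap.pi c.basis) := by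
  have hinj : Function.Injective (LinearMap.pi c.basis) := by
    rw [← LinearMap.ker_eq_bot, LinearMap.ker_eq_bot']
    intro r hr
    refine (Module.forall_dual_apply_eq_zero_iff ℝ r).1 fun f => ?_
    rw [← c.basis.sum_repr f]
    have : ∀ s, c.basis s r = 0 := fun s => congrFun hr s
    simp only [LinearMap.sum_apply, LinearMap.smul_apply, this, smul_zero,
      Finset.sum_const_zero]
  have hfr : Module.finrank ℝ θ.plane = Module.finrank ℝ (Fin d ⊕ Fin l → ℝ) := by
    rw [← Subspace.dual_finrank_eq, Module.finrank_eq_card_basis c.basis,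
      Module.finrank_fintype_fun_eq_card]
  exact ⟨hinj, (LinearMap.injective_iff_surjective_of_finrank_eq_finrank hfr).1 hinj⟩

/-- The coordinates `(y, x)` on `R`. -/
def frame : θ.plane ≃ₗ[ℝ] (Fin d ⊕ Fin l → ℝ) := LinearEquiv.ofBijective _ c.pi_basis_bijective

theorem frame_apply (r : θ.plane) (s) : c.frame r s = c.basis s r := rfl

end Coords

/-- The passage from coordinates `(y - A x, x)` to coordinates `(y, x)`. -/
def shear (A : GrCoord d l) : (Fin d ⊕ Fin l → ℝ) →ₗ[ℝ] (Fin d ⊕ Fin l → ℝ) where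
  toFun a := Sum.elim (fun i => a (Sum.inl i) + ∑ j, A i j * a (Sum.inr j)) fun j => a (Sum.inr j)
  map_add' a b := by
    funext s
    rcases s with i | j
    · simp only [Pi.add_apply, Sum.elim_inl, mul_add, Finset.sum_add_distrib]
      ring
    · rfl
  map_smul' t a := by
    funext s
    rcases s with i | j
    · simp [mul_add, Finset.mul_sum, mul_left_comm]
    · rfl

namespace Coords

variable (c : Coords θ d l m)

/-- The vector of `R` with coordinates `a` with respect to `(y - A x, x)`. -/
def point (A : GrCoord d l) : (Fin d ⊕ Fin l → ℝ) →ₗ[ℝ] θ.plane :=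
  c.frame.symm.toLinearMap ∘ₗ shear A

theorem basis_point (A : GrCoord d l) (a : Fin d ⊕ Fin l → ℝ) (s) :
    c.basis s (c.point A a) = shear A a s := by
  rw [← c.frame_apply]
  simp [point]

theorem y_point (A : GrCoord d l) (a : Fin d ⊕ Fin l → ℝ) (i) :
    c.y i (c.point A a) = a (Sum.inl i) + ∑ j, A i j * a (Sum.inr j) := c.basis_point A a _

theorem x_point (A : GrCoord d l) (a : Fin d ⊕ Fin l → ℝ) (j) :
    c.x j (c.point A a) = a (Sum.inr j) := c.basis_point A a _

theorem yA_apply (A : GrCoord d l) (i) (r : θ.plane) :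
    c.yA A i r = c.y i r - ∑ j, A i j * c.x j r := by simp [yA]

theorem yA_point (A : GrCoord d l) (a : Fin d ⊕ Fin l → ℝ) (i) :
    c.yA A i (c.point A a) = a (Sum.inl i) := by
  rw [yA_apply, y_point]
  simp only [x_point]
  ring

theorem ext_coord {r r' : θ.plane} (hy : ∀ i, c.y i r = c.y i r') (hx : ∀ j, c.x j r = c.x j r') :
    r = r' := by
  refine c.frame.injective (funext fun s => ?_)
  rcases s with i | j
  · exact hy i
  · exact hx j

theorem point_yA_x (A : GrCoord d l) (r : θ.plane) :
    c.point A (Sum.elim (fun i => c.yA A i r) fun j => c.x j r) = r := by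
  refine c.ext_coord (fun i => ?_) fun j => ?_
  · rw [y_point]
    simp [yA_apply]
  · rw [x_point]
    rfl

theorem mem_subspaceAt (A : GrCoord d l) (r : θ.plane) :
    r ∈ c.subspaceAt A ↔ ∀ i, c.yA A i r = 0 := by simp [subspaceAt]

theorem point_mem (A : GrCoord d l) (a : Fin l → ℝ) :
    c.point A (Sum.elim 0 a) ∈ c.subspaceAt A :=
  (c.mem_subspaceAt A _).2 fun i => by simp [yA_point]

theorem exists_point_of_mem {A : GrCoord d l} {r : θ.plane} (hr : r ∈ c.subspaceAt A) :
    ∃ a, r = c.point A (Sum.elim 0 a) := by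
  refine ⟨fun j => c.x j r, ?_⟩
  rw [mem_subspaceAt] at hr
  conv_lhs => rw [← c.point_yA_x A r]
  congr 2
  exact funext hr

theorem gr_injective : Function.Injective c.gr := by
  intro A A' h
  have h' : c.subspaceAt A = c.subspaceAt A' := congrArg Subtype.val h
  funext i j
  have h1 := c.point_mem A (Pi.single j 1)
  rw [h', mem_subspaceAt] at h1
  have h2 := h1 i
  rw [yA_apply, y_point] at h2
  simp only [x_point, Sum.elim_inl, Sum.elim_inr, Pi.zero_apply] at h2
  simpa [Pi.single_apply, sub_eq_zero] using h2

theorem mem_ker_x (r : θ.plane) : (r ∈ ⨅ j, LinearMap.ker (c.x j)) ↔ ∀ j, c.x j r = 0 := by simp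

theorem gr_mem_domain (A : GrCoord d l) : c.gr A ∈ c.domain := by
  change IsCompl (c.subspaceAt A) _
  refine ⟨?_, ?_⟩
  · rw [Submodule.disjoint_def]
    intro r hr hr'
    rw [mem_subspaceAt] at hr
    rw [mem_ker_x] at hr'
    rw [← c.point_yA_x A r]
    have : (Sum.elim (fun i => c.yA A i r) fun j => c.x j r) = 0 := by
      funext s
      rcases s with i | j
      · exact hr i
      · exact hr' j
    rw [this, map_zero]
  · rw [Submodule.codisjoint_iff_exists_add_eq]
    intro r
    refine ⟨_, c.point A (Sum.elim (fun i => c.yA A i r) 0),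
      c.point_mem A (fun j => c.x j r), (c.mem_ker_x _).2 fun j => by simp [x_point], ?_⟩
    rw [← map_add]
    conv_rhs => rw [← c.point_yA_x A r]
    congr 1
    funext s
    rcases s with i | j <;> simp

/-- Transversality gives vectors u_j ∈ L dual to the x_j, and then A_{i,j} = y_i(u_j). Equality of
dimensions leaves one inclusion to check. -/
theorem exists_gr_eq {L : Gr θ.plane l} (hL : L ∈ c.domain) : ∃ A, c.gr A = L := by
  have hc : IsCompl L.1 (⨅ j, LinearMap.ker (c.x j)) := hL
  have hu : ∀ j, ∃ u ∈ L.1, ∀ j', c.x j' u = if j' = j then 1 else 0 := by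
    intro j
    obtain ⟨u, v, hu, hv, huv⟩ := (Submodule.codisjoint_iff_exists_add_eq.1 hc.codisjoint)
      (c.point 0 (Sum.elim 0 (Pi.single j 1)))
    refine ⟨u, hu, fun j' => ?_⟩
    have h1 := congrArg (c.x j') huv
    rw [map_add, (c.mem_ker_x v).1 hv, add_zero, x_point] at h1
    simpa [Pi.single_apply] using h1
  choose u huL hux using hu
  refine ⟨fun i j => c.y i (u j), Subtype.ext ?_⟩
  refine Submodule.eq_of_le_of_finrank_eq (fun r hr => ?_) ((c.finrank_subspaceAt _).trans L.2.symm)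
  have : r = ∑ j, c.x j r • u j := by
    refine c.ext_coord (fun i => ?_) fun j => ?_
    · have := (c.mem_subspaceAt _ r).1 hr i
      rw [yA_apply, sub_eq_zero] at this
      rw [this, map_sum]
      simp [mul_comm]
    · rw [map_sum]
      simp [hux]
  rw [this]
  exact Submodule.sum_mem _ fun j _ => Submodule.smul_mem _ _ (huL j)

theorem grChart_gr (A : GrCoord d l) : c.grChart (c.gr A) = A :=
  Function.leftInverse_invFun c.gr_injective A

theorem gr_grChart {L : Gr θ.plane l} (hL : L ∈ c.domain) : c.gr (c.grChart L) = L :=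
  Function.invFun_eq (c.exists_gr_eq hL)

/-! ### Polynomials in coordinates -/

theorem coord_trivialPoly (u : Idx k d l → Fin m → ℝ) (h : Fin m) (r : θ.plane) :
    c.normalBasis.coord h (c.trivialPoly u r) =
      ∑ σ, u σ h * ((∏ i, c.y i r ^ σ.1 (Sum.inl i) / (σ.1 (Sum.inl i)).factorial) *
        ∏ j, c.x j r ^ σ.1 (Sum.inr j) / (σ.1 (Sum.inr j)).factorial) := by
  simp only [trivialPoly, map_sum, map_smul, Module.Basis.coord_apply, Module.Basis.repr_self,
    Finsupp.single_apply, smul_eq_mul, mul_ite, mul_one, mul_zero, Finset.sum_ite_eq',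
    Finset.mem_univ, if_true]

theorem coord_trivialPoly_eq_monoSum (u : Idx k d l → Fin m → ℝ) (h : Fin m) (r : θ.plane) :
    c.normalBasis.coord h (c.trivialPoly u r) =
      monoSum (fun σ : MIdx (Fin d ⊕ Fin l) (k + 1) => u σ h / ∏ s, ((σ.1 s).factorial : ℝ))
        fun s => c.basis s r := by
  rw [coord_trivialPoly]
  refine Finset.sum_congr rfl fun σ _ => ?_
  simp only [Fintype.prod_sum_type, Finset.prod_div_distrib, x, y]
  field_simp

theorem coord_fibrePoly (v : FibreCoord k l m) (h : Fin m) (r : θ.plane) :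
    c.normalBasis.coord h (c.fibrePoly v r) =
      monoSum (fun ν : MIdx (Fin l) (k + 1) => v ν h) fun j => c.x j r := by
  simp only [fibrePoly, map_sum, map_smul, Module.Basis.coord_apply, Module.Basis.repr_self,
    Finsupp.single_apply, smul_eq_mul, mul_ite, mul_one, mul_zero, Finset.sum_ite_eq',
    Finset.mem_univ, if_true]
  rfl

theorem coord_adaptedPoly (a : MCoord k d l m 1) (h : Fin m) (r : θ.plane) :
    c.normalBasis.coord h (c.adaptedPoly 1 a r) =
      ∑ σ, a.2 σ h * ((∏ i, c.yA a.1 i r ^ σ.1 (Sum.inl i)) *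
        ∏ j, c.x j r ^ σ.1 (Sum.inr j)) := by
  simp only [adaptedPoly, map_sum, map_smul, Module.Basis.coord_apply, Module.Basis.repr_self,
    Finsupp.single_apply, smul_eq_mul, mul_ite, mul_one, mul_zero, Finset.sum_ite_eq',
    Finset.mem_univ, if_true]
  refine Finset.sum_congr rfl fun σ _ => ?_
  congr 2
  refine Finset.prod_congr rfl fun i _ => ?_
  -- For q = 1 all exponents of y - A x are 0 or 1, so the factorials disappear.
  have h1 : σ.1 (Sum.inl i) ≤ 1 :=
    (Finset.single_le_sum (f := fun i => σ.1 (Sum.inl i)) (fun _ _ => Nat.zero_le _)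
      (Finset.mem_univ i)).trans (Finset.mem_filter.1 σ.2).2
  rw [Nat.factorial_eq_one.2 h1]
  simp

/-- Extension by zero of a family indexed by multi-indices of degree at most one in `y`. -/
def extendLe {q : ℕ} (v : IdxLe k d l q → Fin m → ℝ) (σ : Idx k d l) (h : Fin m) : ℝ :=
  if hσ : ∑ i, σ.1 (Sum.inl i) ≤ q then v ⟨σ.1, Finset.mem_filter.2 ⟨σ.2, hσ⟩⟩ h else 0

theorem coord_adaptedPoly_eq_monoSum (a : MCoord k d l m 1) (h : Fin m) (r : θ.plane) :
    c.normalBasis.coord h (c.adaptedPoly 1 a r) =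
      monoSum (fun σ : MIdx (Fin d ⊕ Fin l) (k + 1) => extendLe a.2 σ h)
        (Sum.elim (fun i => c.yA a.1 i r) fun j => c.x j r) := by
  rw [coord_adaptedPoly]
  -- Both sums are rewritten over raw multi-indices, where the index set of one is a filter of that
  -- of the other.
  let g : (Fin d ⊕ Fin l → ℕ) → ℝ := fun σ =>
    (∏ i, c.yA a.1 i r ^ σ (Sum.inl i)) * ∏ j, c.x j r ^ σ (Sum.inr j)
  let f : (Fin d ⊕ Fin l → ℕ) → ℝ := fun σ =>
    if hσ : σ ∈ Finset.piAntidiag Finset.univ (k + 1) ∧ ∑ i, σ (Sum.inl i) ≤ 1 then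
      a.2 ⟨σ, Finset.mem_filter.2 hσ⟩ h else 0
  have e1 : monoSum (fun σ : MIdx (Fin d ⊕ Fin l) (k + 1) => extendLe a.2 σ h)
      (Sum.elim (fun i => c.yA a.1 i r) fun j => c.x j r) =
      ∑ σ : Idx k d l, f σ.1 * g σ.1 := by
    refine Finset.sum_congr rfl fun σ _ => ?_
    rw [Fintype.prod_sum_type]
    simp only [extendLe, f, g, Sum.elim_inl, Sum.elim_inr, σ.2, true_and]
  rw [e1, Finset.sum_coe_sort (Finset.piAntidiag Finset.univ (k + 1)) fun σ => f σ * g σ]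
  have e2 : ∀ σ : IdxLe k d l 1, a.2 σ h * ((∏ i, c.yA a.1 i r ^ σ.1 (Sum.inl i)) *
      ∏ j, c.x j r ^ σ.1 (Sum.inr j)) = f σ.1 * g σ.1 := fun σ => by
    have : f σ.1 = a.2 σ h := dif_pos (Finset.mem_filter.1 σ.2)
    rw [this]
  rw [Finset.sum_congr rfl fun σ _ => e2 σ, Finset.sum_coe_sort _ fun σ => f σ * g σ,
    Finset.sum_filter]
  refine Finset.sum_congr rfl fun σ hσ => ?_
  split_ifs with h1
  · rfl
  · have : f σ = 0 := dif_neg fun h2 => h1 h2.2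
    rw [this, zero_mul]

theorem trivialPoly_mem (u : Idx k d l → Fin m → ℝ) :
    c.trivialPoly u ∈ HomPoly θ.plane θ.normal (k + 1) :=
  mem_homPoly_of_coord c.normalBasis (fun s => c.basis s) (c.coord_trivialPoly_eq_monoSum u)

theorem fibrePoly_mem (v : FibreCoord k l m) :
    c.fibrePoly v ∈ HomPoly θ.plane θ.normal (k + 1) :=
  mem_homPoly_of_coord c.normalBasis (fun j => c.x j) (c.coord_fibrePoly v)

theorem adaptedPoly_mem (a : MCoord k d l m 1) :
    c.adaptedPoly 1 a ∈ HomPoly θ.plane θ.normal (k + 1) := by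
  refine mem_homPoly_of_coord c.normalBasis (Sum.elim (fun i => c.yA a.1 i) fun j => c.x j)
    (w := fun σ h => extendLe a.2 σ h) fun h r => ?_
  rw [coord_adaptedPoly_eq_monoSum]
  congr 1
  funext s
  rcases s with i | j <;> rfl

theorem exists_trivialPoly {P : θ.plane → θ.normal}
    (hP : P ∈ HomPoly θ.plane θ.normal (k + 1)) : ∃ u, c.trivialPoly u = P := by
  obtain ⟨w, hw⟩ := HomPoly.exists_monoSum c.normalBasis
    (HomPoly.comp_linear hP c.frame.symm.toLinearMap LinearMap.id)
  refine ⟨fun σ h => w σ h * ∏ s, ((σ.1 s).factorial : ℝ), funext fun r => ?_⟩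
  refine c.normalBasis.ext_elem fun h => ?_
  have h1 := hw h (c.frame r)
  simp only [LinearEquiv.coe_coe, LinearEquiv.symm_apply_apply, LinearMap.id_apply] at h1
  rw [← Module.Basis.coord_apply, ← Module.Basis.coord_apply, h1, coord_trivialPoly_eq_monoSum]
  congr 1
  funext σ
  have : ∏ s, ((σ.1 s).factorial : ℝ) ≠ 0 :=
    Finset.prod_ne_zero_iff.2 fun s _ => by positivity
  field_simp

theorem trivialPoly_injective : Function.Injective c.trivialPoly := by
  intro u u' huu
  have h1 : ∀ h a, monoSum (fun σ : MIdx (Fin d ⊕ Fin l) (k + 1) =>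
      u σ h / ∏ s, ((σ.1 s).factorial : ℝ)) a = monoSum (fun σ : MIdx (Fin d ⊕ Fin l) (k + 1) =>
      u' σ h / ∏ s, ((σ.1 s).factorial : ℝ)) a := by
    intro h a
    obtain ⟨r, rfl⟩ := c.frame.surjective a
    have := congrArg (fun P => c.normalBasis.coord h (P r)) huu
    simp only [coord_trivialPoly_eq_monoSum] at this
    exact this
  funext σ h
  have h2 := congrFun ((coeffOf_monoSum _).symm.trans ((congrArg coeffOf (funext (h1 h))).trans
    (coeffOf_monoSum _))) σ
  have : ∏ s, ((σ.1 s).factorial : ℝ) ≠ 0 :=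
    Finset.prod_ne_zero_iff.2 fun s _ => by positivity
  exact (div_left_inj' this).1 h2

/-- The coefficients of a polynomial in the coordinates `(y - A x, x)`. -/
def flagCoef (P : θ.plane → θ.normal) (A : GrCoord d l) : Idx k d l → Fin m → ℝ := fun σ h =>
  coeffOf (fun a => c.normalBasis.coord h (P (c.point A a))) σ

/-- The coefficients of the restriction of a polynomial to the subspace with coordinates `A`. -/
def fibreCoef (P : θ.plane → θ.normal) (A : GrCoord d l) : FibreCoord k l m := fun ν h =>
  coeffOf (fun a => c.normalBasis.coord h (P (c.point A (Sum.elim 0 a)))) ν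

theorem flagCoef_eq {P : θ.plane → θ.normal} {A : GrCoord d l} {w : Idx k d l → Fin m → ℝ}
    (hw : ∀ h a, c.normalBasis.coord h (P (c.point A a)) = monoSum (fun σ => w σ h) a) :
    c.flagCoef P A = w := by
  funext σ h
  unfold flagCoef
  rw [funext (hw h), coeffOf_monoSum]

theorem fibreCoef_eq {P : θ.plane → θ.normal} {A : GrCoord d l} {v : FibreCoord k l m}
    (hv : ∀ h a, c.normalBasis.coord h (P (c.point A (Sum.elim 0 a))) =
      monoSum (fun ν => v ν h) a) :
    c.fibreCoef P A = v := by
  funext σ h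
  unfold fibreCoef
  rw [funext (hv h), coeffOf_monoSum]

theorem coord_point {P : θ.plane → θ.normal} (hP : P ∈ HomPoly θ.plane θ.normal (k + 1))
    (A : GrCoord d l) (h a) : c.normalBasis.coord h (P (c.point A a)) =
      monoSum (fun σ => c.flagCoef P A σ h) a := by
  obtain ⟨w, hw⟩ := HomPoly.exists_monoSum c.normalBasis
    (HomPoly.comp_linear hP (c.point A) LinearMap.id)
  rw [c.flagCoef_eq hw]
  exact hw h a

theorem coord_point_fibre {P : θ.plane → θ.normal} (hP : P ∈ HomPoly θ.plane θ.normal (k + 1))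
    (A : GrCoord d l) (h) (a : Fin l → ℝ) :
    c.normalBasis.coord h (P (c.point A (Sum.elim 0 a))) =
      monoSum (fun ν => c.fibreCoef P A ν h) a := by
  let f : (Fin l → ℝ) →ₗ[ℝ] (Fin d ⊕ Fin l → ℝ) :=
    { toFun := fun a => Sum.elim 0 a
      map_add' := fun a b => by funext s; rcases s with i | j <;> simp
      map_smul' := fun t a => by funext s; rcases s with i | j <;> simp }
  obtain ⟨w, hw⟩ := HomPoly.exists_monoSum c.normalBasis
    (HomPoly.comp_linear hP (c.point A ∘ₗ f) LinearMap.id)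
  rw [c.fibreCoef_eq (v := w) hw]
  exact hw h a

theorem fibreCoef_sub (P Q : θ.plane → θ.normal) (A : GrCoord d l) :
    c.fibreCoef (P - Q) A = c.fibreCoef P A - c.fibreCoef Q A := by
  funext ν h
  simp only [fibreCoef, Pi.sub_apply, map_sub, coeffOf_sub]

theorem fibreCoef_eq_zero {P : θ.plane → θ.normal} {A : GrCoord d l}
    (hP : ∀ r ∈ c.subspaceAt A, P r = 0) : c.fibreCoef P A = 0 := by
  funext ν h
  simp only [fibreCoef, hP _ (c.point_mem A _), map_zero]
  exact coeffOf_zero ν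

theorem eq_zero_of_fibreCoef {P : θ.plane → θ.normal} (hP : P ∈ HomPoly θ.plane θ.normal (k + 1))
    {A : GrCoord d l} (h0 : c.fibreCoef P A = 0) {r : θ.plane} (hr : r ∈ c.subspaceAt A) :
    P r = 0 := by
  obtain ⟨a, rfl⟩ := c.exists_point_of_mem hr
  refine c.normalBasis.ext_elem fun h => ?_
  rw [← Module.Basis.coord_apply, c.coord_point_fibre hP, h0]
  simp [monoSum]

theorem contDiff_coord_trivialPoly {N : WithTop ℕ∞} (h : Fin m) (a : Fin d ⊕ Fin l → ℝ) :
    ContDiff ℝ N fun p : FlagCoord k d l m =>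
      c.normalBasis.coord h (c.trivialPoly p.2 (c.point p.1 a)) := by
  simp only [coord_trivialPoly, y_point, x_point]
  fun_prop

theorem contDiff_fibreCoef_trivialPoly {N : WithTop ℕ∞} :
    ContDiff ℝ N fun p : FlagCoord k d l m => c.fibreCoef (c.trivialPoly p.2) p.1 :=
  contDiff_pi.2 fun ν => contDiff_pi.2 fun h =>
    contDiff_coeffOf (fun a => c.contDiff_coord_trivialPoly h (Sum.elim 0 a)) ν

theorem contDiff_flagCoef_trivialPoly {N : WithTop ℕ∞} :
    ContDiff ℝ N fun p : FlagCoord k d l m => c.flagCoef (c.trivialPoly p.2) p.1 :=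
  contDiff_pi.2 fun σ => contDiff_pi.2 fun h =>
    contDiff_coeffOf (fun a => c.contDiff_coord_trivialPoly h a) σ

theorem contDiff_fibreCoef {P : θ.plane → θ.normal}
    (hP : P ∈ HomPoly θ.plane θ.normal (k + 1)) : ContDiff ℝ ∞ (c.fibreCoef P) := by
  obtain ⟨u, rfl⟩ := c.exists_trivialPoly hP
  have h1 : ContDiff ℝ ∞ fun A : GrCoord d l => ((A, u) : FlagCoord k d l m) :=
    contDiff_id.prodMk contDiff_const
  have h2 := (c.contDiff_fibreCoef_trivialPoly (N := ∞)).comp h1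
  simp only [Function.comp_def] at h2
  exact h2

end Coords
end Coordinates

/-! ### Multi-indices of degree at most one in y. -/

section Reindexing

variable {k d l : ℕ}

theorem MIdx.ext_sum {σ τ : Idx k d l} (hl : σ.1 ∘ Sum.inl = τ.1 ∘ Sum.inl)
    (hr : σ.1 ∘ Sum.inr = τ.1 ∘ Sum.inr) : σ = τ := by
  refine Subtype.ext (funext fun s => ?_)
  rcases s with i | j
  · exact congrFun hl i
  · exact congrFun hr j

/-- The multi-index `(0, ν)`. -/
def zeroIdx (d : ℕ) (ν : IdxL k l) : Idx k d l :=
  ⟨Sum.elim 0 ν.1, by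
    rw [Finset.mem_piAntidiag]
    exact ⟨by simpa using MIdx.sum_eq ν, by simp⟩⟩

/-- The multi-index `(1_i, ν - 1_j)`. -/
def shiftIdx (i : Fin d) (j : Fin l) (ν : IdxL k l) (h : 0 < ν.1 j) : Idx k d l :=
  ⟨Sum.elim (Pi.single i 1) (ν.1 - Pi.single j 1), by
    rw [Finset.mem_piAntidiag]
    refine ⟨?_, by simp⟩
    have h1 : ∑ j', (ν.1 - Pi.single j 1 : Fin l → ℕ) j' + ∑ j', (Pi.single j 1 : Fin l → ℕ) j' = k + 1 := by
      rw [← Finset.sum_add_distrib]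
      refine Eq.trans ?_ (MIdx.sum_eq ν)
      refine Finset.sum_congr rfl fun j' _ => ?_
      rcases eq_or_ne j' j with rfl | hj
      · simp only [Pi.sub_apply, Pi.single_eq_same]
        omega
      · simp [hj]
    simp only [Finset.sum_pi_single', Finset.mem_univ, if_true] at h1
    simp only [Fintype.sum_sum_type, Sum.elim_inl, Sum.elim_inr, Finset.sum_pi_single',
      Finset.mem_univ, if_true]
    omega⟩

theorem sum_shiftIdx (i : Fin d) (j : Fin l) {σ : Idx k d l}
    (hσ : σ.1 ∘ Sum.inl = Pi.single i 1) :
    σ.1 ∘ Sum.inr + Pi.single j 1 ∈ Finset.piAntidiag Finset.univ (k + 1) := by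
  rw [Finset.mem_piAntidiag]
  refine ⟨?_, by simp⟩
  have h1 := MIdx.sum_eq σ
  have h2 : ∑ i', σ.1 (Sum.inl i') = 1 := by
    have : ∀ i', σ.1 (Sum.inl i') = (Pi.single i 1 : Fin d → ℕ) i' := congrFun hσ
    simp only [this, Finset.sum_pi_single', Finset.mem_univ, if_true]
  rw [Fintype.sum_sum_type, h2] at h1
  simp only [Pi.add_apply, Function.comp_apply, Finset.sum_add_distrib, Finset.sum_pi_single',
    Finset.mem_univ, if_true]
  omega

/-- The coefficients `w_{1_i, ν - 1_j}`, extended by zero. -/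
def shiftCoef (i : Fin d) (j : Fin l) (w : Idx k d l → ℝ) (ν : IdxL k l) : ℝ :=
  if h : 0 < ν.1 j then w (shiftIdx i j ν h) else 0

theorem monoSum_elim_zero (w : Idx k d l → ℝ) (a : Fin l → ℝ) :
    monoSum w (Sum.elim 0 a) = monoSum (fun ν : MIdx (Fin l) (k + 1) => w (zeroIdx d ν)) a := by
  have h1 : ∀ σ : Idx k d l, w σ * ∏ s, (Sum.elim 0 a : Fin d ⊕ Fin l → ℝ) s ^ σ.1 s =
      if σ.1 ∘ Sum.inl = 0 then w σ * ∏ j, a j ^ σ.1 (Sum.inr j) else 0 := by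
    intro σ
    simp only [Fintype.prod_sum_type, Sum.elim_inl, Sum.elim_inr, Pi.zero_apply]
    split_ifs with h
    · have : ∀ i, σ.1 (Sum.inl i) = 0 := congrFun h
      simp [this]
    · obtain ⟨i, hi⟩ := Function.ne_iff.1 h
      rw [Finset.prod_eq_zero (Finset.mem_univ i) (zero_pow hi), zero_mul, mul_zero]
  unfold monoSum
  rw [Finset.sum_congr rfl fun σ _ => h1 σ, ← Finset.sum_filter]
  refine Finset.sum_bij' (fun σ hσ => ⟨σ.1 ∘ Sum.inr, ?_⟩) (fun ν _ => zeroIdx d ν)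
    (fun _ _ => Finset.mem_univ _) (fun ν _ => ?_) (fun σ hσ => ?_) (fun ν _ => rfl)
    fun σ hσ => ?_
  · have h2 := MIdx.sum_eq σ
    have h3 : ∀ i, σ.1 (Sum.inl i) = 0 := congrFun (Finset.mem_filter.1 hσ).2
    rw [Finset.mem_piAntidiag]
    refine ⟨?_, by simp⟩
    rw [Fintype.sum_sum_type] at h2
    simpa [h3] using h2
  · exact Finset.mem_filter.2 ⟨Finset.mem_univ _, rfl⟩
  · exact MIdx.ext_sum (Finset.mem_filter.1 hσ).2.symm rfl
  · congr 2
    exact MIdx.ext_sum (Finset.mem_filter.1 hσ).2 rfl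

theorem hasDerivAt_prod_single (i : Fin d) (δ : Fin d → ℕ) :
    HasDerivAt (fun s : ℝ => ∏ i', (Pi.single i s : Fin d → ℝ) i' ^ δ i')
      (if δ = Pi.single i 1 then 1 else 0) 0 := by
  have h1 : (fun s : ℝ => ∏ i', (Pi.single i s : Fin d → ℝ) i' ^ δ i') =
      fun s => s ^ δ i * ∏ i' ∈ Finset.univ.erase i, (0 : ℝ) ^ δ i' := by
    funext s
    rw [← Finset.mul_prod_erase _ _ (Finset.mem_univ i), Pi.single_eq_same]
    congr 1
    refine Finset.prod_congr rfl fun i' hi' => ?_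
    rw [Pi.single_eq_of_ne (Finset.ne_of_mem_erase hi')]
  rw [h1]
  have h2 := (hasDerivAt_pow (δ i) (0 : ℝ)).mul_const
    (∏ i' ∈ Finset.univ.erase i, (0 : ℝ) ^ δ i')
  refine h2.congr_deriv (Eq.symm ?_)
  split_ifs with h
  · rw [Finset.prod_eq_one fun i' hi' => by
      rw [h, Pi.single_eq_of_ne (Finset.ne_of_mem_erase hi'), pow_zero]]
    simp [h]
  · by_cases hi : ∀ i' ≠ i, δ i' = 0
    · have h3 : δ i ≠ 1 := fun h3 => h (funext fun i' => by
        rcases eq_or_ne i' i with rfl | hne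
        · simp [h3]
        · simp [hne, hi i' hne])
      rcases Nat.lt_or_ge 1 (δ i) with h4 | h4
      · rw [zero_pow (by omega)]
        simp
      · have : δ i = 0 := by omega
        simp [this]
    · push Not at hi
      obtain ⟨i', hne, h0⟩ := hi
      rw [Finset.prod_eq_zero (Finset.mem_erase.2 ⟨hne, Finset.mem_univ _⟩) (zero_pow h0), mul_zero]

/-- At t = 0 only monomials with y-part exactly 1_i have a nonzero derivative. The inner factor a_j
raises the exponent of x_j by one, so the term (1_i, λ) contributes to the index λ + 1_j. -/
theorem hasDerivAt_monoSum_single (w : Idx k d l → ℝ) (i : Fin d) (j : Fin l) (a : Fin l → ℝ) :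
    HasDerivAt (fun t : ℝ => monoSum w (Sum.elim (Pi.single i (t * a j)) a))
      (monoSum (r := k + 1) (shiftCoef i j w) a) 0 := by
  have h1 : ∀ t : ℝ, monoSum w (Sum.elim (Pi.single i (t * a j)) a) =
      ∑ σ : Idx k d l, w σ * ((∏ i', (Pi.single i (t * a j) : Fin d → ℝ) i' ^ σ.1 (Sum.inl i')) *
        ∏ j', a j' ^ σ.1 (Sum.inr j')) := by
    intro t
    simp only [monoSum, Fintype.prod_sum_type, Sum.elim_inl, Sum.elim_inr]
  have h2 : ∀ σ ∈ (Finset.univ : Finset (Idx k d l)), HasDerivAt (fun t : ℝ => w σ *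
      ((∏ i', (Pi.single i (t * a j) : Fin d → ℝ) i' ^ σ.1 (Sum.inl i')) *
        ∏ j', a j' ^ σ.1 (Sum.inr j')))
      (w σ * ((if σ.1 ∘ Sum.inl = Pi.single i 1 then 1 else 0) * a j *
        ∏ j', a j' ^ σ.1 (Sum.inr j'))) 0 := by
    intro σ _
    refine HasDerivAt.const_mul _ (HasDerivAt.mul_const ?_ _)
    have h3 := hasDerivAt_prod_single i (σ.1 ∘ Sum.inl)
    have h4 : HasDerivAt (fun t : ℝ => t * a j) (a j) 0 := by
      simpa using (hasDerivAt_id (0 : ℝ)).mul_const (a j)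
    have h5 := HasDerivAt.comp (h := fun t : ℝ => t * a j) 0 (by rw [zero_mul]; exact h3) h4
    exact h5
  rw [funext h1]
  refine (HasDerivAt.fun_sum h2).congr_deriv ?_
  have h6 : ∀ σ : Idx k d l, w σ * ((if σ.1 ∘ Sum.inl = Pi.single i 1 then 1 else 0) * a j *
      ∏ j', a j' ^ σ.1 (Sum.inr j')) = if σ.1 ∘ Sum.inl = Pi.single i 1 then
        w σ * (a j * ∏ j', a j' ^ σ.1 (Sum.inr j')) else 0 := by
    intro σ
    split_ifs <;> simp
  have h7 : ∀ ν : IdxL k l, shiftCoef i j w ν * ∏ j', a j' ^ ν.1 j' =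
      if 0 < ν.1 j then shiftCoef i j w ν * ∏ j', a j' ^ ν.1 j' else 0 := by
    intro ν
    split_ifs with h
    · rfl
    · simp [shiftCoef, h]
  have hmon : ∀ μ : Fin l → ℕ, ∏ j', a j' ^ (μ + Pi.single j 1 : Fin l → ℕ) j' = a j * ∏ j', a j' ^ μ j' := by
    intro μ
    simp only [Pi.add_apply, pow_add, Finset.prod_mul_distrib]
    rw [mul_comm]
    congr 1
    rw [Finset.prod_eq_single j (fun j' _ hj => by simp [hj]) (by simp)]
    simp
  unfold monoSum
  rw [Finset.sum_congr rfl fun σ _ => h6 σ, Finset.sum_congr rfl fun ν _ => h7 ν,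
    ← Finset.sum_filter, ← Finset.sum_filter]
  refine Finset.sum_bij' (fun σ hσ => ⟨σ.1 ∘ Sum.inr + Pi.single j 1,
      sum_shiftIdx i j (Finset.mem_filter.1 hσ).2⟩)
    (fun ν hν => shiftIdx i j ν (Finset.mem_filter.1 hν).2)
    (fun σ hσ => Finset.mem_filter.2 ⟨Finset.mem_univ _, by simp⟩)
    (fun ν hν => Finset.mem_filter.2 ⟨Finset.mem_univ _, rfl⟩)
    (fun σ hσ => ?_) (fun ν hν => ?_) fun σ hσ => ?_
  · refine MIdx.ext_sum (Finset.mem_filter.1 hσ).2.symm ?_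
    funext j'
    simp [shiftIdx]
  · refine Subtype.ext (funext fun j' => ?_)
    have := (Finset.mem_filter.1 hν).2
    rcases eq_or_ne j' j with rfl | hj
    · simp [shiftIdx]
      omega
    · simp [shiftIdx, hj]
  · rw [hmon]
    congr 1
    have hpos : 0 < (σ.1 ∘ Sum.inr + Pi.single j 1 : Fin l → ℕ) j := by simp
    unfold shiftCoef
    rw [dif_pos hpos]
    congr 1
    refine MIdx.ext_sum (Finset.mem_filter.1 hσ).2 ?_
    funext j'
    simp [shiftIdx]

end Reindexing

/-! ### Derivatives of restricted coefficients along the Grassmannian. -/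

section Charts

variable {H : Type*} [NormedAddCommGroup H] [NormedSpace ℝ H] [FiniteDimensional ℝ H]
  {E : Type*} [TopologicalSpace E] [ChartedSpace H E] {n k : ℕ} {e : E}
  {θ : Jet H n k e} {d l m : ℕ}

namespace Coords

variable (c : Coords θ d l m)

/-! ### Derivatives of the coefficients along the Grassmannian -/

/-- Seen in the coordinates of the fixed plane A, tilting by t B displaces the vector with x = a by
t B a in the directions y - A x. All derivatives in A thus become derivatives of P transverse to the
fixed plane. -/
theorem point_add_smul (A B : GrCoord d l) (t : ℝ) (a : Fin l → ℝ) :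
    c.point (A + t • B) (Sum.elim 0 a) =
      c.point A (Sum.elim (fun i => t * ∑ j, B i j * a j) a) := by
  refine c.ext_coord (fun i => ?_) fun j => ?_
  · simp only [y_point, Sum.elim_inl, Sum.elim_inr, Pi.zero_apply, Pi.add_apply, Pi.smul_apply,
      smul_eq_mul, add_mul, Finset.sum_add_distrib, Finset.mul_sum, zero_add, mul_assoc]
    rw [add_comm]
  · simp only [x_point, Sum.elim_inr]

theorem point_add_smul' (A B : GrCoord d l) (t : ℝ) (a : Fin l → ℝ) :
    c.point (A + t • B) (Sum.elim 0 a) = c.point A (Sum.elim 0 a) +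
      t • c.point A (Sum.elim (fun i => ∑ j, B i j * a j) 0) := by
  rw [point_add_smul, ← map_smul, ← map_add]
  congr 1
  funext s
  rcases s with i | j <;> simp

theorem point_add_smul_single (A : GrCoord d l) (i : Fin d) (j : Fin l) (t : ℝ)
    (a : Fin l → ℝ) :
    c.point (A + t • (Pi.single i (Pi.single j 1) : GrCoord d l)) (Sum.elim 0 a) =
      c.point A (Sum.elim (Pi.single i (t * a j)) a) := by
  rw [point_add_smul]
  congr 2
  funext i'
  rcases eq_or_ne i' i with rfl | hi
  · simp [Pi.single_apply]
  · simp [hi]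

theorem hasDerivAt_fibreCoef {P : θ.plane → θ.normal}
    (hP : P ∈ HomPoly θ.plane θ.normal (k + 1)) (A B : GrCoord d l) (ν h) :
    HasDerivAt (fun t : ℝ => c.fibreCoef P (A + t • B) ν h)
      (fderiv ℝ (c.fibreCoef P) A B ν h) 0 := by
  have h1 : HasFDerivAt (c.fibreCoef P) (fderiv ℝ (c.fibreCoef P) A) A :=
    ((c.contDiff_fibreCoef hP).differentiable (by simp) A).hasFDerivAt
  have h2 : HasDerivAt (fun t : ℝ => c.fibreCoef P (A + t • B)) _ 0 := h1.hasLineDerivAt B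
  exact hasDerivAt_pi.1 (hasDerivAt_pi.1 h2 ν) h

theorem fderiv_fibreCoef_single {P : θ.plane → θ.normal}
    (hP : P ∈ HomPoly θ.plane θ.normal (k + 1)) (A : GrCoord d l) (i : Fin d) (j : Fin l) (ν h) :
    fderiv ℝ (c.fibreCoef P) A (Pi.single i (Pi.single j 1)) ν h =
      shiftCoef i j (fun σ => c.flagCoef P A σ h) ν := by
  refine (c.hasDerivAt_fibreCoef hP A _ ν h).unique ?_
  have h1 : ∀ a, HasDerivAt (fun t : ℝ => c.normalBasis.coord h
      (P (c.point (A + t • (Pi.single i (Pi.single j 1) : GrCoord d l)) (Sum.elim 0 a))))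
      (monoSum (r := k + 1) (shiftCoef i j fun σ => c.flagCoef P A σ h) a) 0 := by
    intro a
    simp only [point_add_smul_single, c.coord_point hP]
    exact hasDerivAt_monoSum_single _ i j a
  have h2 := hasDerivAt_coeffOf h1 ν
  rw [coeffOf_monoSum] at h2
  exact h2

/-- Moving the plane evaluates P along lines through points of L, and elements of μ_L^k vanish there
to second order. -/
theorem fderiv_fibreCoef_of_mem_mu {P : θ.plane → θ.normal} {A : GrCoord d l}
    (hP : P ∈ mu θ.normal (k + 1) (c.subspaceAt A) k) : fderiv ℝ (c.fibreCoef P) A = 0 := by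
  ext B ν h
  refine (c.hasDerivAt_fibreCoef (mu_le_homPoly _ _ hP) A B ν h).unique ?_
  have h1 : ∀ a, HasDerivAt (fun t : ℝ => c.normalBasis.coord h
      (P (c.point (A + t • B) (Sum.elim 0 a)))) 0 0 := by
    intro a
    simp only [point_add_smul']
    exact hasDerivAt_of_mem_mu hP _ (c.point_mem A a) _
  have h2 := hasDerivAt_coeffOf h1 ν
  rw [coeffOf_zero] at h2
  exact h2

theorem fderiv_fibreCoef_congr {P Q : θ.plane → θ.normal} {A : GrCoord d l}
    (hP : P ∈ HomPoly θ.plane θ.normal (k + 1)) (hQ : Q ∈ HomPoly θ.plane θ.normal (k + 1))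
    (hPQ : P - Q ∈ mu θ.normal (k + 1) (c.subspaceAt A) k) :
    fderiv ℝ (c.fibreCoef P) A = fderiv ℝ (c.fibreCoef Q) A := by
  have h1 := c.fderiv_fibreCoef_of_mem_mu hPQ
  have h2 : c.fibreCoef (P - Q) = c.fibreCoef P - c.fibreCoef Q :=
    funext fun A => c.fibreCoef_sub P Q A
  rw [h2, fderiv_sub ((c.contDiff_fibreCoef hP).differentiable (by simp) A)
    ((c.contDiff_fibreCoef hQ).differentiable (by simp) A)] at h1
  exact sub_eq_zero.1 h1

theorem fibreCoef_eq_flagCoef {P : θ.plane → θ.normal}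
    (hP : P ∈ HomPoly θ.plane θ.normal (k + 1)) (A : GrCoord d l) (ν h) :
    c.fibreCoef P A ν h = c.flagCoef P A (zeroIdx d ν) h := by
  refine congrFun (congrFun (c.fibreCoef_eq (v := fun ν h => c.flagCoef P A (zeroIdx d ν) h)
    fun h a => ?_) ν) h
  rw [c.coord_point hP, monoSum_elim_zero]

theorem fibreCoef_fibrePoly (v : FibreCoord k l m) (A : GrCoord d l) :
    c.fibreCoef (c.fibrePoly v) A = v :=
  c.fibreCoef_eq fun h a => by
    rw [coord_fibrePoly]
    simp only [x_point, Sum.elim_inr]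

theorem flagCoef_adaptedPoly (a : MCoord k d l m 1) :
    c.flagCoef (c.adaptedPoly 1 a) a.1 = extendLe a.2 :=
  c.flagCoef_eq fun h b => by
    rw [coord_adaptedPoly_eq_monoSum]
    congr 1
    funext s
    rcases s with i | j
    · simp [yA_point]
    · simp [x_point]

theorem flagCoef_sub (P Q : θ.plane → θ.normal) (A : GrCoord d l) :
    c.flagCoef (P - Q) A = c.flagCoef P A - c.flagCoef Q A := by
  funext ν h
  simp only [flagCoef, Pi.sub_apply, map_sub, coeffOf_sub]

/-- The coefficients of degree at most one in `y - A x` of an element of `μ_L^k` vanish. -/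
theorem flagCoef_eq_zero_of_mem_mu (hk : 1 ≤ k) {P : θ.plane → θ.normal} {A : GrCoord d l}
    (hP : P ∈ mu θ.normal (k + 1) (c.subspaceAt A) k) {σ : Idx k d l}
    (hσ : ∑ i, σ.1 (Sum.inl i) ≤ 1) (h : Fin m) : c.flagCoef P A σ h = 0 := by
  have hP' := mu_le_homPoly _ _ hP
  have hsum := MIdx.sum_eq σ
  rw [Fintype.sum_sum_type] at hsum
  by_cases h0 : ∀ i, σ.1 (Sum.inl i) = 0
  · have hmem : σ.1 ∘ Sum.inr ∈ Finset.piAntidiag Finset.univ (k + 1) := by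
      rw [Finset.mem_piAntidiag]
      refine ⟨?_, by simp⟩
      simpa [h0] using hsum
    have h1 : σ = zeroIdx d ⟨σ.1 ∘ Sum.inr, hmem⟩ := MIdx.ext_sum (funext h0) rfl
    rw [h1, ← c.fibreCoef_eq_flagCoef hP', c.fibreCoef_eq_zero fun r hr =>
      eq_zero_of_mem_mu k.le_succ hP hr]
    rfl
  · push Not at h0
    obtain ⟨i, hi⟩ := h0
    have h1 : σ.1 ∘ Sum.inl = Pi.single i 1 := by
      have h2 := Finset.add_sum_erase Finset.univ (fun i => σ.1 (Sum.inl i)) (Finset.mem_univ i)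
      funext i'
      rcases eq_or_ne i' i with rfl | hne
      · simp only [Function.comp_apply, Pi.single_eq_same]
        omega
      · rw [Pi.single_eq_of_ne hne]
        have h3 := Finset.single_le_sum (f := fun i => σ.1 (Sum.inl i)) (fun _ _ => Nat.zero_le _)
          (Finset.mem_erase.2 ⟨hne, Finset.mem_univ i'⟩)
        simp only [Function.comp_apply] at h3 ⊢
        omega
    -- The degree in x is k ≥ 1, so `Fin l` is nonempty. Any j serves: σ is the shift by j of ν = λ
    -- + 1_j, and its coefficient is a derivative of `fibreCoef`, which vanishes.
    obtain ⟨j, -⟩ : ∃ j, σ.1 (Sum.inr j) ≠ 0 := by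
      by_contra! hj
      simp only [hj, Finset.sum_const_zero] at hsum
      omega
    let ν : IdxL k l := ⟨_, sum_shiftIdx i j h1⟩
    have hpos : 0 < ν.1 j := by simp [ν]
    have h2 := c.fderiv_fibreCoef_single hP' A i j ν h
    rw [c.fderiv_fibreCoef_of_mem_mu hP] at h2
    unfold shiftCoef at h2
    rw [dif_pos hpos] at h2
    have h3 : σ = shiftIdx i j ν hpos := by
      refine MIdx.ext_sum h1 (funext fun j' => ?_)
      simp [ν, shiftIdx]
    rw [h3]
    exact h2.symm

/-- Removing the terms of degree at most one in y - A x leaves monomials with at least two factors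
vanishing on L, and k + 1 < k + 2. So adapted coordinates reach every point of M^1 over the chart.
-/
theorem sub_adaptedPoly_mem_mu {P : θ.plane → θ.normal}
    (hP : P ∈ HomPoly θ.plane θ.normal (k + 1)) (A : GrCoord d l) :
    P - c.adaptedPoly 1 (A, fun σ h => c.flagCoef P A ⟨σ.1, (Finset.mem_filter.1 σ.2).1⟩ h) ∈
      mu θ.normal (k + 1) (c.subspaceAt A) k := by
  set a : MCoord k d l m 1 :=
    (A, fun σ h => c.flagCoef P A ⟨σ.1, (Finset.mem_filter.1 σ.2).1⟩ h) with ha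
  have hQ : P - c.adaptedPoly 1 a ∈ HomPoly θ.plane θ.normal (k + 1) :=
    Submodule.sub_mem _ hP (c.adaptedPoly_mem a)
  refine mem_mu_of_coord c.normalBasis (Sum.elim (fun i => c.yA A i) fun j => c.x j)
    (w := c.flagCoef (P - c.adaptedPoly 1 a) A) (fun h r => ?_) _ _
    (Finset.univ.map Function.Embedding.inl) ?_ fun σ h hσ => ?_
  · have h1 := c.coord_point hQ A h (Sum.elim (fun i => c.yA A i r) fun j => c.x j r)
    rw [point_yA_x] at h1
    rw [h1]
    congr 1
    funext s
    rcases s with i | j <;> rfl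
  · intro s hs r hr
    obtain ⟨i, -, rfl⟩ := Finset.mem_map.1 hs
    exact (c.mem_subspaceAt A r).1 hr i
  · rw [Finset.sum_map]
    by_contra hlt
    refine hσ ?_
    have hle : ∑ i, σ.1 (Sum.inl i) ≤ 1 := by
      simp only [Function.Embedding.inl_apply] at hlt
      omega
    rw [flagCoef_sub]
    have h2 := c.flagCoef_adaptedPoly a
    simp only [ha] at h2 ⊢
    rw [h2, Pi.sub_apply, Pi.sub_apply]
    simp [extendLe, hle]

end Coords
end Charts

/-! ### The leaf spaces, their charts and the planes Q. -/

section Leaves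

variable {H : Type*} [NormedAddCommGroup H] [NormedSpace ℝ H] [FiniteDimensional ℝ H]
  {E : Type*} [TopologicalSpace E] [ChartedSpace H E] [IsManifold 𝓘(ℝ, H) ∞ E] {n k : ℕ} {e : E}
  {θ : Jet H n k e} {d l m : ℕ}

theorem sameLeaf_iff (hk : 1 ≤ k) (o : Ext θ) {p : ℕ} {X Y : Flag θ l} :
    SameLeaf θ l p X Y ↔ X.1 = Y.1 ∧ Y.2.diff o - X.2.diff o ∈ mu θ.normal (k + 1) X.1.1 p := by
  refine and_congr_right fun _ => ⟨?_, fun h => ⟨_, h, (isDiff_iff hk o).2 rfl⟩⟩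
  rintro ⟨P, hP, hd⟩
  rwa [← (isDiff_iff hk o).1 hd]

theorem samePartial_iff (hk : 1 ≤ k) (o : Ext θ) {X Y : Flag θ l} :
    SamePartial θ l X Y ↔ X.1 = Y.1 ∧ ∀ r ∈ X.1.1, (Y.2.diff o - X.2.diff o) r = 0 := by
  refine and_congr_right fun _ => ⟨?_, fun h => ⟨_, (isDiff_iff hk o).2 rfl, h⟩⟩
  rintro ⟨P, hd, hP⟩
  rwa [← (isDiff_iff hk o).1 hd]

/-- `M` is a quotient by a bare relation; being an equivalence, it can be recovered from equality of
classes. -/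
theorem sameLeaf_equivalence (hk : 1 ≤ k) (o : Ext θ) (p : ℕ) :
    Equivalence (SameLeaf θ l p) where
  refl X := (sameLeaf_iff hk o).2 ⟨rfl, by rw [sub_self]; exact Submodule.zero_mem _⟩
  symm {X Y} h := by
    rw [sameLeaf_iff hk o] at h ⊢
    refine ⟨h.1.symm, ?_⟩
    rw [← h.1, ← neg_sub]
    exact Submodule.neg_mem _ h.2
  trans {X Y Z} h h' := by
    rw [sameLeaf_iff hk o] at h h' ⊢
    refine ⟨h.1.trans h'.1, ?_⟩
    rw [← sub_add_sub_cancel _ (Y.2.diff o)]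
    refine Submodule.add_mem _ ?_ h.2
    rw [h.1]
    exact h'.2

theorem samePartial_equivalence (hk : 1 ≤ k) (o : Ext θ) :
    Equivalence (SamePartial θ l) where
  refl X := (samePartial_iff hk o).2 ⟨rfl, by simp⟩
  symm {X Y} h := by
    rw [samePartial_iff hk o] at h ⊢
    refine ⟨h.1.symm, fun r hr => ?_⟩
    rw [← neg_sub, Pi.neg_apply, h.2 r (h.1 ▸ hr), neg_zero]
  trans {X Y Z} h h' := by
    rw [samePartial_iff hk o] at h h' ⊢
    refine ⟨h.1.trans h'.1, fun r hr => ?_⟩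
    rw [← sub_add_sub_cancel _ (Y.2.diff o), Pi.add_apply, h.2 r hr, h'.2 r (h.1 ▸ hr), add_zero]

theorem toM_eq_iff (hk : 1 ≤ k) (o : Ext θ) {q : ℕ} {X Y : Flag θ l} :
    toM q X = toM q Y ↔
      X.1 = Y.1 ∧ Y.2.diff o - X.2.diff o ∈ mu θ.normal (k + 1) X.1.1 (k + 1 - q) := by
  rw [← sameLeaf_iff hk o, ← (sameLeaf_equivalence hk o _).eqvGen_iff]
  exact Quot.eq

theorem partialExt_mk_eq_iff (hk : 1 ≤ k) (o : Ext θ) {X Y : Flag θ l} :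
    (Quot.mk _ X : PartialExt θ l) = Quot.mk _ Y ↔
      X.1 = Y.1 ∧ ∀ r ∈ X.1.1, (Y.2.diff o - X.2.diff o) r = 0 := by
  rw [← samePartial_iff hk o, ← (samePartial_equivalence hk o).eqvGen_iff]
  exact Quot.eq

namespace Coords

variable (c : Coords θ d l m)

/-! ### The charts -/

theorem flagParam_injective (hk : 1 ≤ k) : Function.Injective c.flagParam := by
  rintro ⟨A, u⟩ ⟨A', u'⟩ h
  obtain rfl : A = A' := c.gr_injective (congrArg Prod.fst h)
  have h1 := congrArg (fun X : Flag θ l => X.2.diff c.orig) h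
  simp only [flagParam, Ext.diff_add hk _ (c.trivialPoly_mem _)] at h1
  rw [c.trivialPoly_injective h1]

theorem flagChart_flagParam (hk : 1 ≤ k) (p : FlagCoord k d l m) :
    c.flagChart (c.flagParam p) = p :=
  Function.leftInverse_invFun (c.flagParam_injective hk) p

theorem exists_flagParam (hk : 1 ≤ k) {X : Flag θ l} (hX : X.1 ∈ c.domain) :
    ∃ p, c.flagParam p = X := by
  obtain ⟨A, hA⟩ := c.exists_gr_eq hX
  obtain ⟨u, hu⟩ := c.exists_trivialPoly (Ext.diff_mem hk X.2 c.orig)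
  exact ⟨(A, u), Prod.ext hA (by simp only [flagParam, hu, Ext.add_diff hk])⟩

theorem mParam_injective (hk : 1 ≤ k) : Function.Injective (c.mParam 1) := by
  rintro ⟨A, v⟩ ⟨A', v'⟩ h
  obtain ⟨h1, h2⟩ := (toM_eq_iff hk c.orig).1 h
  obtain rfl : A = A' := c.gr_injective h1
  simp only [Ext.diff_add hk _ (c.adaptedPoly_mem _), Nat.add_sub_cancel] at h2
  congr 1
  funext σ h
  have h3 := c.flagCoef_eq_zero_of_mem_mu hk h2
    (σ := ⟨σ.1, (Finset.mem_filter.1 σ.2).1⟩) (Finset.mem_filter.1 σ.2).2 h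
  have h4 := c.flagCoef_adaptedPoly (A, v)
  have h5 := c.flagCoef_adaptedPoly (A, v')
  simp only at h4 h5
  rw [flagCoef_sub, h4, h5, Pi.sub_apply, Pi.sub_apply, sub_eq_zero] at h3
  simp only [extendLe, (Finset.mem_filter.1 σ.2).2, dif_pos] at h3
  exact h3.symm

/-- The adapted coordinates of a flag over the point of the Grassmannian with coordinates `A`. -/
def mCoef (P : θ.plane → θ.normal) (A : GrCoord d l) : MCoord k d l m 1 :=
  (A, fun σ h => c.flagCoef P A ⟨σ.1, (Finset.mem_filter.1 σ.2).1⟩ h)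

theorem mParam_mCoef (hk : 1 ≤ k) (A : GrCoord d l) (η : Ext θ) :
    c.mParam 1 (c.mCoef (η.diff c.orig) A) = toM 1 (c.gr A, η) := by
  refine (toM_eq_iff hk c.orig).2 ⟨rfl, ?_⟩
  simp only [Ext.diff_add hk _ (c.adaptedPoly_mem _), Nat.add_sub_cancel]
  exact c.sub_adaptedPoly_mem_mu (Ext.diff_mem hk _ _) A

theorem mChart_toM (hk : 1 ≤ k) (A : GrCoord d l) (η : Ext θ) :
    c.mChart 1 (toM 1 (c.gr A, η)) = c.mCoef (η.diff c.orig) A := by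
  rw [← c.mParam_mCoef hk]
  exact Function.leftInverse_invFun (c.mParam_injective hk) _

theorem partialParam_fibreCoef (hk : 1 ≤ k) (A : GrCoord d l) (η : Ext θ) :
    c.partialParam (A, c.fibreCoef (η.diff c.orig) A) = Quot.mk _ (c.gr A, η) := by
  refine (partialExt_mk_eq_iff hk c.orig).2 ⟨rfl, fun r hr => ?_⟩
  simp only [Ext.diff_add hk _ (c.fibrePoly_mem _)]
  refine c.eq_zero_of_fibreCoef (Submodule.sub_mem _ (Ext.diff_mem hk _ _) (c.fibrePoly_mem _))
    (A := A) ?_ hr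
  rw [fibreCoef_sub, fibreCoef_fibrePoly, sub_self]

theorem partialParam_injective (hk : 1 ≤ k) : Function.Injective c.partialParam := by
  rintro ⟨A, v⟩ ⟨A', v'⟩ h
  obtain ⟨h1, h2⟩ := (partialExt_mk_eq_iff hk c.orig).1 h
  obtain rfl : A = A' := c.gr_injective h1
  simp only [Ext.diff_add hk _ (c.fibrePoly_mem _)] at h2
  have h3 := c.fibreCoef_eq_zero h2
  rw [fibreCoef_sub, fibreCoef_fibrePoly, fibreCoef_fibrePoly, sub_eq_zero] at h3
  rw [h3]

theorem partialChart_partialParam (hk : 1 ≤ k) (p : PartialCoord k d l m) :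
    c.partialChart (c.partialParam p) = p :=
  Function.leftInverse_invFun (c.partialParam_injective hk) p

theorem partialChart_mk (hk : 1 ≤ k) (A : GrCoord d l) (η : Ext θ) :
    c.partialChart (Quot.mk _ (c.gr A, η)) = (A, c.fibreCoef (η.diff c.orig) A) := by
  rw [← c.partialParam_fibreCoef hk, c.partialChart_partialParam hk]

/-! ### The planes `Q` -/

theorem partialChart_comp_mParam (hk : 1 ≤ k) (a : MCoord k d l m 1) :
    (c.partialChart ∘ M.toPartial ∘ c.mParam 1) a =
      (a.1, c.fibreCoef (c.adaptedPoly 1 a) a.1) := by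
  have h1 := c.partialChart_mk hk a.1 (c.orig.add (c.adaptedPoly 1 a))
  rw [Ext.diff_add hk _ (c.adaptedPoly_mem _)] at h1
  exact h1

theorem contDiff_partialChart_comp_mParam (hk : 1 ≤ k) :
    ContDiff ℝ 1 (c.partialChart ∘ M.toPartial ∘ c.mParam 1) := by
  rw [funext (c.partialChart_comp_mParam hk)]
  refine contDiff_fst.prodMk (contDiff_pi.2 fun ν => contDiff_pi.2 fun h =>
    contDiff_coeffOf (f := fun (p : MCoord k d l m 1) a =>
      c.normalBasis.coord h (c.adaptedPoly 1 p (c.point p.1 (Sum.elim 0 a)))) (fun a => ?_) ν)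
  simp only [coord_adaptedPoly, yA_point, x_point]
  fun_prop

theorem contDiff_mCoef_trivialPoly :
    ContDiff ℝ 1 fun p : FlagCoord k d l m => c.mCoef (c.trivialPoly p.2) p.1 := by
  have h1 := c.contDiff_flagCoef_trivialPoly (N := 1)
  exact contDiff_fst.prodMk (contDiff_pi.2 fun σ => contDiff_pi.1 h1 _)

theorem mChart_comp_flagParam (hk : 1 ≤ k) :
    c.mChart 1 ∘ toM 1 ∘ c.flagParam = fun p => c.mCoef (c.trivialPoly p.2) p.1 := by
  funext p
  have h1 := c.mChart_toM hk p.1 (c.orig.add (c.trivialPoly p.2))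
  rw [Ext.diff_add hk _ (c.trivialPoly_mem _)] at h1
  exact h1

theorem partialChart_comp_flagParam (hk : 1 ≤ k) (p : FlagCoord k d l m) :
    (c.partialChart ∘ M.toPartial ∘ c.mParam 1) (c.mCoef (c.trivialPoly p.2) p.1) =
      (p.1, c.fibreCoef (c.trivialPoly p.2) p.1) := by
  have h1 := c.mParam_mCoef hk p.1 (c.orig.add (c.trivialPoly p.2))
  have h2 := c.partialChart_mk hk p.1 (c.orig.add (c.trivialPoly p.2))
  rw [Ext.diff_add hk _ (c.trivialPoly_mem _)] at h1 h2
  simp only [Function.comp_apply, h1]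
  exact h2

/-- The tangent map of the projection of the space of flags onto `M^0`. -/
theorem comp_tangentToM (hk : 1 ≤ k) (p : FlagCoord k d l m) :
    (fderiv ℝ (c.partialChart ∘ M.toPartial ∘ c.mParam 1)
      (c.mChart 1 (toM 1 (c.flagParam p)))).comp (c.tangentToM 1 (c.flagParam p)) =
      fderiv ℝ (fun p : FlagCoord k d l m =>
        ((p.1, c.fibreCoef (c.trivialPoly p.2) p.1) : PartialCoord k d l m)) p := by
  have h1 : c.mChart 1 (toM 1 (c.flagParam p)) = c.mCoef (c.trivialPoly p.2) p.1 :=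
    congrFun (c.mChart_comp_flagParam hk) p
  unfold tangentToM
  rw [c.flagChart_flagParam hk, h1, c.mChart_comp_flagParam hk,
    ← funext (c.partialChart_comp_flagParam hk)]
  exact (fderiv_comp (g := c.partialChart ∘ M.toPartial ∘ c.mParam 1)
    (f := fun p : FlagCoord k d l m => c.mCoef (c.trivialPoly p.2) p.1) p
    ((c.contDiff_partialChart_comp_mParam hk).differentiable (by simp) _)
    (c.contDiff_mCoef_trivialPoly.differentiable (by simp) p)).symm

theorem coord_trivialPoly_add_smul (u w : Idx k d l → Fin m → ℝ) (t : ℝ) (h : Fin m)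
    (r : θ.plane) : c.normalBasis.coord h (c.trivialPoly (u + t • w) r) =
      c.normalBasis.coord h (c.trivialPoly u r) + t * c.normalBasis.coord h (c.trivialPoly w r) := by
  simp only [coord_trivialPoly, Pi.add_apply, Pi.smul_apply, smul_eq_mul, add_mul,
    Finset.sum_add_distrib, Finset.mul_sum, mul_assoc]

/-- The projection is linear in u for fixed A, so the tangent vector is split into its A-part and
its u-part. -/
theorem fderiv_projection (p w : FlagCoord k d l m) :
    fderiv ℝ (fun p : FlagCoord k d l m =>
      ((p.1, c.fibreCoef (c.trivialPoly p.2) p.1) : PartialCoord k d l m)) p w =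
      (w.1, fderiv ℝ (c.fibreCoef (c.trivialPoly p.2)) p.1 w.1 +
        c.fibreCoef (c.trivialPoly w.2) p.1) := by
  let G : FlagCoord k d l m → FibreCoord k l m := fun p => c.fibreCoef (c.trivialPoly p.2) p.1
  have hG : HasFDerivAt G (fderiv ℝ G p) p :=
    ((c.contDiff_fibreCoef_trivialPoly (N := 1)).differentiable (by simp) p).hasFDerivAt
  have h1 := (hasFDerivAt_fst (𝕜 := ℝ) (p := p)).prodMk hG
  rw [h1.fderiv]
  change (w.1, fderiv ℝ G p w) = _
  have h2 : w = (w.1, 0) + (0, w.2) := by simp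
  have h3 : fderiv ℝ G p (w.1, 0) = fderiv ℝ (c.fibreCoef (c.trivialPoly p.2)) p.1 w.1 := by
    funext ν h
    have h4 : HasDerivAt (fun t : ℝ => G (p + t • ((w.1, 0) : FlagCoord k d l m))) _ 0 :=
      hG.hasLineDerivAt _
    refine (hasDerivAt_pi.1 (hasDerivAt_pi.1 h4 ν) h).unique ?_
    have h5 := c.hasDerivAt_fibreCoef (c.trivialPoly_mem p.2) p.1 w.1 ν h
    refine h5.congr_of_eventuallyEq (Filter.Eventually.of_forall fun t => ?_)
    simp [G]
  have h4 : fderiv ℝ G p (0, w.2) = c.fibreCoef (c.trivialPoly w.2) p.1 := by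
    funext ν h
    have h4 : HasDerivAt (fun t : ℝ => G (p + t • ((0, w.2) : FlagCoord k d l m))) _ 0 :=
      hG.hasLineDerivAt _
    refine (hasDerivAt_pi.1 (hasDerivAt_pi.1 h4 ν) h).unique ?_
    refine hasDerivAt_coeffOf (f := fun t a => c.normalBasis.coord h
      (c.trivialPoly (p + t • ((0, w.2) : FlagCoord k d l m)).2
        (c.point (p + t • ((0, w.2) : FlagCoord k d l m)).1 (Sum.elim 0 a)))) (fun a => ?_) ν
    simp only [Prod.snd_add, Prod.smul_snd, Prod.fst_add, Prod.smul_fst, smul_zero, add_zero,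
      coord_trivialPoly_add_smul]
    simpa using ((hasDerivAt_id (0 : ℝ)).mul_const (c.normalBasis.coord h
      (c.trivialPoly w.2 (c.point p.1 (Sum.elim 0 a))))).const_add (c.normalBasis.coord h
      (c.trivialPoly p.2 (c.point p.1 (Sum.elim 0 a))))
  conv_lhs => rw [h2, map_add, h3, h4]
  simp

theorem map_flagDist (p : FlagCoord k d l m) :
    (c.flagDist k (c.flagParam p)).map (fderiv ℝ (fun p : FlagCoord k d l m =>
      ((p.1, c.fibreCoef (c.trivialPoly p.2) p.1) : PartialCoord k d l m)) p).toLinearMap =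
      LinearMap.graph (fderiv ℝ (c.fibreCoef (c.trivialPoly p.2)) p.1).toLinearMap := by
  have h0 : c.fibreCoef (c.trivialPoly (k := k) 0) p.1 = 0 :=
    c.fibreCoef_eq_zero fun r _ => by simp [trivialPoly]
  refine le_antisymm ?_ fun v hv => ?_
  · unfold flagDist
    rw [Submodule.map_sup]
    refine sup_le ?_ ?_
    · rintro _ ⟨w, ⟨hw1, hw2⟩, rfl⟩
      rw [LinearMap.mem_graph_iff]
      rw [ContinuousLinearMap.coe_coe, fderiv_projection, hw1]
      rw [c.fibreCoef_eq_zero fun r hr => eq_zero_of_mem_mu le_rfl hw2 hr]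
      simp
    · rintro _ ⟨w, hw, rfl⟩
      have hw' : w.2 = 0 := hw
      rw [LinearMap.mem_graph_iff]
      rw [ContinuousLinearMap.coe_coe, fderiv_projection, hw', h0]
      simp
  · rw [LinearMap.mem_graph_iff] at hv
    refine ⟨(v.1, 0), Submodule.mem_sup_right (show (0 : Idx k d l → Fin m → ℝ) = 0 from rfl), ?_⟩
    rw [ContinuousLinearMap.coe_coe, fderiv_projection, h0, add_zero]
    exact Prod.ext rfl hv.symm

/-- `reducedDist` is a supremum over all flags above the point. Each contributes the same graph,
since two such flags differ by an element of μ_L^k, invisible to the first derivative of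
`fibreCoef`. -/
theorem qPlane_toM (hk : 1 ≤ k) (A : GrCoord d l) (η : Ext θ) :
    c.qPlane (toM 1 (c.gr A, η)) =
      LinearMap.graph (fderiv ℝ (c.fibreCoef (η.diff c.orig)) A).toLinearMap := by
  have key : ∀ X : Flag θ l, toM 1 X = toM 1 (c.gr A, η) →
      ((c.flagDist (k + 1 - 1) X).map (c.tangentToM 1 X).toLinearMap).map
        (fderiv ℝ (c.partialChart ∘ M.toPartial ∘ c.mParam 1)
          (c.mChart 1 (toM 1 (c.gr A, η)))).toLinearMap =
      LinearMap.graph (fderiv ℝ (c.fibreCoef (η.diff c.orig)) A).toLinearMap := by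
    intro X hX
    have h1 := (toM_eq_iff hk c.orig).1 hX
    obtain ⟨⟨A', u⟩, rfl⟩ := c.exists_flagParam hk (X := X) (by
      rw [h1.1]
      exact c.gr_mem_domain A)
    obtain rfl : A' = A := c.gr_injective h1.1
    have h2 := c.comp_tangentToM hk (A', u)
    have h3 := c.map_flagDist (A', u)
    rw [← h2, hX, ContinuousLinearMap.toLinearMap_comp, Submodule.map_comp] at h3
    refine h3.trans ?_
    have h4 := h1.2
    simp only [flagParam, Ext.diff_add hk _ (c.trivialPoly_mem _)] at h4
    rw [c.fderiv_fibreCoef_congr (Ext.diff_mem hk η c.orig) (c.trivialPoly_mem u) h4]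
  unfold qPlane reducedDist
  simp only [Submodule.map_iSup]
  exact le_antisymm (iSup₂_le fun X hX => (key X hX).le)
    (le_iSup₂_of_le (c.gr A, η) rfl (key _ rfl).ge)

end Coords
end Leaves

/-! ### Change of charts for 1-jets of sections. -/

theorem differentiableAt_det {X ι : Type*} [NormedAddCommGroup X] [NormedSpace ℝ X] [Fintype ι]
    [DecidableEq ι] {F : X → Matrix ι ι ℝ} {x : X}
    (hF : ∀ i j, DifferentiableAt ℝ (fun x => F x i j) x) :
    DifferentiableAt ℝ (fun x => (F x).det) x := by
  simp only [Matrix.det_apply']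
  fun_prop

theorem differentiableAt_inv_apply {X ι : Type*} [NormedAddCommGroup X] [NormedSpace ℝ X]
    [Fintype ι] [DecidableEq ι] {F : X → Matrix ι ι ℝ} {x : X}
    (hF : ∀ i j, DifferentiableAt ℝ (fun x => F x i j) x) (h0 : (F x).det ≠ 0) (i j : ι) :
    DifferentiableAt ℝ (fun x => (F x)⁻¹ i j) x := by
  simp only [Matrix.inv_def, Matrix.smul_apply, smul_eq_mul, Ring.inverse_eq_inv',
    Matrix.adjugate_apply]
  refine ((differentiableAt_det hF).inv h0).mul (differentiableAt_det fun i' j' => ?_)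
  rcases eq_or_ne i' j with rfl | hi
  · simp only [Matrix.updateRow_self]
    exact differentiableAt_const _
  · simp only [Matrix.updateRow_ne hi]
    exact hF i' j'

section ChartChange

variable {H : Type*} [NormedAddCommGroup H] [NormedSpace ℝ H] [FiniteDimensional ℝ H]
  {E : Type*} [TopologicalSpace E] [ChartedSpace H E] {n k : ℕ} {e : E}
  {θ : Jet H n k e} {d l m : ℕ}

namespace Coords

variable (c c' : Coords θ d l m)

theorem apply_point (f : Module.Dual ℝ θ.plane) (A : GrCoord d l) (a : Fin d ⊕ Fin l → ℝ) :
    f (c.point A a) = ∑ i, c.basis.repr f (Sum.inl i) * (a (Sum.inl i) +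
      ∑ j, A i j * a (Sum.inr j)) + ∑ j, c.basis.repr f (Sum.inr j) * a (Sum.inr j) := by
  conv_lhs => rw [← c.basis.sum_repr f]
  rw [LinearMap.sum_apply, Fintype.sum_sum_type]
  simp only [LinearMap.smul_apply, basis_point, smul_eq_mul]
  rfl

theorem contDiff_apply_point {N : WithTop ℕ∞} (f : Module.Dual ℝ θ.plane)
    (a : Fin d ⊕ Fin l → ℝ) : ContDiff ℝ N fun A : GrCoord d l => f (c.point A a) := by
  simp only [apply_point]
  fun_prop

/-- The `x`-coordinates with respect to `c` of the basis of a subspace given by `c'`. -/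
def transX (A : GrCoord d l) : Matrix (Fin l) (Fin l) ℝ :=
  Matrix.of fun j j' => c.x j (c'.point A (Sum.elim 0 (Pi.single j' 1)))

/-- The `y`-coordinates with respect to `c` of the basis of a subspace given by `c'`. -/
def transY (A : GrCoord d l) : Matrix (Fin d) (Fin l) ℝ :=
  Matrix.of fun i j' => c.y i (c'.point A (Sum.elim 0 (Pi.single j' 1)))

theorem point_elim_zero (A : GrCoord d l) (a : Fin l → ℝ) :
    c'.point A (Sum.elim 0 a) = ∑ j, a j • c'.point A (Sum.elim 0 (Pi.single j 1)) := by
  simp only [← map_smul, ← map_sum]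
  congr 1
  funext s
  rcases s with i | j
  · simp
  · simp [Pi.single_apply]

theorem transX_mulVec (A : GrCoord d l) (a : Fin l → ℝ) (j) :
    (c.transX c' A).mulVec a j = c.x j (c'.point A (Sum.elim 0 a)) := by
  rw [point_elim_zero, map_sum]
  simp [transX, Matrix.mulVec, dotProduct, mul_comm]

theorem transY_mulVec (A : GrCoord d l) (a : Fin l → ℝ) (i) :
    (c.transY c' A).mulVec a i = c.y i (c'.point A (Sum.elim 0 a)) := by
  rw [point_elim_zero, map_sum]
  simp [transY, Matrix.mulVec, dotProduct, mul_comm]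

/-- A kernel vector would give a nonzero element of L on which all x_j vanish, against
transversality. -/
theorem det_transX_ne_zero {A : GrCoord d l} (hA : c'.gr A ∈ c.domain) :
    (c.transX c' A).det ≠ 0 := by
  intro h0
  obtain ⟨a, ha, ha0⟩ := Matrix.exists_mulVec_eq_zero_iff.2 h0
  have hc : IsCompl (c'.subspaceAt A) (⨅ j, LinearMap.ker (c.x j)) := hA
  have h1 := Submodule.disjoint_def.1 hc.disjoint _ (c'.point_mem A a)
    ((c.mem_ker_x _).2 fun j => by rw [← transX_mulVec, ha0, Pi.zero_apply])
  refine ha (funext fun j => ?_)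
  have h2 := c'.x_point A (Sum.elim 0 a) j
  rw [h1, map_zero] at h2
  exact h2.symm

/-- The plane is parametrized by a ↦ (y, x) = (Y a, X a), hence satisfies y = Y X⁻¹ x. -/
theorem gr_trans {A : GrCoord d l} (hA : (c.transX c' A).det ≠ 0) :
    c.gr (fun i j => (c.transY c' A * (c.transX c' A)⁻¹) i j) = c'.gr A := by
  symm
  refine Subtype.ext (Submodule.eq_of_le_of_finrank_eq (fun r hr => ?_)
    ((c'.finrank_subspaceAt _).trans (c.finrank_subspaceAt _).symm))
  obtain ⟨a, rfl⟩ := c'.exists_point_of_mem hr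
  refine (c.mem_subspaceAt _ _).2 fun i => ?_
  rw [yA_apply, sub_eq_zero, ← transY_mulVec]
  simp only [← transX_mulVec]
  change _ = ((c.transY c' A * (c.transX c' A)⁻¹).mulVec ((c.transX c' A).mulVec a)) i
  rw [Matrix.mulVec_mulVec, Matrix.mul_assoc, Matrix.nonsing_inv_mul _ (isUnit_iff_ne_zero.2 hA),
    Matrix.mul_one]

theorem eventually_gr_mem_domain {A : GrCoord d l} (hA : c'.gr A ∈ c.domain) :
    ∀ᶠ B in 𝓝 A, c'.gr B ∈ c.domain ∧
      c.grChart (c'.gr B) = fun i j => (c.transY c' B * (c.transX c' B)⁻¹) i j := by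
  have h1 : ContinuousAt (fun B => (c.transX c' B).det) A :=
    (differentiableAt_det fun i j =>
      (c'.contDiff_apply_point (N := 1) (c.x i) _).differentiable (by simp) A).continuousAt
  filter_upwards [h1.eventually_ne (c.det_transX_ne_zero c' hA)] with B hB
  rw [← c.gr_trans c' hB]
  exact ⟨c.gr_mem_domain _, c.grChart_gr _⟩

theorem differentiableAt_grChart_gr {A : GrCoord d l} (hA : c'.gr A ∈ c.domain) :
    DifferentiableAt ℝ (fun B => c.grChart (c'.gr B)) A := by
  have h1 : DifferentiableAt ℝ (fun B : GrCoord d l => ((fun i j =>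
      (c.transY c' B * (c.transX c' B)⁻¹) i j) : GrCoord d l)) A := by
    refine differentiableAt_pi.2 fun i => differentiableAt_pi.2 fun j => ?_
    simp only [Matrix.mul_apply]
    refine DifferentiableAt.fun_sum fun j' _ => DifferentiableAt.mul ?_ ?_
    · exact (c'.contDiff_apply_point (N := 1) (c.y i) _).differentiable (by simp) A
    · exact differentiableAt_inv_apply (fun i j =>
        (c'.contDiff_apply_point (N := 1) (c.x i) _).differentiable (by simp) A)
        (c.det_transX_ne_zero c' hA) j' j
  refine h1.congr_of_eventuallyEq ?_
  filter_upwards [c.eventually_gr_mem_domain c' hA] with B hB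
  exact hB.2

theorem contDiff_fibreCoef_fibrePoly :
    ContDiff ℝ 1 fun p : PartialCoord k d l m => c'.fibreCoef (c.fibrePoly p.2) p.1 := by
  refine contDiff_pi.2 fun ν => contDiff_pi.2 fun h =>
    contDiff_coeffOf (f := fun (p : PartialCoord k d l m) a =>
      c'.normalBasis.coord h (c.fibrePoly p.2 (c'.point p.1 (Sum.elim 0 a)))) (fun a => ?_) ν
  simp only [fibrePoly, map_sum, map_smul, smul_eq_mul, apply_point]
  fun_prop

variable [IsManifold 𝓘(ℝ, H) ∞ E]

/-- On L the `fibrePoly` of the c-coordinates agrees with η - `c.orig`, so rereading it in c' and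
adding the shift of origins gives the c'-coordinates. The change of chart is thus a differentiable
function of B and the c-coordinates. -/
theorem sectionCoord_eq_trans (hk : 1 ≤ k) {s : Gr θ.plane l → PartialExt θ l}
    (hs : ∀ L, (s L).dir = L) {B : GrCoord d l} (hB : c'.gr B ∈ c.domain) :
    c'.sectionCoord s B = c'.fibreCoef (c.fibrePoly (c.sectionCoord s (c.grChart (c'.gr B)))) B +
      c'.fibreCoef (c.orig.diff c'.orig) B := by
  have h1 := c.gr_grChart hB
  obtain ⟨⟨L, η⟩, hη⟩ : ∃ X : Flag θ l, Quot.mk _ X = s (c'.gr B) := Quot.exists_rep _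
  have h2 : L = c'.gr B := by
    rw [← hs (c'.gr B), ← hη]
    rfl
  subst h2
  have h3 : c'.sectionCoord s B = c'.fibreCoef (η.diff c'.orig) B := by
    unfold sectionCoord
    rw [← hη, c'.partialChart_mk hk]
  have h4 : c.sectionCoord s (c.grChart (c'.gr B)) =
      c.fibreCoef (η.diff c.orig) (c.grChart (c'.gr B)) := by
    unfold sectionCoord
    have h5 := c.partialChart_mk hk (c.grChart (c'.gr B)) η
    rw [h1] at h5 ⊢
    rw [← hη, h5]
  have h5 : η.diff c.orig = η.diff c'.orig - c.orig.diff c'.orig :=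
    (isDiff_iff hk c'.orig).1 (isDiff_diff hk η c.orig)
  rw [h3, h4, eq_comm, ← sub_eq_zero, add_sub_right_comm]
  have h6 : c'.fibreCoef (η.diff c'.orig) B - c'.fibreCoef (c.orig.diff c'.orig) B =
      c'.fibreCoef (η.diff c.orig) B := by rw [h5, fibreCoef_sub]
  rw [sub_add, h6, ← fibreCoef_sub]
  refine c'.fibreCoef_eq_zero fun r hr => ?_
  have hr' : r ∈ c.subspaceAt (c.grChart (c'.gr B)) := by
    change r ∈ (c.gr (c.grChart (c'.gr B))).1
    rw [h1]
    exact hr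
  refine c.eq_zero_of_fibreCoef (Submodule.sub_mem _ (c.fibrePoly_mem _) (Ext.diff_mem hk _ _))
    (A := c.grChart (c'.gr B)) ?_ hr'
  rw [fibreCoef_sub, fibreCoef_fibrePoly, sub_self]

/-- Local sections with the same 1-jet in one chart have the same 1-jet in every chart. -/
theorem fderiv_sectionCoord_congr (hk : 1 ≤ k) {s t : Gr θ.plane l → PartialExt θ l}
    (hs : ∀ L, (s L).dir = L) (ht : ∀ L, (t L).dir = L) {L : Gr θ.plane l} (hL : L ∈ c.domain)
    (hL' : L ∈ c'.domain) (hst : s L = t L)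
    (hsd : DifferentiableAt ℝ (c.sectionCoord s) (c.grChart L))
    (htd : DifferentiableAt ℝ (c.sectionCoord t) (c.grChart L))
    (h : fderiv ℝ (c.sectionCoord s) (c.grChart L) = fderiv ℝ (c.sectionCoord t) (c.grChart L)) :
    fderiv ℝ (c'.sectionCoord s) (c'.grChart L) = fderiv ℝ (c'.sectionCoord t) (c'.grChart L) := by
  set B := c'.grChart L with hB
  have hBL : c'.gr B = L := c'.gr_grChart hL'
  have hBd : c'.gr B ∈ c.domain := by rwa [hBL]
  let Ψ : PartialCoord k d l m → FibreCoord k l m := fun p =>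
    c'.fibreCoef (c.fibrePoly p.2) p.1
  -- By the chain rule the derivative in c' is expressed through the section only by its value and
  -- derivative in c.
  have key : ∀ {s : Gr θ.plane l → PartialExt θ l}, (∀ L, (s L).dir = L) →
      DifferentiableAt ℝ (c.sectionCoord s) (c.grChart L) →
      HasFDerivAt (c'.sectionCoord s)
        ((fderiv ℝ Ψ (B, c.sectionCoord s (c.grChart L))).comp
          ((ContinuousLinearMap.id ℝ (GrCoord d l)).prod
            ((fderiv ℝ (c.sectionCoord s) (c.grChart L)).comp
              (fderiv ℝ (fun B => c.grChart (c'.gr B)) B))) +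
          fderiv ℝ (c'.fibreCoef (c.orig.diff c'.orig)) B) B := by
    intro s hs hsd
    have h1 : HasFDerivAt (fun B => c.grChart (c'.gr B))
        (fderiv ℝ (fun B => c.grChart (c'.gr B)) B) B :=
      (c.differentiableAt_grChart_gr c' hBd).hasFDerivAt
    have h2 : HasFDerivAt (c.sectionCoord s) (fderiv ℝ (c.sectionCoord s) (c.grChart L))
        (c.grChart (c'.gr B)) := by
      rw [hBL]
      exact hsd.hasFDerivAt
    have h3 := (hasFDerivAt_id (𝕜 := ℝ) B).prodMk (h2.comp B h1)
    have h4 : HasFDerivAt Ψ (fderiv ℝ Ψ (B, c.sectionCoord s (c.grChart L)))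
        (B, c.sectionCoord s (c.grChart (c'.gr B))) := by
      rw [hBL]
      exact ((c.contDiff_fibreCoef_fibrePoly c').differentiable (by simp) _).hasFDerivAt
    have h5 : HasFDerivAt (c'.fibreCoef (c.orig.diff c'.orig))
        (fderiv ℝ (c'.fibreCoef (c.orig.diff c'.orig)) B) B :=
      ((c'.contDiff_fibreCoef (Ext.diff_mem hk _ _)).differentiable (by simp) B).hasFDerivAt
    refine ((HasFDerivAt.comp (g := Ψ) B h4 h3).add h5).congr_of_eventuallyEq ?_
    filter_upwards [c.eventually_gr_mem_domain c' hBd] with B' hB'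
    exact c.sectionCoord_eq_trans c' hk hs hB'.1
  have hv : c.sectionCoord s (c.grChart L) = c.sectionCoord t (c.grChart L) := by
    unfold sectionCoord
    rw [c.gr_grChart hL, hst]
  rw [(key hs hsd).fderiv, (key ht htd).fderiv, hv, h]

end Coords
end ChartChange

/-! ### Jets representing Q and the pasting conditions. -/

section Representation

variable {H : Type*} [NormedAddCommGroup H] [NormedSpace ℝ H] [FiniteDimensional ℝ H]
  {E : Type*} [TopologicalSpace E] [ChartedSpace H E] [IsManifold 𝓘(ℝ, H) ∞ E] {n k : ℕ} {e : E}
  {θ : Jet H n k e} {d l m : ℕ}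

theorem Coords.sectionCoord_const (c : Coords θ d l m) (hk : 1 ≤ k) (η : Ext θ) :
    c.sectionCoord (fun L => Quot.mk _ (L, η)) = c.fibreCoef (η.diff c.orig) := by
  funext A
  unfold Coords.sectionCoord
  rw [c.partialChart_mk hk]

/-- The section of partial extensions defined by an extension of `θ`. -/
def constSection (d m : ℕ) (hk : 1 ≤ k) (X : Flag θ l) : LocalSection θ d l m where
  base := X.1
  toFun L := Quot.mk _ (L, X.2)
  isSection _ := rfl
  smooth c _ := Filter.Eventually.of_forall fun A => by
    rw [c.sectionCoord_const hk]
    exact (c.contDiff_fibreCoef (Ext.diff_mem hk _ _)).contDiffAt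

/-- The 1-jet at a flag of the section defined by its extension of `θ`. -/
def constJet (d m : ℕ) (hk : 1 ≤ k) (X : Flag θ l) : FirstJet θ d l m :=
  Quotient.mk (jetSetoid θ d l m) (constSection d m hk X)

theorem deriv_mk (c : Coords θ d l m) {s : LocalSection θ d l m} (hs : s.base ∈ c.domain) :
    FirstJet.deriv c (Quotient.mk (jetSetoid θ d l m) s) =
      fderiv ℝ (c.sectionCoord s.toFun) (c.grChart s.base) := by
  simp only [FirstJet.deriv, Quotient.lift_mk, if_pos hs]

theorem deriv_constJet (hk : 1 ≤ k) (c : Coords θ d l m) {X : Flag θ l} (hX : X.1 ∈ c.domain) :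
    (constJet d m hk X).deriv c =
      fderiv ℝ (c.fibreCoef (X.2.diff c.orig)) (c.grChart X.1) := by
  rw [← c.sectionCoord_const hk]
  exact deriv_mk c hX

/-- The same section, with η held constant, works in every chart, because `qPlane_toM` holds for
arbitrary coordinates. -/
theorem represents_constJet (hk : 1 ≤ k) (X : Flag θ l) :
    Represents (constJet d m hk X) (toM 1 X) := by
  refine ⟨rfl, fun c hc => ?_⟩
  have hX : X.1 ∈ c.domain := hc
  have h1 := c.qPlane_toM hk (c.grChart X.1) X.2
  rw [c.gr_grChart hX] at h1
  unfold FirstJet.plane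
  rw [deriv_constJet hk c hX]
  exact h1.symm

theorem FirstJet.dir_value (J : FirstJet θ d l m) : J.value.dir = J.base := by
  induction J using Quotient.inductionOn with
  | h s => exact s.isSection s.base

theorem FirstJet.ext {J J' : FirstJet θ d l m} (hv : J.value = J'.value)
    (hd : ∀ c : Coords θ d l m, J.base ∈ c.domain → J.deriv c = J'.deriv c) : J = J' := by
  have hb : J.base = J'.base := by rw [← J.dir_value, hv, J'.dir_value]
  induction J using Quotient.inductionOn with
  | h s =>
    induction J' using Quotient.inductionOn with
    | h t =>
      refine Quotient.sound ⟨hb, hv, fun c hc => ?_⟩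
      have hc' : t.base ∈ c.domain := by rwa [← show s.base = t.base from hb]
      rw [← deriv_mk c hc, ← deriv_mk c hc']
      exact hd c hc

theorem Represents.unique {J J' : FirstJet θ d l m} {φ : M θ l 1} (h : Represents J φ)
    (h' : Represents J' φ) : J = J' := by
  have hv : J.value = J'.value := h.1.trans h'.1.symm
  have hb : J.base = J'.base := by rw [← J.dir_value, hv, J'.dir_value]
  refine FirstJet.ext hv fun c hc => ?_
  have hp : J.plane c = J'.plane c := (h.2 c hc).trans (h'.2 c (hb ▸ hc)).symm
  ext1 B
  have h1 : (B, J.deriv c B) ∈ J'.plane c := by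
    rw [← hp]
    exact (LinearMap.mem_graph_iff _ _).2 rfl
  exact (LinearMap.mem_graph_iff _ _).1 h1

/-- A 1-jet of sections is determined by its value and its first derivatives in one chart. -/
theorem FirstJet.ext_of_chart (hk : 1 ≤ k) (c : Coords θ d l m) {J J' : FirstJet θ d l m}
    (hc : J.base ∈ c.domain) (hv : J.value = J'.value) (hd : J.deriv c = J'.deriv c) :
    J = J' := by
  have hb : J.base = J'.base := by rw [← J.dir_value, hv, J'.dir_value]
  induction J using Quotient.inductionOn with
  | h s =>
    induction J' using Quotient.inductionOn with
    | h t =>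
      have hb' : s.base = t.base := hb
      have hcs : s.base ∈ c.domain := hc
      have hct : t.base ∈ c.domain := hb' ▸ hcs
      refine Quotient.sound ⟨hb, hv, fun c' hc' => ?_⟩
      have hv' : s.toFun s.base = t.toFun t.base := hv
      rw [deriv_mk c hcs, deriv_mk c hct] at hd
      rw [← hb'] at hd hv' ⊢
      refine c.fderiv_sectionCoord_congr c' hk s.isSection t.isSection hcs hc' hv' ?_ ?_ hd
      · exact ((s.smooth c hcs).self_of_nhds).differentiableAt (by simp)
      · rw [hb']
        exact ((t.smooth c hct).self_of_nhds).differentiableAt (by simp)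

theorem partialDeriv_constJet (hk : 1 ≤ k) (c : Coords θ d l m) {X : Flag θ l}
    (hX : X.1 ∈ c.domain) (i j ν h) : (constJet d m hk X).partialDeriv c i j ν h =
      shiftCoef i j (fun σ => c.flagCoef (X.2.diff c.orig) (c.grChart X.1) σ h) ν := by
  unfold FirstJet.partialDeriv
  rw [deriv_constJet hk c hX]
  exact c.fderiv_fibreCoef_single (Ext.diff_mem hk _ _) _ i j ν h

/-- Both sides of the first condition are literally the coefficient of index (1_i, λ - 1_j); the
second is the zero default of `shiftCoef`. -/
theorem pastingConditions_constJet (hk : 1 ≤ k) (c : Coords θ d l m) {X : Flag θ l}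
    (hX : X.1 ∈ c.domain) : PastingConditions c (constJet d m hk X) := by
  refine ⟨fun i j j' ν ν' h hν hν' heq => ?_, fun i j ν h hν => ?_⟩
  · rw [partialDeriv_constJet hk c hX, partialDeriv_constJet hk c hX]
    unfold shiftCoef
    rw [dif_pos hν, dif_pos hν']
    congr 1
    exact Subtype.ext (by simp only [shiftIdx, heq])
  · rw [partialDeriv_constJet hk c hX]
    unfold shiftCoef
    rw [dif_neg (by omega)]

/-- The pasting conditions are exactly what is needed to assemble values and first derivatives
into the coefficients of degree at most one of a polynomial. -/
theorem exists_coefficients (v : FibreCoord k l m)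
    (D : Fin d → Fin l → IdxL k l → Fin m → ℝ)
    (hD : ∀ (i : Fin d) (j j' : Fin l) (ν ν' : IdxL k l) (h : Fin m),
      0 < ν.1 j → 0 < ν'.1 j' → ν.1 - Pi.single j 1 = ν'.1 - Pi.single j' 1 →
        D i j ν h = D i j' ν' h) :
    ∃ w : Idx k d l → Fin m → ℝ, (∀ ν h, w (zeroIdx d ν) h = v ν h) ∧
      ∀ i j ν h (hν : 0 < ν.1 j), w (shiftIdx i j ν hν) h = D i j ν h := by
  classical
  refine ⟨fun σ h => if h0 : ∃ ν, σ = zeroIdx d ν then v h0.choose h else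
    if h1 : ∃ p : Fin d × Fin l × IdxL k l, ∃ hp : 0 < p.2.2.1 p.2.1,
      σ = shiftIdx p.1 p.2.1 p.2.2 hp then
      D h1.choose.1 h1.choose.2.1 h1.choose.2.2 h else 0, fun ν h => ?_, fun i j ν h hν => ?_⟩
  · have h0 : ∃ ν', zeroIdx d ν = zeroIdx d ν' := ⟨ν, rfl⟩
    beta_reduce
    rw [dif_pos h0]
    congr 1
    have h2 := h0.choose_spec
    refine Subtype.ext (funext fun j => ?_)
    exact (congrFun (congrArg Subtype.val h2) (Sum.inr j)).symm
  · have h0 : ¬ ∃ ν', shiftIdx i j ν hν = zeroIdx d ν' := by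
      rintro ⟨ν', h2⟩
      have h3 := congrFun (congrArg Subtype.val h2) (Sum.inl i)
      simp [shiftIdx, zeroIdx] at h3
    have h1 : ∃ p : Fin d × Fin l × IdxL k l, ∃ hp : 0 < p.2.2.1 p.2.1,
        shiftIdx i j ν hν = shiftIdx p.1 p.2.1 p.2.2 hp := ⟨(i, j, ν), hν, rfl⟩
    beta_reduce
    rw [dif_neg h0, dif_pos h1]
    obtain ⟨hp, h2⟩ := h1.choose_spec
    -- The chosen triple may differ from (i, j, ν). Equality of the multi-indices forces the same i
    -- and the same ν - 1_j, and the hypothesis `hD` then makes the values agree.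
    generalize h1.choose = p at hp h2
    have h3 : (Pi.single i 1 : Fin d → ℕ) = Pi.single p.1 1 :=
      funext fun i' => congrFun (congrArg Subtype.val h2) (Sum.inl i')
    have h4 : i = p.1 := by
      by_contra hne
      have := congrFun h3 i
      simp [hne] at this
    rw [← h4]
    exact hD i _ _ _ _ h hp hν
      (funext fun j' => (congrFun (congrArg Subtype.val h2) (Sum.inr j')).symm)

theorem exists_represents_of_pasting (hk : 1 ≤ k) (c : Coords θ d l m) {J : FirstJet θ d l m}
    (hJ : J.base ∈ c.domain) (hP : PastingConditions c J) : ∃ φ, Represents J φ := by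
  obtain ⟨⟨L, η₀⟩, hη₀⟩ : ∃ X : Flag θ l, Quot.mk _ X = J.value := Quot.exists_rep _
  obtain rfl : L = J.base := by
    rw [← J.dir_value, ← hη₀]
    rfl
  set A := c.grChart J.base with hA
  have hAL : c.gr A = J.base := c.gr_grChart hJ
  obtain ⟨w, hw0, hw1⟩ := exists_coefficients (c.fibreCoef (η₀.diff c.orig) A)
    (fun i j ν h => J.partialDeriv c i j ν h) hP.1
  -- The point of M^1 sought: its coefficients with δ = 0 are the values of J, those with δ = 1_i
  -- the derivatives of J. The constant section of the resulting extension then has 1-jet J, which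
  -- suffices to check in the chart c.
  let a : MCoord k d l m 1 := (A, fun σ h => w ⟨σ.1, (Finset.mem_filter.1 σ.2).1⟩ h)
  let X : Flag θ l := (J.base, c.orig.add (c.adaptedPoly 1 a))
  have hdiff : X.2.diff c.orig = c.adaptedPoly 1 a := Ext.diff_add hk _ (c.adaptedPoly_mem a)
  have hcoef : ∀ σ : Idx k d l, ∑ i, σ.1 (Sum.inl i) ≤ 1 → ∀ h,
      c.flagCoef (X.2.diff c.orig) A σ h = w σ h := by
    intro σ hσ h
    have h1 := c.flagCoef_adaptedPoly a
    rw [hdiff]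
    rw [show c.flagCoef (c.adaptedPoly 1 a) A = Coords.extendLe a.2 from h1]
    simp [Coords.extendLe, hσ, a]
  have hJX : J = constJet d m hk X := by
    refine FirstJet.ext_of_chart hk c hJ ?_ ?_
    · change J.value = Quot.mk _ X
      rw [← hη₀]
      change Quot.mk _ (J.base, η₀) = Quot.mk _ (J.base, X.2)
      rw [← hAL, ← c.partialParam_fibreCoef hk, ← c.partialParam_fibreCoef hk]
      congr 2
      funext ν h
      rw [c.fibreCoef_eq_flagCoef (Ext.diff_mem hk X.2 c.orig), hcoef, hw0]
      simp [zeroIdx]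
    · have hpd : ∀ i j ν h, J.partialDeriv c i j ν h =
          (constJet d m hk X).partialDeriv c i j ν h := by
        intro i j ν h
        rw [partialDeriv_constJet hk c hJ]
        unfold shiftCoef
        split_ifs with hν
        · refine ((hcoef _ ?_ h).trans (hw1 i j ν h hν)).symm
          simp [shiftIdx]
        · exact hP.2 i j ν h (by omega)
      ext1 B
      have hB : B = ∑ i, ∑ j, B i j • (Pi.single i (Pi.single j 1) : GrCoord d l) := by
        funext i' j'
        simp [Finset.sum_apply, Pi.single_apply, ite_apply]
      rw [hB]
      simp only [map_sum, map_smul]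
      refine Finset.sum_congr rfl fun i _ => Finset.sum_congr rfl fun j _ => ?_
      congr 1
      funext ν h
      exact hpd i j ν h
  exact ⟨toM 1 X, hJX ▸ represents_constJet hk X⟩

end Representation
end PolarJets

end

open PolarJets in
theorem mainTheorem6
    {H : Type*} [NormedAddCommGroup H] [NormedSpace ℝ H] [FiniteDimensional ℝ H]
    {E : Type*} [TopologicalSpace E] [ChartedSpace H E] [IsManifold 𝓘(ℝ, H) ∞ E]
    (d l m k : ℕ) (hk : 1 ≤ k) (hE : Module.finrank ℝ H = d + l + m)
    (e : E) (θ : Jet H (d + l) k e) :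
    (∀ φ : M θ l 1, ∃! J : FirstJet θ d l m, Represents J φ) ∧
    ∀ c : Coords θ d l m,
      {J : FirstJet θ d l m | J.base ∈ c.domain ∧ ∃ φ : M θ l 1, Represents J φ} =
        {J : FirstJet θ d l m | J.base ∈ c.domain ∧ PastingConditions c J} := by
  have hex : ∀ φ : M θ l 1, ∃ X : Flag θ l, toM 1 X = φ := fun φ => Quot.exists_rep φ
  refine ⟨fun φ => ?_, fun c => Set.ext fun J => and_congr_right fun hJ => ⟨?_, ?_⟩⟩
  · obtain ⟨X, rfl⟩ := hex φ
    exact ⟨constJet d m hk X, represents_constJet hk X,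
      fun J hJ => hJ.unique (represents_constJet hk X)⟩
  · rintro ⟨φ, hφ⟩
    obtain ⟨X, rfl⟩ := hex φ
    -- Uniqueness of the representing jet allows J to be replaced by the constant-extension jet.
    obtain rfl := hφ.unique (represents_constJet hk X)
    exact pastingConditions_constJet hk c hJ
  · exact exists_represents_of_pasting hk c hJ
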